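/- Let $(M;\phi,\xi,\lambda,g)$ be a contact metric manifold of dimension $2m+1$: $\lambda$ is a contact form with Reeb field $\xi$, $g$ is a Riemannian metric, and, with $\omega=d\lambda=\frac12\omega_{ij}dx^i\wedge dx^j$, $\omega_{ij}=\partial_i\lambda_j-\partial_j\lambda_i$, $$\lambda(X)=g(X,\xi),\quad \omega(X,Y)=g(X,\phi Y),\quad g(\phi X,\phi Y)=g(X,Y)-\lambda(X)\lambda(Y),\quad \phi^2=-I+\xi\otimes\lambda,\quad \phi\xi=0,\quad \lambda\circ\phi=0.$$ Let $\pi^{ij}=g^{ik}\phi^j_k$, $h^{ij}=g^{ij}+\sqrt{-1}\,\pi^{ij}$, let $\nabla^g$ be the Levi-Civita connection, and let $\nabla=\nabla^g+S$, $\nabla_kv^i=\nabla^g_kv^i+S^i_{jk}v^j$, be the contact metric connection with $$S^i_{jk}=-\tfrac12\phi^i_l\nabla^g_k\phi^l_j-\tfrac12\lambda_j\nabla^g_k\xi^i+\xi^i\nabla^g_k\lambda_j .$$ Let $T^i_{jk}=S^i_{jk}-S^i_{kj}$, and let $R^i_{jkl}$ be the curvature, $[\nabla_k,\nabla_l]v^i=R^i_{jkl}v^j+T^j_{kl}\nabla_jv^i$;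 put $T=\frac12\omega_{kn}T^n_{ij}\,y^kdx^i\wedge dx^j$ and $R=-\frac14\omega_{in}R^n_{jkl}\,y^iy^jdx^k\wedge dx^l$. Let $W$ be the bundle of formal power series in the fibre coordinates $y^i$ of $TM$ and in $\nu$ with complex coefficients, with the product $(a\circ b)(y)=\exp\big(\frac\nu2h^{ij}\frac{\partial^2}{\partial y^i\partial z^j}\big)a(y)b(z)\big|_{z=y}$, extended to $W$-valued forms; $[\cdot,\cdot]$ is the graded commutator, $\delta=dx^i\wedge\partial/\partial y^i$, and $d_\nabla=dx^i\wedge\nabla_i$ with $\nabla_ia=\partial_ia-y^j\Gamma^k_{ji}\,\partial a/\partial y^k$, where $\Gamma$ are the coefficients of $\nabla$. Let $\delta^*=y^iP^j_i\,i_{\partial/\partial x^j}$ with $P^i_j=\delta^i_j-\xi^i\lambda_j$. On $n$-forms of polynomial degree $q$ in $y$, let $\delta^{-1}=\frac1{q+n}\delta^*$ on forms annihilated by $i_\xi$ and $\delta^{-1}=\frac1{q+n-1}\delta^*$ on multiples of $\lambda$ (zero where the denominator vanishes). Let $\Pi a=a|_{y=0,\,dx=0}+\lambda\,(i_\xi a)|_{y=0,\,dx=0}$.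 Let the $W$-valued one-form $r$ be the solution, obtained by iteration from $0$, of $$r=\delta^{-1}(T+R)+\delta^{-1}\big(d_\nabla r+\tfrac{\sqrt{-1}}\nu\,r\circ r\big),\qquad\text{and put}\qquad Da=d_\nabla a-\delta a+\tfrac{\sqrt{-1}}\nu[r,a].$$ For $a\in C^\infty(M,\mathbb C)[[\nu]]$ let $b=Qa$ be the solution, obtained by iteration from $a$, of $b=a+\delta^{-1}(D+\delta)b$. Let $\Delta=i_\xi\Pi DQ=\sum_{k\ge0}\nu^k\Delta_k$. **Proposition.** One has $\Delta_0=\xi$ and, in every chart, for every $a\in C^\infty(M,\mathbb C)$, $$\Delta_1a=-\tfrac14(\mathcal L_\xi g^{ij})\nabla_i\nabla_ja+\tfrac18(\mathcal L_\xi g^{ij})(\nabla^g_i\omega_{jk})\pi^{kn}\nabla_na .$$ If $M$ is K-contact, i.e. $\mathcal L_\xi g=0$, then $\Delta_1=0$; and then every classical observable is quantizable to first order in $\nu$: for every $a_0\in C^\infty(M,\mathbb C)$ with $\xi a_0=0$ there is $a_1\in C^\infty(M,\mathbb C)$ such that $\Delta(a_0+\nu a_1)=O(\nu^2)$. -/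

import Mathlib

open scoped Manifold ContDiff
open Finset

noncomputable section

namespace WickContact

/-- The coordinate space `ℝⁿ`. -/
abbrev Coord (n : ℕ) : Type := EuclideanSpace ℝ (Fin n)

/-- The partial derivative `∂f/∂xⁱ`. -/
def pd {n : ℕ} {V : Type*} [NormedAddCommGroup V] [NormedSpace ℝ V]
    (i : Fin n) (f : Coord n → V) (x : Coord n) : V :=
  fderiv ℝ f x (EuclideanSpace.single i 1)

/-! ## Tensor calculus in a coordinate chart

Index conventions: the arguments of a component function are its indices from left to right,
and in a covariant derivative the differentiating index comes first. -/

/-- The coordinate components of the tensors `(φ, ξ, λ, g)`. -/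
structure LocalFields (n : ℕ) where
  /-- `λ_i` -/
  lam : Fin n → Coord n → ℝ
  /-- `ξ^i` -/
  xi : Fin n → Coord n → ℝ
  /-- `φ^i_j` is `phi i j` -/
  phi : Fin n → Fin n → Coord n → ℝ
  /-- `g_{ij}` -/
  g : Fin n → Fin n → Coord n → ℝ

namespace LocalFields

variable {n : ℕ} (F : LocalFields n)

/-- `ω = dλ`, that is `ω_{ij} = ∂_i λ_j - ∂_j λ_i`, where `ω = ½ ω_{ij} dxⁱ ∧ dxʲ`. -/
def omega (i j : Fin n) (x : Coord n) : ℝ := pd i (F.lam j) x - pd j (F.lam i) x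

/-- The inverse metric `g^{ij}`. -/
def ginv (i j : Fin n) (x : Coord n) : ℝ := (Matrix.of fun a b => F.g a b x)⁻¹ i j

/-- The Jacobi bivector `π^{ij} = g^{ik} φ^j_k`, i.e. `π(α, β) = g⁻¹(α, φᵗ β)`. -/
def piv (i j : Fin n) (x : Coord n) : ℝ := ∑ k, F.ginv i k x * F.phi j k x

/-- The Wick tensor `h^{ij} = g^{ij} + √-1 π^{ij}`. -/
def h (i j : Fin n) (x : Coord n) : ℂ := (F.ginv i j x : ℂ) + Complex.I * (F.piv i j x : ℂ)

/-- The projector `P^i_j = δ^i_j - ξ^i λ_j` onto the contact distribution. -/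
def proj (i j : Fin n) (x : Coord n) : ℝ := (if i = j then 1 else 0) - F.xi i x * F.lam j x

/-- The Christoffel symbols of the Levi-Civita connection `∇^g` (upper index first). -/
def chris (k i j : Fin n) (x : Coord n) : ℝ :=
  (1 / 2) * ∑ l, F.ginv k l x *
    (pd i (F.g l j) x + pd j (F.g l i) x - pd l (F.g i j) x)

/-- `∇^g_k ξ^i` -/
def lcXi (k i : Fin n) (x : Coord n) : ℝ :=
  pd k (F.xi i) x + ∑ a, F.chris i a k x * F.xi a x

/-- `∇^g_k λ_j` -/
def lcLam (k j : Fin n) (x : Coord n) : ℝ :=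
  pd k (F.lam j) x - ∑ a, F.chris a j k x * F.lam a x

/-- `∇^g_k φ^l_j` -/
def lcPhi (k l j : Fin n) (x : Coord n) : ℝ :=
  pd k (F.phi l j) x + ∑ a, (F.chris l a k x * F.phi a j x - F.chris a j k x * F.phi l a x)

/-- `∇^g_k ω_{ij}` -/
def lcOmega (k i j : Fin n) (x : Coord n) : ℝ :=
  pd k (F.omega i j) x -
    ∑ a, (F.chris a i k x * F.omega a j x + F.chris a j k x * F.omega i a x)

/-- The potential of the contact metric connection:
`S^i_{jk} = -½ φ^i_l ∇^g_k φ^l_j - ½ λ_j ∇^g_k ξ^i + ξ^i ∇^g_k λ_j`. -/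
def S (i j k : Fin n) (x : Coord n) : ℝ :=
  -(1 / 2) * (∑ l, F.phi i l x * F.lcPhi k l j x)
    - (1 / 2) * (F.lam j x * F.lcXi k i x) + F.xi i x * F.lcLam k j x

/-- The coefficients `Γ^i_{jk}` of the contact metric connection `∇ = ∇^g + S`, normalised by
`∇_k v^i = ∂_k v^i + Γ^i_{jk} v^j`. -/
def Gam (i j k : Fin n) (x : Coord n) : ℝ := F.chris i j k x + F.S i j k x

/-- The torsion `T^i_{jk} = S^i_{jk} - S^i_{kj}`. -/
def torsion (i j k : Fin n) (x : Coord n) : ℝ := F.S i j k x - F.S i k j x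

/-- The curvature `R^i_{jkl}`, normalised by `[∇_k, ∇_l] v^i = R^i_{jkl} v^j + T^j_{kl} ∇_j v^i`. -/
def curv (i j k l : Fin n) (x : Coord n) : ℝ :=
  pd k (F.Gam i j l) x - pd l (F.Gam i j k) x
    + ∑ a, (F.Gam i a k x * F.Gam a j l x - F.Gam i a l x * F.Gam a j k x)

/-- `T_{kij} = ω_{kn} T^n_{ij}` -/
def torsionCov (k i j : Fin n) (x : Coord n) : ℝ := ∑ a, F.omega k a x * F.torsion a i j x

/-- `R_{klij} = ω_{kn} R^n_{lij}` -/
def curvCov (k l i j : Fin n) (x : Coord n) : ℝ := ∑ a, F.omega k a x * F.curv a l i j x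

/-- The Lie derivative `(L_ξ g)_{ij}` of the metric. -/
def lieMetric (i j : Fin n) (x : Coord n) : ℝ :=
  ∑ k, (F.xi k x * pd k (F.g i j) x + F.g k j x * pd i (F.xi k) x + F.g i k x * pd j (F.xi k) x)

/-- The Lie derivative `L_ξ g^{ij}` of the inverse metric. -/
def lieGinv (i j : Fin n) (x : Coord n) : ℝ :=
  ∑ k, (F.xi k x * pd k (F.ginv i j) x
    - F.ginv k j x * pd k (F.xi i) x - F.ginv i k x * pd k (F.xi j) x)

/-- `∇_i ∇_j a` for a function `a` and the contact metric connection. -/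
def hess (i j : Fin n) (a : Coord n → ℂ) (x : Coord n) : ℂ :=
  pd i (pd j a) x - ∑ k, (F.Gam k j i x : ℂ) * pd k a x

end LocalFields

/-! ## The formal Wick algebra over a coordinate chart

An element `∑_k ν^k a_k(x, y)` is the sequence of its coefficients `a_k`, formal power series in
the fibre coordinates `y¹, …, yⁿ` with coefficients depending on the point `x` of the chart.
A form of degree one is given by its components `a_i`, where `a = a_i dxⁱ`, and a form of degree two
by its antisymmetric components `a_{ij}`, where `a = ½ a_{ij} dxⁱ ∧ dxʲ`. -/

/-- Elements of the Wick algebra, as sequences indexed by the power of `ν`. -/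
abbrev W (n : ℕ) : Type := ℕ → MvPowerSeries (Fin n) (Coord n → ℂ)

/-- `W ⊗ Λ₁` -/
abbrev W1 (n : ℕ) : Type := Fin n → W n

/-- `W ⊗ Λ₂` -/
abbrev W2 (n : ℕ) : Type := Fin n → Fin n → W n

variable {n : ℕ}

/-- A real function on the chart, as a complex-valued one. -/
def cx (f : Coord n → ℝ) : Coord n → ℂ := fun x => (f x : ℂ)

/-- Pointwise multiplication by `yⁱ`. -/
def mulY (i : Fin n) (a : W n) : W n := fun k => MvPowerSeries.X i * a k

/-- `∂/∂yⁱ` -/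
def dY (i : Fin n) (a : W n) : W n := fun k => MvPowerSeries.pderiv (Coord n → ℂ) i (a k)

/-- `∂/∂xⁱ`, acting on the coefficients. -/
def dX (i : Fin n) (a : W n) : W n :=
  fun k d => pd i (MvPowerSeries.coeff d (a k))

/-- Multiplies the component of polynomial degree `q` in `y` by `1 / (q + c)`, understood as `0`
when `q + c = 0`. -/
def divDeg (c : ℕ) (a : W n) : W n :=
  fun k d => (((d.degree + c : ℕ) : ℂ)⁻¹) • MvPowerSeries.coeff d (a k)

/-- The restriction to `y = 0`. -/
def atZero (a : W n) : W n := fun k => MvPowerSeries.C (MvPowerSeries.constantCoeff (a k))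

/-- The coefficient of `ν^k` in `√-1/ν · a` (for `a` divisible by `ν`). -/
def iOverNu (a : W n) : W n := fun k => (fun _ : Coord n => Complex.I) • a (k + 1)

/-- The limit of a sequence of successive approximations whose `N`-th member is correct up to total
degree `N`, where `deg yⁱ = 1` and `deg ν = 2`: the coefficient of `ν^k y^d` is read off
from the member with the number `2k + |d|`. -/
def limit (u : ℕ → W n) : W n := fun k d => MvPowerSeries.coeff d (u (2 * k + d.degree) k)

namespace LocalFields

variable (F : LocalFields n)

/-- `(h^{ij} ∂²/∂yⁱ∂zʲ)^s a(y) b(z)` at `z = y`. -/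
def bidiff : ℕ → MvPowerSeries (Fin n) (Coord n → ℂ) → MvPowerSeries (Fin n) (Coord n → ℂ) →
    MvPowerSeries (Fin n) (Coord n → ℂ)
  | 0, a, b => a * b
  | s + 1, a, b => ∑ i, ∑ j, F.h i j •
      bidiff s (MvPowerSeries.pderiv (Coord n → ℂ) i a) (MvPowerSeries.pderiv (Coord n → ℂ) j b)

/-- The product `a ∘ b = exp(ν/2 h^{ij} ∂²/∂yⁱ∂zʲ) a(y) b(z)` at `z = y`. -/
def circ (a b : W n) : W n := fun k =>
  ∑ u ∈ antidiagonal k, ∑ v ∈ antidiagonal u.2,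
    (fun _ : Coord n => ((2 : ℂ) ^ u.1 * (u.1.factorial : ℂ))⁻¹) • F.bidiff u.1 (a v.1) (b v.2)

/-- `∇_i a = ∂a/∂xⁱ - yʲ Γ^k_{ji} ∂a/∂y^k` -/
def nabla (i : Fin n) (a : W n) : W n :=
  dX i a - ∑ j, ∑ k, cx (F.Gam k j i) • mulY j (dY k a)

/-- `d_∇ a = dxⁱ ∧ ∇_i a` on forms of degree zero. -/
def dNabla0 (a : W n) : W1 n := fun i => F.nabla i a

/-- `d_∇ a = dxⁱ ∧ ∇_i a` on forms of degree one. -/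
def dNabla1 (a : W1 n) : W2 n := fun i j => F.nabla i (a j) - F.nabla j (a i)

/-- `δ = dxⁱ ∧ ∂/∂yⁱ` on forms of degree zero. -/
def delta0 (a : W n) : W1 n := fun i => dY i a

/-- `i_ξ` on forms of degree one. -/
def iXi1 (a : W1 n) : W n := ∑ i, cx (F.xi i) • a i

/-- `i_ξ` on forms of degree two. -/
def iXi2 (a : W2 n) : W1 n := fun j => ∑ i, cx (F.xi i) • a i j

/-- The component `λ i_ξ a` in `W ⊗ Λ^λ` of a form of degree one. -/
def lamPart1 (a : W1 n) : W1 n := fun i => cx (F.lam i) • F.iXi1 a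

/-- The component `λ ∧ i_ξ a` in `W ⊗ Λ^λ` of a form of degree two. -/
def lamPart2 (a : W2 n) : W2 n := fun i j =>
  cx (F.lam i) • F.iXi2 a j - cx (F.lam j) • F.iXi2 a i

/-- `δ* = yⁱ P^j_i i_{∂/∂xʲ}` on forms of degree one. -/
def deltaStar1 (a : W1 n) : W n := ∑ i, ∑ j, cx (F.proj j i) • mulY i (a j)

/-- `δ* = yⁱ P^j_i i_{∂/∂xʲ}` on forms of degree two. -/
def deltaStar2 (a : W2 n) : W1 n := fun l => ∑ i, ∑ j, cx (F.proj j i) • mulY i (a j l)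

/-- `δ⁻¹` on forms of degree one: for polynomial degree `q` in `y` it is `1/(q + 1) δ*` on forms
annihilated by `i_ξ`, and on multiples of `λ` it is `1/q δ*` (zero if `q = 0`). -/
def deltaInv1 (a : W1 n) : W n :=
  F.deltaStar1 (fun i => divDeg 1 (a i - F.lamPart1 a i))
    + F.deltaStar1 (fun i => divDeg 0 (F.lamPart1 a i))

/-- `δ⁻¹` on forms of degree two: for polynomial degree `q` in `y` it is `1/(q + 2) δ*` on forms
annihilated by `i_ξ`, and `1/(q + 1) δ*` on multiples of `λ`. -/
def deltaInv2 (a : W2 n) : W1 n :=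
  F.deltaStar2 (fun i j => divDeg 2 (a i j - F.lamPart2 a i j))
    + F.deltaStar2 (fun i j => divDeg 1 (F.lamPart2 a i j))

/-- The torsion form `T = ½ T_{kij} y^k dxⁱ ∧ dxʲ`. -/
def torsionForm : W2 n := fun i j k => if k = 0 then
  ∑ l, cx (F.torsionCov l i j) • MvPowerSeries.X l else 0

/-- The curvature form `R = -¼ R_{ijkl} yⁱ yʲ dx^k ∧ dx^l`; the sign is the one for which
`d_∇² a = √-1/ν [R, a]` and `δ R = d_∇ T`. -/
def curvForm : W2 n := fun k l q => if q = 0 then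
  -∑ i, ∑ j, (fun x => ((1 / 2 * F.curvCov i j k l x : ℝ) : ℂ)) •
    (MvPowerSeries.X i * MvPowerSeries.X j) else 0

/-- `√-1/ν · r ∘ r` for a form `r` of degree one. -/
def iNuSq (r : W1 n) : W2 n := fun i j => iOverNu (F.circ (r i) (r j) - F.circ (r j) (r i))

/-- `√-1/ν · [r, a]` for a form `r` of degree one and a form `a` of degree zero. -/
def iNuComm (r : W1 n) (a : W n) : W1 n := fun i => iOverNu (F.circ (r i) a - F.circ a (r i))

/-- The iterations, starting from zero, of `r = δ⁻¹(T + R) + δ⁻¹(d_∇ r + √-1/ν r ∘ r)`. -/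
def rIter : ℕ → W1 n
  | 0 => 0
  | N + 1 => F.deltaInv2 (F.torsionForm + F.curvForm)
      + F.deltaInv2 (F.dNabla1 (rIter N) + F.iNuSq (rIter N))

/-- The form `r` of the abelian connection, i.e. the solution of
`r = δ⁻¹(T + R) + δ⁻¹(d_∇ r + √-1/ν r ∘ r)`. -/
def r : W1 n := fun i => limit fun N => F.rIter N i

/-- The abelian connection `D a = d_∇ a - δ a + √-1/ν [r, a]` on forms of degree zero. -/
def D (a : W n) : W1 n := F.dNabla0 a - delta0 a + F.iNuComm F.r a

/-- A formal power series in `ν` of functions on the chart, as an element of the Wick algebra that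
does not depend on `y`. -/
def ofFun (A : ℕ → Coord n → ℂ) : W n := fun k => MvPowerSeries.C (A k)

/-- The iterations, starting from `A`, of `b = A + δ⁻¹ (D + δ) b`. -/
def liftIter (A : ℕ → Coord n → ℂ) : ℕ → W n
  | 0 => ofFun A
  | N + 1 => ofFun A + F.deltaInv1 (F.D (liftIter A N) + delta0 (liftIter A N))

/-- The quantum lift `Q A`, i.e. the solution `b` of `b = A + δ⁻¹ (D + δ) b`. -/
def lift (A : ℕ → Coord n → ℂ) : W n := limit (F.liftIter A)

/-- The projector `Π` on forms of degree one: `Π a = λ (i_ξ a)` at `y = 0`. -/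
def Pi1 (a : W1 n) : W1 n := fun i => cx (F.lam i) • atZero (F.iXi1 a)

/-- The operator `Δ = i_ξ Π D Q` on formal power series of functions on the chart: the coefficient
of `ν^k` in `Δ A`. -/
def Delta (A : ℕ → Coord n → ℂ) (k : ℕ) : Coord n → ℂ :=
  MvPowerSeries.constantCoeff (F.iXi1 (F.Pi1 (F.D (F.lift A))) k)

end LocalFields

/-! ## Contact metric manifolds -/

/-- Smooth tensor fields `λ`, `ξ`, `φ`, `g` of the types entering a contact metric structure. -/
structure ContactTensors (m : ℕ) (M : Type*) [TopologicalSpace M]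
    [ChartedSpace (Coord (2 * m + 1)) M] [IsManifold (𝓡 (2 * m + 1)) ∞ M] where
  /-- the one-form `λ` -/
  lam : ∀ p : M, TangentSpace (𝓡 (2 * m + 1)) p →L[ℝ] ℝ
  /-- the Reeb vector field `ξ` -/
  xi : ∀ p : M, TangentSpace (𝓡 (2 * m + 1)) p
  /-- the `(1,1)`-tensor field `φ` -/
  phi : ∀ p : M, TangentSpace (𝓡 (2 * m + 1)) p →L[ℝ] TangentSpace (𝓡 (2 * m + 1)) p
  /-- the Riemannian metric `g` -/
  metric : Bundle.ContMDiffRiemannianMetric (𝓡 (2 * m + 1)) ∞ (Coord (2 * m + 1))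
    (fun p : M => TangentSpace (𝓡 (2 * m + 1)) p)
  contMDiff_lam : ContMDiff (𝓡 (2 * m + 1))
    ((𝓡 (2 * m + 1)).prod 𝓘(ℝ, Coord (2 * m + 1) →L[ℝ] ℝ)) ∞
    (fun p : M => Bundle.TotalSpace.mk' (Coord (2 * m + 1) →L[ℝ] ℝ)
      (E := fun q : M => TangentSpace (𝓡 (2 * m + 1)) q →L[ℝ] Bundle.Trivial M ℝ q) p (lam p))
  contMDiff_xi : ContMDiff (𝓡 (2 * m + 1))
    ((𝓡 (2 * m + 1)).prod 𝓘(ℝ, Coord (2 * m + 1))) ∞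
    (fun p : M => Bundle.TotalSpace.mk' (Coord (2 * m + 1))
      (E := fun q : M => TangentSpace (𝓡 (2 * m + 1)) q) p (xi p))
  contMDiff_phi : ContMDiff (𝓡 (2 * m + 1))
    ((𝓡 (2 * m + 1)).prod 𝓘(ℝ, Coord (2 * m + 1) →L[ℝ] Coord (2 * m + 1))) ∞
    (fun p : M => Bundle.TotalSpace.mk' (Coord (2 * m + 1) →L[ℝ] Coord (2 * m + 1))
      (E := fun q : M => TangentSpace (𝓡 (2 * m + 1)) q →L[ℝ] TangentSpace (𝓡 (2 * m + 1)) q)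
      p (phi p))

section Manifold

variable {m : ℕ} {M : Type*} [TopologicalSpace M]
  [ChartedSpace (Coord (2 * m + 1)) M] [IsManifold (𝓡 (2 * m + 1)) ∞ M]

/-- The coordinate vector field `∂/∂xʲ` of the chart `e`, at the point with coordinates `x`. -/
def coordVec (e : OpenPartialHomeomorph M (Coord (2 * m + 1))) (j : Fin (2 * m + 1))
    (x : Coord (2 * m + 1)) : TangentSpace (𝓡 (2 * m + 1)) (e.symm x) :=
  mfderiv (𝓡 (2 * m + 1)) (𝓡 (2 * m + 1)) e.symm x (EuclideanSpace.single j (1 : ℝ))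

/-- The component `dxⁱ(v)` in the chart `e` of a tangent vector `v` at the point `p`. -/
def coordComp (e : OpenPartialHomeomorph M (Coord (2 * m + 1))) (i : Fin (2 * m + 1))
    (p : M) (v : TangentSpace (𝓡 (2 * m + 1)) p) : ℝ :=
  (show Coord (2 * m + 1) from mfderiv (𝓡 (2 * m + 1)) (𝓡 (2 * m + 1)) e p v) i

/-- The components of the tensor fields in the chart `e`, as functions of the coordinates; only
their values on `e.target` matter. -/
def ContactTensors.inChart (C : ContactTensors m M)
    (e : OpenPartialHomeomorph M (Coord (2 * m + 1))) : LocalFields (2 * m + 1) where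
  lam i x := C.lam (e.symm x) (coordVec e i x)
  xi i x := coordComp e i (e.symm x) (C.xi (e.symm x))
  phi i j x := coordComp e i (e.symm x) (C.phi (e.symm x) (coordVec e j x))
  g i j x := C.metric.inner (e.symm x) (coordVec e i x) (coordVec e j x)

end Manifold

/-- A contact metric structure `(φ, ξ, λ, g)` on a manifold of dimension `2m + 1`. Identities
that involve `ω = dλ` are required in every chart. -/
structure ContactMetricStructure (m : ℕ) (M : Type*) [TopologicalSpace M]
    [ChartedSpace (Coord (2 * m + 1)) M] [IsManifold (𝓡 (2 * m + 1)) ∞ M]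
    extends ContactTensors m M where
  /-- `λ ∧ (dλ)^m ≠ 0` at each point: the value of this form on the coordinate vector fields is,
  up to a positive factor, the antisymmetrization of `λ_{i₀} ω_{i₁i₂} ⋯ ω_{i_{2m-1}i_{2m}}`. -/
  contact : ∀ e ∈ IsManifold.maximalAtlas (𝓡 (2 * m + 1)) ∞ M, ∀ x ∈ e.target,
    ∑ s : Equiv.Perm (Fin (2 * m + 1)), ((Equiv.Perm.sign s : ℤ) : ℝ) *
      ((toContactTensors.inChart e).lam (s 0) x *
        ∏ k : Fin m, (toContactTensors.inChart e).omega
          (s ⟨2 * (k : ℕ) + 1, by omega⟩) (s ⟨2 * (k : ℕ) + 2, by omega⟩) x) ≠ 0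
  /-- `i_ξ λ = 1` -/
  lam_xi : ∀ p, lam p (xi p) = 1
  /-- `i_ξ ω = 0` -/
  omega_xi : ∀ e ∈ IsManifold.maximalAtlas (𝓡 (2 * m + 1)) ∞ M, ∀ x ∈ e.target, ∀ j,
    ∑ i, (toContactTensors.inChart e).xi i x * (toContactTensors.inChart e).omega i j x = 0
  /-- `λ(X) = g(X, ξ)` -/
  lam_eq : ∀ p X, lam p X = metric.inner p X (xi p)
  /-- `ω(X, Y) = g(X, φ(Y))` -/
  omega_eq : ∀ e ∈ IsManifold.maximalAtlas (𝓡 (2 * m + 1)) ∞ M, ∀ x ∈ e.target, ∀ i j,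
    (toContactTensors.inChart e).omega i j x =
      metric.inner (e.symm x) (coordVec e i x) (phi (e.symm x) (coordVec e j x))
  /-- `g(φ(X), φ(Y)) = g(X, Y) - λ(X) λ(Y)` -/
  metric_phi : ∀ p X Y,
    metric.inner p (phi p X) (phi p Y) = metric.inner p X Y - lam p X * lam p Y
  /-- `φ² = -I + ξ ⊗ λ` -/
  phi_phi : ∀ p X, phi p (phi p X) = -X + lam p X • xi p
  /-- `φ(ξ) = 0` -/
  phi_xi : ∀ p, phi p (xi p) = 0
  /-- `λ ∘ φ = 0` -/
  lam_phi : ∀ p X, lam p (phi p X) = 0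

namespace ContactMetricStructure

variable {m : ℕ} {M : Type*} [TopologicalSpace M]
  [ChartedSpace (Coord (2 * m + 1)) M] [IsManifold (𝓡 (2 * m + 1)) ∞ M]

/-- The structure is K-contact: `ξ` is a Killing vector field, `L_ξ g = 0`. -/
def IsKContact (C : ContactMetricStructure m M) : Prop :=
  ∀ e ∈ IsManifold.maximalAtlas (𝓡 (2 * m + 1)) ∞ M, ∀ x ∈ e.target, ∀ i j,
    (C.inChart e).lieMetric i j x = 0

/-- The derivative `ξ a` of a smooth complex-valued function along the Reeb vector field. -/
def reebDeriv (C : ContactMetricStructure m M)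
    (a : C^∞⟮𝓡 (2 * m + 1), M; 𝓘(ℝ, ℂ), ℂ⟯) (p : M) : ℂ :=
  mfderiv (𝓡 (2 * m + 1)) 𝓘(ℝ, ℂ) a p (C.xi p)

/-- The restriction of `Δ` to the domain of the chart `e`, computed in the coordinates of `e`:
the coefficient of `ν^k` in `Δ A` at a point `p` of `e.source`, for a formal power series
`A = ∑_k ν^k A_k` with coefficients in `C^∞(M, ℂ)`. -/
def Delta (C : ContactMetricStructure m M) (e : OpenPartialHomeomorph M (Coord (2 * m + 1)))
    (A : ℕ → C^∞⟮𝓡 (2 * m + 1), M; 𝓘(ℝ, ℂ), ℂ⟯) (k : ℕ) (p : M) : ℂ :=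
  (C.inChart e).Delta (fun l x => A l (e.symm x)) k (e p)

/-- The operator `Δ_k` in `Δ = ∑_k ν^k Δ_k`: the coefficient of `ν^k` in `Δ a` for a
function `a` that does not depend on `ν`. -/
def DeltaCoeff (C : ContactMetricStructure m M) (k : ℕ)
    (e : OpenPartialHomeomorph M (Coord (2 * m + 1)))
    (a : C^∞⟮𝓡 (2 * m + 1), M; 𝓘(ℝ, ℂ), ℂ⟯) (p : M) : ℂ :=
  C.Delta e (fun l => if l = 0 then a else 0) k p

/-- A function `a₀` is quantizable up to first order in `ν`: there is a smooth function `a₁` for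
which `Δ (a₀ + ν a₁)` vanishes modulo `ν²`. -/
def QuantizableToFirstOrder (C : ContactMetricStructure m M)
    (a₀ : C^∞⟮𝓡 (2 * m + 1), M; 𝓘(ℝ, ℂ), ℂ⟯) : Prop :=
  ∃ a₁ : C^∞⟮𝓡 (2 * m + 1), M; 𝓘(ℝ, ℂ), ℂ⟯,
    ∀ e ∈ IsManifold.maximalAtlas (𝓡 (2 * m + 1)) ∞ M, ∀ p ∈ e.source, ∀ k < 2,
      C.Delta e (fun l => if l = 0 then a₀ else if l = 1 then a₁ else 0) k p = 0

end ContactMetricStructure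

end WickContact

end

/-! ### Fibre jets up to order two: product, homotopy operators -/

noncomputable section

namespace WickContact

variable {n : ℕ}

/-! With `deg y = 1` and `deg ν = 2`, only finitely many Taylor coefficients in `y` of `r` and of
the lift can reach `Δ₁`, so everything is tracked through the value, first and second fibre
derivatives at `y = 0` (`val`, `lin`, `quad`). By `Delta_apply`, `Δ` is `ξ` plus the `ξ`-component
at `y = 0` of `√-1/ν [r, Qa]`. The form `r` has no constant term in `y` and, at `ν⁰`, no linear one;
hence the commutator vanishes at order zero and `Δ₀ = ξ`. At order one (`val_circ_comm_two`) there
remain two contributions: the linear part of `r` at `ν¹` bracketed with the linear part of the lift,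
and the double contraction of the quadratic part of `r` at `ν⁰`, which is `δ⁻¹T`, with the quadratic
part of the lift. The linear part of `r` at `ν¹` itself comes from the double contraction in `r ∘
r`. The curvature has too high a degree in `y` to enter. This gives `Delta_one`.

The geometry rests on the tensor `Z_{mj} = φ^l_j ∇^g_m λ_l`. It is symmetric (`zMat_symm`); with `dω
= 0` this puts the lowered torsion in the form `torsionCov_eq`, and `i_ξ δ⁻¹T` has fibre Hessian
`-Z` (`sum_xi_rQuad`). Both double contractions therefore have `Z` in one slot, and there `h h - hᵗ
hᵗ` turns `Z` into `2√-1 L_ξ g^{ij}` on symmetric tensors (`quadComm_zMat`). This is why `Δ₁` is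
built on `L_ξ g^{ij}`.

It remains to contract `L_ξ g^{ij}` with the quadratic parts of `r` and of the lift. Terms along `λ`
disappear because `λ` is annihilated by `L_ξ g^{ij}` and by `π`, and `∇λ = 0` (`sum_lam_Gam`) makes
the quadratic part of the lift the Hessian plus a torsion correction. The two contributions to the
first order term of `Δ₁` have coefficients `1/12` and `1/24`, whose sum is `1/8` (`Delta_one_eq`).
In the K-contact case `L_ξ g^{ij} = 0`, so `Δ₁ = 0` and `a₁ = 0` serves as the correction. -/

/-- Formal power series in the fibre coordinates over the functions on a chart. -/
abbrev Fib (n : ℕ) : Type := MvPowerSeries (Fin n) (Coord n → ℂ)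

/-- The value at `y = 0`. -/
def val : Fib n →ₗ[Coord n → ℂ] (Coord n → ℂ) := MvPowerSeries.coeff 0

/-- The first fibre derivative at `y = 0`. -/
def lin (a : Fin n) : Fib n →ₗ[Coord n → ℂ] (Coord n → ℂ) :=
  val ∘ₗ (MvPowerSeries.pderiv (Coord n → ℂ) a).toLinearMap

/-- The second fibre derivative at `y = 0`. -/
def quad (a c : Fin n) : Fib n →ₗ[Coord n → ℂ] (Coord n → ℂ) :=
  lin a ∘ₗ (MvPowerSeries.pderiv (Coord n → ℂ) c).toLinearMap

theorem constantCoeff_eq_val (f : Fib n) : MvPowerSeries.constantCoeff f = val f := by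
  simp [val]

theorem val_mul (f g : Fib n) : val (f * g) = val f * val g := by
  simp [← constantCoeff_eq_val]

theorem val_pderiv (a : Fin n) (f : Fib n) :
    val (MvPowerSeries.pderiv (Coord n → ℂ) a f) = lin a f := rfl

theorem lin_pderiv (a c : Fin n) (f : Fib n) :
    lin a (MvPowerSeries.pderiv (Coord n → ℂ) c f) = quad a c f := rfl

theorem lin_mul (a : Fin n) (f g : Fib n) :
    lin a (f * g) = val f * lin a g + val g * lin a f := by
  rw [← val_pderiv, Derivation.leibniz]
  simp [val_mul, val_pderiv]

theorem quad_mul (a c : Fin n) (f g : Fib n) :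
    quad a c (f * g) = val f * quad a c g + lin a f * lin c g
      + (val g * quad a c f + lin a g * lin c f) := by
  rw [← lin_pderiv, Derivation.leibniz]
  simp only [smul_eq_mul, map_add, lin_mul, val_pderiv, lin_pderiv]
  ring

theorem lin_eq_coeff (a : Fin n) (f : Fib n) :
    lin a f = MvPowerSeries.coeff (Finsupp.single a 1) f := by
  change MvPowerSeries.coeff 0 (MvPowerSeries.pderiv (Coord n → ℂ) a f) = _
  simp only [MvPowerSeries.coeff_pderiv]
  simp

/-- The factor is `2` for `a = c` and `1` otherwise: `quad` is the Hessian, not the Taylor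
coefficient, so that the product rule and the contractions with `h` need no case distinction. -/
theorem quad_eq_coeff (a c : Fin n) (f : Fib n) :
    quad a c f = MvPowerSeries.coeff (Finsupp.single a 1 + Finsupp.single c 1) f
      * ((Finsupp.single a 1 c : ℕ) + 1) := by
  rw [← lin_pderiv, lin_eq_coeff, MvPowerSeries.coeff_pderiv]

theorem val_C (A : Coord n → ℂ) : val (MvPowerSeries.C A : Fib n) = A := by
  simp [← constantCoeff_eq_val]

theorem lin_C (a : Fin n) (A : Coord n → ℂ) : lin a (MvPowerSeries.C A : Fib n) = 0 := by
  simp [← val_pderiv]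

theorem quad_C (a c : Fin n) (A : Coord n → ℂ) : quad a c (MvPowerSeries.C A : Fib n) = 0 := by
  simp [← lin_pderiv]

theorem val_X (i : Fin n) : val (MvPowerSeries.X i : Fib n) = 0 := by
  simp [← constantCoeff_eq_val]

theorem lin_X (a i : Fin n) : lin a (MvPowerSeries.X i : Fib n) = if a = i then 1 else 0 := by
  rw [lin_eq_coeff, MvPowerSeries.coeff_X]
  congr 1
  simp [Finsupp.single_left_inj]

theorem quad_X (a c i : Fin n) : quad a c (MvPowerSeries.X i : Fib n) = 0 := by
  rw [quad_eq_coeff, MvPowerSeries.coeff_X, if_neg, zero_mul]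
  intro h
  simpa using congrArg Finsupp.degree h

theorem val_mulY (i : Fin n) (f : W n) (k : ℕ) : val (mulY i f k) = 0 := by
  simp [mulY, val_mul, val_X]

theorem lin_mulY (a i : Fin n) (f : W n) (k : ℕ) :
    lin a (mulY i f k) = if a = i then val (f k) else 0 := by
  simp [mulY, lin_mul, val_X, lin_X]

theorem quad_mulY (a c i : Fin n) (f : W n) (k : ℕ) :
    quad a c (mulY i f k) = (if a = i then lin c (f k) else 0) + if c = i then lin a (f k) else 0 := by
  simp [mulY, quad_mul, val_X, lin_X, quad_X]

theorem val_divDeg (c : ℕ) (f : W n) (k : ℕ) : val (divDeg c f k) = (c : ℂ)⁻¹ • val (f k) := by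
  change (((0 : Fin n →₀ ℕ).degree + c : ℕ) : ℂ)⁻¹ • MvPowerSeries.coeff 0 (f k) = _
  simp [val]

theorem lin_divDeg (a : Fin n) (c : ℕ) (f : W n) (k : ℕ) :
    lin a (divDeg c f k) = ((1 + c : ℕ) : ℂ)⁻¹ • lin a (f k) := by
  rw [lin_eq_coeff, lin_eq_coeff]
  change (((Finsupp.single a 1 : Fin n →₀ ℕ).degree + c : ℕ) : ℂ)⁻¹ •
    MvPowerSeries.coeff (Finsupp.single a 1) (f k) = _
  simp

theorem val_dX (i : Fin n) (f : W n) (k : ℕ) : val (dX i f k) = pd i (val (f k)) := rfl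

theorem lin_dX (a i : Fin n) (f : W n) (k : ℕ) : lin a (dX i f k) = pd i (lin a (f k)) := by
  rw [lin_eq_coeff, lin_eq_coeff]; rfl

/-- The total degree `2k + |d|` selects the iterate; the value and the first and second derivatives
at `ν^k` are thus read from the iterates `2k`, `2k + 1` and `2k + 2`. -/
theorem val_limit (u : ℕ → W n) (k : ℕ) : val (limit u k) = val (u (2 * k) k) := by
  change MvPowerSeries.coeff 0 (u (2 * k + (0 : Fin n →₀ ℕ).degree) k) = _
  simp [val]

theorem lin_limit (a : Fin n) (u : ℕ → W n) (k : ℕ) :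
    lin a (limit u k) = lin a (u (2 * k + 1) k) := by
  rw [lin_eq_coeff, lin_eq_coeff]
  change MvPowerSeries.coeff _ (u (2 * k + (Finsupp.single a 1 : Fin n →₀ ℕ).degree) k) = _
  simp

theorem quad_limit (a c : Fin n) (u : ℕ → W n) (k : ℕ) :
    quad a c (limit u k) = quad a c (u (2 * k + 2) k) := by
  rw [quad_eq_coeff, quad_eq_coeff]
  congr 1
  change MvPowerSeries.coeff _ (u (2 * k +
    (Finsupp.single a 1 + Finsupp.single c 1 : Fin n →₀ ℕ).degree) k) = _
  simp

theorem pd_zero (i : Fin n) : pd i (0 : Coord n → ℂ) = 0 := by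
  funext x
  change fderiv ℝ (fun _ => (0 : ℂ)) x _ = 0
  simp

namespace LocalFields

variable (F : LocalFields n)

theorem val_nabla (i : Fin n) (f : W n) (k : ℕ) : val (F.nabla i f k) = pd i (val (f k)) := by
  simp [nabla, val_dX, val_mulY, Finset.sum_apply]

theorem lin_nabla (a i : Fin n) (f : W n) (k : ℕ) :
    lin a (F.nabla i f k) = pd i (lin a (f k)) - ∑ l, cx (F.Gam l a i) * lin l (f k) := by
  simp only [nabla, Pi.sub_apply, map_sub, lin_dX, Finset.sum_apply, Pi.smul_apply, map_sum,
    map_smul, lin_mulY, smul_eq_mul]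
  congr 1
  rw [Finset.sum_comm]
  simp [dY, val_pderiv]

theorem circ_one (f g : W n) : F.circ f g 1 = f 0 * g 1 + f 1 * g 0
    + (fun _ : Coord n => (1 / 2 : ℂ)) • ∑ i, ∑ j, F.h i j •
      (MvPowerSeries.pderiv (Coord n → ℂ) i (f 0) * MvPowerSeries.pderiv (Coord n → ℂ) j (g 0)) := by
  have h0 : (antidiagonal 0 : Finset (ℕ × ℕ)) = {(0, 0)} := rfl
  have h1 : (antidiagonal 1 : Finset (ℕ × ℕ)) = {(0, 1), (1, 0)} := rfl
  have e0 : (fun _ : Coord n => (((2 : ℂ) ^ 0 * (Nat.factorial 0 : ℂ))⁻¹)) = 1 := by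
    funext; simp
  have e1 : (fun _ : Coord n => (((2 : ℂ) ^ 1 * (Nat.factorial 1 : ℂ))⁻¹)) =
      fun _ => (1 / 2 : ℂ) := by
    funext; simp
  simp only [circ, h1]
  rw [Finset.sum_pair (by decide)]
  simp only [h0, h1, Finset.sum_singleton]
  rw [Finset.sum_pair (by decide)]
  simp only [e0, e1, one_smul, bidiff]

theorem circ_two (f g : W n) : F.circ f g 2 = f 0 * g 2 + f 1 * g 1 + f 2 * g 0
    + (fun _ : Coord n => (1 / 2 : ℂ)) • ∑ i, ∑ j, F.h i j •
      (MvPowerSeries.pderiv (Coord n → ℂ) i (f 0) * MvPowerSeries.pderiv (Coord n → ℂ) j (g 1)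
      + MvPowerSeries.pderiv (Coord n → ℂ) i (f 1) * MvPowerSeries.pderiv (Coord n → ℂ) j (g 0))
    + (fun _ : Coord n => (1 / 8 : ℂ)) • ∑ i, ∑ j, F.h i j • ∑ k, ∑ l, F.h k l •
      (MvPowerSeries.pderiv (Coord n → ℂ) k (MvPowerSeries.pderiv (Coord n → ℂ) i (f 0))
        * MvPowerSeries.pderiv (Coord n → ℂ) l (MvPowerSeries.pderiv (Coord n → ℂ) j (g 0))) := by
  have h0 : (antidiagonal 0 : Finset (ℕ × ℕ)) = {(0, 0)} := rfl
  have h1 : (antidiagonal 1 : Finset (ℕ × ℕ)) = {(0, 1), (1, 0)} := rfl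
  have h2 : (antidiagonal 2 : Finset (ℕ × ℕ)) = {(0, 2), (1, 1), (2, 0)} := rfl
  have e0 : (fun _ : Coord n => (((2 : ℂ) ^ 0 * (Nat.factorial 0 : ℂ))⁻¹)) = 1 := by
    funext; simp
  have e1 : (fun _ : Coord n => (((2 : ℂ) ^ 1 * (Nat.factorial 1 : ℂ))⁻¹)) =
      fun _ => (1 / 2 : ℂ) := by
    funext; simp
  have e2 : (fun _ : Coord n => (((2 : ℂ) ^ 2 * (Nat.factorial 2 : ℂ))⁻¹)) =
      fun _ => (1 / 8 : ℂ) := by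
    funext; norm_num [Nat.factorial]
  simp only [circ, h2]
  rw [Finset.sum_insert (by decide), Finset.sum_pair (by decide)]
  simp only [h0, h1, h2, Finset.sum_singleton]
  rw [Finset.sum_insert (by decide), Finset.sum_pair (by decide)]
  simp only [Finset.sum_pair (show ((0, 1) : ℕ × ℕ) ≠ (1, 0) by decide), e0, e1, e2, one_smul,
    bidiff]
  simp only [smul_add, Finset.sum_add_distrib, add_assoc]

/-- The leading term of the commutator is a multiple of the fibrewise Poisson bracket. -/
theorem val_circ_comm_one (f g : W n) :
    val (F.circ f g 1 - F.circ g f 1) = fun x => (1 / 2 : ℂ) * ∑ i, ∑ j,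
      (F.h i j x - F.h j i x) * (lin i (f 0) x * lin j (g 0) x) := by
  have key : ∀ f g : W n, val (F.circ f g 1) = fun x => val (f 0) x * val (g 1) x
      + val (f 1) x * val (g 0) x + (1 / 2 : ℂ) * ∑ i, ∑ j,
      F.h i j x * (lin i (f 0) x * lin j (g 0) x) := by
    intro f g
    funext x
    simp [circ_one, val_mul, val_pderiv]
  funext x
  rw [map_sub, key f g, key g f]
  simp only [Pi.sub_apply, sub_mul, Finset.sum_sub_distrib]
  rw [Finset.sum_comm (f := fun i j => F.h j i x * (lin i (f 0) x * lin j (g 0) x))]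
  simp only [mul_comm (lin _ (g 0) x)]
  ring

/-- Uncontracted products cancel in the commutator. Differentiating the Poisson bracket of the
leading terms gives two sums, and the one containing `quad` of `g` carries the vanishing linear part
of `f`. -/
theorem lin_circ_comm_one (c : Fin n) (f g : W n) (hf : ∀ i, lin i (f 0) = 0) :
    lin c (F.circ f g 1 - F.circ g f 1) = fun x => (1 / 2 : ℂ) * ∑ i, ∑ j,
      (F.h i j x - F.h j i x) * (quad c i (f 0) x * lin j (g 0) x) := by
  have key : ∀ f g : W n, lin c (F.circ f g 1) = fun x => lin c (f 0 * g 1) x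
      + lin c (f 1 * g 0) x + (1 / 2 : ℂ) * ∑ i, ∑ j,
      F.h i j x * (lin i (f 0) x * quad c j (g 0) x + lin j (g 0) x * quad c i (f 0) x) := by
    intro f g
    funext x
    simp only [circ_one, map_add, map_smul, map_sum, lin_mul _ (MvPowerSeries.pderiv _ _ _),
      val_pderiv, lin_pderiv]
    simp
  funext x
  rw [map_sub, key f g, key g f]
  simp only [Pi.sub_apply, sub_mul, Finset.sum_sub_distrib, hf]
  rw [Finset.sum_comm (f := fun i j => F.h j i x * (quad c i (f 0) x * lin j (g 0) x))]
  simp [mul_comm (g _) (f _), mul_comm (quad _ _ (f 0) x)]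
  ring

/-- Here `f` will be a component of `r`, whose linear part at `ν⁰` is zero; so of the single
contractions only that of `f 1` with `g 0` survives, next to the double contraction of `f 0` with `g
0`. -/
theorem val_circ_comm_two (f g : W n) (hf : ∀ i, lin i (f 0) = 0) :
    val (F.circ f g 2 - F.circ g f 2) = fun x => (1 / 2 : ℂ) * ∑ i, ∑ j,
      (F.h i j x - F.h j i x) * (lin i (f 1) x * lin j (g 0) x)
      + (1 / 8 : ℂ) * ∑ i, ∑ j, ∑ k, ∑ l, (F.h i j x * F.h k l x - F.h j i x * F.h l k x)
        * (quad k i (f 0) x * quad l j (g 0) x) := by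
  have key : ∀ f g : W n, val (F.circ f g 2) = fun x => val (f 0) x * val (g 2) x
      + val (f 1) x * val (g 1) x + val (f 2) x * val (g 0) x + (1 / 2 : ℂ) * ∑ i, ∑ j,
      F.h i j x * (lin i (f 0) x * lin j (g 1) x + lin i (f 1) x * lin j (g 0) x)
      + (1 / 8 : ℂ) * ∑ i, ∑ j, ∑ k, ∑ l, F.h i j x * F.h k l x
        * (quad k i (f 0) x * quad l j (g 0) x) := by
    intro f g
    funext x
    simp [circ_two, val_mul, val_pderiv, lin_pderiv, Finset.mul_sum, mul_assoc, mul_add]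
  -- Exchanging the factors `f` and `g` exchanges the indices within each of the two contracted
  -- pairs, which transposes both copies of `h`.
  have swap : ∀ c : Fin n → Fin n → Fin n → Fin n → ℂ, ∑ i, ∑ j, ∑ k, ∑ l, c i j k l =
      ∑ i, ∑ j, ∑ k, ∑ l, c j i l k := by
    intro c
    rw [Finset.sum_comm]
    refine Finset.sum_congr rfl fun i _ => Finset.sum_congr rfl fun j _ => ?_
    rw [Finset.sum_comm]
  funext x
  rw [map_sub, key f g, key g f]
  simp only [Pi.sub_apply, sub_mul, Finset.sum_sub_distrib, hf]
  rw [swap (fun i j k l => F.h i j x * F.h k l x * (quad k i (g 0) x * quad l j (f 0) x)),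
    Finset.sum_comm (f := fun i j => F.h i j x * (lin i (g 0) x * lin j (f 1) x +
      lin i (g 1) x * (0 : Coord n → ℂ) x))]
  simp [mul_comm (lin _ (g 0) x), mul_comm (quad _ _ (g 0) x)]
  ring

/-! ### The homotopy operator -/

theorem val_deltaInv1 (a : W1 n) (k : ℕ) : val (F.deltaInv1 a k) = 0 := by
  simp [deltaInv1, deltaStar1, Finset.sum_apply, val_mulY]

theorem val_deltaInv2 (a : W2 n) (l : Fin n) (k : ℕ) : val (F.deltaInv2 a l k) = 0 := by
  simp [deltaInv2, deltaStar2, Finset.sum_apply, val_mulY]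

theorem linearMap_iXi1 (L : Fib n →ₗ[Coord n → ℂ] (Coord n → ℂ)) (a : W1 n) (k : ℕ) :
    L (F.iXi1 a k) = ∑ i, cx (F.xi i) * L (a i k) := by
  simp [iXi1, Finset.sum_apply]

theorem linearMap_lamPart1 (L : Fib n →ₗ[Coord n → ℂ] (Coord n → ℂ)) (a : W1 n) (i : Fin n)
    (k : ℕ) : L (F.lamPart1 a i k) = cx (F.lam i) * ∑ j, cx (F.xi j) * L (a j k) := by
  simp [lamPart1, linearMap_iXi1]

theorem linearMap_lamPart2 (L : Fib n →ₗ[Coord n → ℂ] (Coord n → ℂ)) (a : W2 n) (i j : Fin n)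
    (k : ℕ) : L (F.lamPart2 a i j k) = cx (F.lam i) * ∑ l, cx (F.xi l) * L (a l j k)
      - cx (F.lam j) * ∑ l, cx (F.xi l) * L (a l i k) := by
  simp [lamPart2, iXi2, Finset.sum_apply]

theorem lin_deltaInv1 (c : Fin n) (a : W1 n) (k : ℕ) :
    lin c (F.deltaInv1 a k) = ∑ j, cx (F.proj j c) * val (a j k - F.lamPart1 a j k) := by
  -- On the multiples of `λ` the weight in degree zero is `0⁻¹ = 0`, so that part contributes
  -- nothing.
  simp [deltaInv1, deltaStar1, Finset.sum_apply, lin_mulY, val_divDeg]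

theorem lin_deltaInv2 (c : Fin n) (a : W2 n) (l : Fin n) (k : ℕ) :
    lin c (F.deltaInv2 a l k) = ∑ j, cx (F.proj j c) *
      ((1 / 2 : ℂ) • val (a j l k - F.lamPart2 a j l k) + val (F.lamPart2 a j l k)) := by
  simp [deltaInv2, deltaStar2, Finset.sum_apply, lin_mulY, val_divDeg, mul_add,
    Finset.sum_add_distrib]

theorem quad_deltaInv1 (b c : Fin n) (a : W1 n) (k : ℕ) :
    quad b c (F.deltaInv1 a k) =
      ∑ j, cx (F.proj j b) * ((1 / 2 : ℂ) • lin c (a j k - F.lamPart1 a j k)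
        + lin c (F.lamPart1 a j k))
      + ∑ j, cx (F.proj j c) * ((1 / 2 : ℂ) • lin b (a j k - F.lamPart1 a j k)
        + lin b (F.lamPart1 a j k)) := by
  simp [deltaInv1, deltaStar1, Finset.sum_apply, quad_mulY, lin_divDeg, mul_add,
    Finset.sum_add_distrib]
  abel

theorem quad_deltaInv2 (b c : Fin n) (a : W2 n) (l : Fin n) (k : ℕ) :
    quad b c (F.deltaInv2 a l k) =
      ∑ j, cx (F.proj j b) * ((1 / 3 : ℂ) • lin c (a j l k - F.lamPart2 a j l k)
        + (1 / 2 : ℂ) • lin c (F.lamPart2 a j l k))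
      + ∑ j, cx (F.proj j c) * ((1 / 3 : ℂ) • lin b (a j l k - F.lamPart2 a j l k)
        + (1 / 2 : ℂ) • lin b (F.lamPart2 a j l k)) := by
  simp [deltaInv2, deltaStar2, Finset.sum_apply, quad_mulY, lin_divDeg, mul_add,
    Finset.sum_add_distrib]
  abel

variable {F} {x : Coord n}

/-- The two weights `1/2` and `1` combine to `1/2 (a + λ ∧ i_ξ a)`. In the contraction with the
projector only the term of `λ ∧ i_ξ a` with `λ` in the free slot survives. -/
theorem lin_deltaInv2_apply (hP : ∀ c, ∑ j, F.proj j c x * F.lam j x = 0) (c : Fin n) (a : W2 n)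
    (l : Fin n) (k : ℕ) :
    lin c (F.deltaInv2 a l k) x = (1 / 2 : ℂ) * ∑ j, (F.proj j c x : ℂ) *
      (val (a j l k) x - F.lam l x * ∑ q, F.xi q x * val (a q j k) x) := by
  have hP' : ∑ j, (F.proj j c x : ℂ) * F.lam j x = 0 := by exact_mod_cast hP c
  -- The added summand is zero by `hP'`; with it the two sides agree term by term in `j`.
  have : (1 / 2 : ℂ) * ∑ j, (F.proj j c x : ℂ) *
      (val (a j l k) x - F.lam l x * ∑ q, F.xi q x * val (a q j k) x) =
      (1 / 2 : ℂ) * ∑ j, (F.proj j c x : ℂ) *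
      (val (a j l k) x - F.lam l x * ∑ q, F.xi q x * val (a q j k) x)
      + (1 / 2 : ℂ) * ((∑ j, (F.proj j c x : ℂ) * F.lam j x) *
        ∑ q, F.xi q x * val (a q l k) x) := by
    rw [hP']; ring
  rw [this, lin_deltaInv2]
  simp only [map_sub, linearMap_lamPart2, Finset.sum_apply, Pi.mul_apply, Pi.add_apply,
    Pi.smul_apply, Pi.sub_apply, smul_eq_mul, cx, Finset.sum_mul (Finset.univ (α := Fin n)) (fun j => (F.proj j c x : ℂ) * F.lam j x)]
  rw [← mul_add, ← Finset.sum_add_distrib, Finset.mul_sum]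
  refine Finset.sum_congr rfl fun j _ => ?_
  ring

/-- In degree one the weights are `1/3` and `1/2`, and `1/6` is their difference. -/
theorem quad_deltaInv2_apply (hP : ∀ c, ∑ j, F.proj j c x * F.lam j x = 0) (b c : Fin n) (a : W2 n)
    (l : Fin n) (k : ℕ) :
    quad b c (F.deltaInv2 a l k) x = ∑ j, (F.proj j b x : ℂ) *
      (1 / 3 * lin c (a j l k) x - 1 / 6 * F.lam l x * ∑ q, F.xi q x * lin c (a q j k) x)
      + ∑ j, (F.proj j c x : ℂ) *
      (1 / 3 * lin b (a j l k) x - 1 / 6 * F.lam l x * ∑ q, F.xi q x * lin b (a q j k) x) := by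
  have key : ∀ b c : Fin n, (∑ j, cx (F.proj j b) *
      ((1 / 3 : ℂ) • lin c (a j l k - F.lamPart2 a j l k)
        + (1 / 2 : ℂ) • lin c (F.lamPart2 a j l k))) x = ∑ j, (F.proj j b x : ℂ) *
      (1 / 3 * lin c (a j l k) x - 1 / 6 * F.lam l x * ∑ q, F.xi q x * lin c (a q j k) x) := by
    intro b c
    have hP' : ∑ j, (F.proj j b x : ℂ) * F.lam j x = 0 := by exact_mod_cast hP b
    have : ∑ j, (F.proj j b x : ℂ) *
      (1 / 3 * lin c (a j l k) x - 1 / 6 * F.lam l x * ∑ q, F.xi q x * lin c (a q j k) x) =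
      ∑ j, (F.proj j b x : ℂ) *
      (1 / 3 * lin c (a j l k) x - 1 / 6 * F.lam l x * ∑ q, F.xi q x * lin c (a q j k) x)
      + (∑ j, (F.proj j b x : ℂ) * F.lam j x) *
        (1 / 6 * ∑ q, F.xi q x * lin c (a q l k) x) := by
      rw [hP']; ring
    rw [this, Finset.sum_mul, ← Finset.sum_add_distrib]
    simp only [map_sub, linearMap_lamPart2, Finset.sum_apply, Pi.mul_apply, Pi.add_apply,
      Pi.smul_apply, Pi.sub_apply, smul_eq_mul, cx]
    refine Finset.sum_congr rfl fun j _ => ?_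
    ring
  rw [quad_deltaInv2, Pi.add_apply, key, key]

/-- For forms of degree one the whole `λ` part is killed by the projector, so its separate weight
never matters. -/
theorem lin_deltaInv1_apply (hP : ∀ c, ∑ j, F.proj j c x * F.lam j x = 0) (c : Fin n) (a : W1 n)
    (k : ℕ) : lin c (F.deltaInv1 a k) x = ∑ j, (F.proj j c x : ℂ) * val (a j k) x := by
  have hP' : ∑ j, (F.proj j c x : ℂ) * F.lam j x = 0 := by exact_mod_cast hP c
  have : ∑ j, (F.proj j c x : ℂ) * val (a j k) x = ∑ j, (F.proj j c x : ℂ) * val (a j k) x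
      - (∑ j, (F.proj j c x : ℂ) * F.lam j x) * ∑ q, F.xi q x * val (a q k) x := by
    rw [hP']; ring
  rw [this, lin_deltaInv1, Finset.sum_mul, ← Finset.sum_sub_distrib]
  simp only [map_sub, linearMap_lamPart1, Finset.sum_apply, Pi.mul_apply, Pi.sub_apply, cx]
  refine Finset.sum_congr rfl fun j _ => ?_
  ring

theorem quad_deltaInv1_apply (hP : ∀ c, ∑ j, F.proj j c x * F.lam j x = 0) (b c : Fin n) (a : W1 n)
    (k : ℕ) : quad b c (F.deltaInv1 a k) x =
      (1 / 2 : ℂ) * (∑ j, (F.proj j b x : ℂ) * lin c (a j k) x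
        + ∑ j, (F.proj j c x : ℂ) * lin b (a j k) x) := by
  have key : ∀ b c : Fin n, (∑ j, cx (F.proj j b) * ((1 / 2 : ℂ) • lin c (a j k - F.lamPart1 a j k)
        + lin c (F.lamPart1 a j k))) x =
      (1 / 2 : ℂ) * ∑ j, (F.proj j b x : ℂ) * lin c (a j k) x := by
    intro b c
    have hP' : ∑ j, (F.proj j b x : ℂ) * F.lam j x = 0 := by exact_mod_cast hP b
    have : (1 / 2 : ℂ) * ∑ j, (F.proj j b x : ℂ) * lin c (a j k) x =
      ∑ j, (F.proj j b x : ℂ) * (1 / 2 * lin c (a j k) x)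
      + (∑ j, (F.proj j b x : ℂ) * F.lam j x) *
        (1 / 2 * ∑ q, F.xi q x * lin c (a q k) x) := by
      rw [hP', Finset.mul_sum, zero_mul, add_zero]
      exact Finset.sum_congr rfl fun j _ => by ring
    rw [this, Finset.sum_mul, ← Finset.sum_add_distrib]
    simp only [map_sub, linearMap_lamPart1, Finset.sum_apply, Pi.mul_apply, Pi.add_apply,
      Pi.smul_apply, Pi.sub_apply, smul_eq_mul, cx]
    refine Finset.sum_congr rfl fun j _ => ?_
    ring
  rw [quad_deltaInv1, Pi.add_apply, key, key, mul_add]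

end LocalFields
end WickContact
end

/-! ### The form `r`, the quantum lift and `Δ` in low degrees -/

noncomputable section

namespace WickContact

variable {n : ℕ}

namespace LocalFields

variable (F : LocalFields n)

/-! ### The abelian connection in low degrees -/

theorem val_torsionForm_add_curvForm (i j : Fin n) (k : ℕ) :
    val ((F.torsionForm + F.curvForm) i j k) = 0 := by
  simp only [Pi.add_apply, torsionForm, curvForm]
  split_ifs
  · simp [val_X, val_mul]
  · simp

theorem lin_torsionForm_add_curvForm (c i j : Fin n) :
    lin c ((F.torsionForm + F.curvForm) i j 0) = cx (F.torsionCov c i j) := by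
  simp [torsionForm, curvForm, lin_X, lin_mul, val_X]

theorem val_rIter (N : ℕ) (l : Fin n) (k : ℕ) : val (F.rIter N l k) = 0 := by
  cases N with
  | zero => simp [rIter]
  | succ N => simp [rIter, val_deltaInv2]

theorem val_dNabla1 {a : W1 n} {k : ℕ} (ha : ∀ l, val (a l k) = 0) (i j : Fin n) :
    val (F.dNabla1 a i j k) = 0 := by
  simp [dNabla1, val_nabla, ha, pd_zero]

theorem lin_dNabla1 {a : W1 n} {k : ℕ} (ha : ∀ l c, lin c (a l k) = 0) (c i j : Fin n) :
    lin c (F.dNabla1 a i j k) = 0 := by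
  simp [dNabla1, lin_nabla, ha, pd_zero]

theorem linearMap_iNuSq (L : Fib n →ₗ[Coord n → ℂ] (Coord n → ℂ)) (a : W1 n) (i j : Fin n)
    (k : ℕ) : L (F.iNuSq a i j k) = fun x => Complex.I *
      L (F.circ (a i) (a j) (k + 1) - F.circ (a j) (a i) (k + 1)) x := by
  simp only [iNuSq, iOverNu, map_smul]
  rfl

theorem linearMap_iNuComm (L : Fib n →ₗ[Coord n → ℂ] (Coord n → ℂ)) (a : W1 n) (b : W n)
    (i : Fin n) (k : ℕ) : L (F.iNuComm a b i k) = fun x => Complex.I *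
      L (F.circ (a i) b (k + 1) - F.circ b (a i) (k + 1)) x := by
  simp only [iNuComm, iOverNu, map_smul]
  rfl

theorem val_iNuSq_zero {a : W1 n} (ha : ∀ l c, lin c (a l 0) = 0) (i j : Fin n) :
    val (F.iNuSq a i j 0) = 0 := by
  rw [linearMap_iNuSq, zero_add, val_circ_comm_one]
  funext x
  simp [ha]

theorem lin_iNuSq_zero {a : W1 n} (ha : ∀ l c, lin c (a l 0) = 0) (c i j : Fin n) :
    lin c (F.iNuSq a i j 0) = 0 := by
  rw [linearMap_iNuSq, zero_add, lin_circ_comm_one _ _ _ _ (ha i)]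
  funext x
  simp [ha]

theorem lin_deltaInv2_eq_zero {a : W2 n} {k : ℕ} (ha : ∀ i j, val (a i j k) = 0)
    (c l : Fin n) : lin c (F.deltaInv2 a l k) = 0 := by
  simp [lin_deltaInv2, linearMap_lamPart2, ha]

/-- `T + R` starts in degree one in `y` and `δ⁻¹` raises that degree. By induction `r ∘ r` adds
nothing at `y = 0`, since at leading order it is a Poisson bracket of components without linear
part. -/
theorem lin_rIter_zero (N : ℕ) (l c : Fin n) : lin c (F.rIter N l 0) = 0 := by
  induction N generalizing l c with
  | zero => simp [rIter]
  | succ N ih =>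
    simp only [rIter, Pi.add_apply, map_add]
    rw [lin_deltaInv2_eq_zero, lin_deltaInv2_eq_zero, add_zero]
    · intro i j
      rw [Pi.add_apply, Pi.add_apply, Pi.add_apply, map_add, F.val_dNabla1 (F.val_rIter N · 0),
        F.val_iNuSq_zero ih, add_zero]
    · exact fun i j => F.val_torsionForm_add_curvForm i j 0

/-- The second fibre derivatives of the leading part `δ⁻¹ T` of the form `r`. -/
def rQuad (l b c : Fin n) (x : Coord n) : ℝ :=
  ∑ j, F.proj j b x * (1 / 3 * F.torsionCov c j l x
      - 1 / 6 * F.lam l x * ∑ q, F.xi q x * F.torsionCov c q j x)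
    + ∑ j, F.proj j c x * (1 / 3 * F.torsionCov b j l x
      - 1 / 6 * F.lam l x * ∑ q, F.xi q x * F.torsionCov b q j x)

/-- The curvature is quadratic in `y`, and `d_∇ r` and `r ∘ r` have no linear part at `ν⁰`; so only
the torsion contributes. -/
theorem quad_rIter_two {x : Coord n} (hP : ∀ c, ∑ j, F.proj j c x * F.lam j x = 0)
    (l b c : Fin n) : quad b c (F.rIter 2 l 0) x = (F.rQuad l b c x : ℂ) := by
  simp only [rIter, Pi.add_apply, map_add]
  rw [quad_deltaInv2_apply hP, quad_deltaInv2_apply hP _ _ (F.dNabla1 _ + _)]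
  have h0 : ∀ i j c, lin c ((F.dNabla1 (F.rIter 1) + F.iNuSq (F.rIter 1)) i j 0) = 0 := by
    intro i j c
    rw [Pi.add_apply, Pi.add_apply, Pi.add_apply, map_add, F.lin_dNabla1 (F.lin_rIter_zero 1),
      F.lin_iNuSq_zero (F.lin_rIter_zero 1), add_zero]
  simp only [rIter] at h0
  simp only [h0, lin_torsionForm_add_curvForm, rQuad, cx]
  push_cast
  simp

/-- The sum `(h^{ij} h^{kl} - h^{ji} h^{lk}) a_{ik} b_{jl}` that enters the commutator of two
quadratic functions on the fibres. -/
def quadComm (x : Coord n) (a b : Fin n → Fin n → ℂ) : ℂ :=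
  ∑ i, ∑ j, ∑ k, ∑ l, (F.h i j x * F.h k l x - F.h j i x * F.h l k x) * (a k i * b l j)

/-- At `ν¹` and `y = 0` the only source is the double contraction in `r ∘ r`. Contraction with `ξ`
is enough for `Δ`, and it removes the factor `1/2` of `δ⁻¹`: the `ξ`-part of the two-form is counted
twice, once through each index. -/
theorem sum_xi_lin_rIter_three {x : Coord n} (hP : ∀ c, ∑ j, F.proj j c x * F.lam j x = 0)
    (hlx : ∑ i, F.lam i x * F.xi i x = 1) (c : Fin n) :
    ∑ l, (F.xi l x : ℂ) * lin c (F.rIter 3 l 1) x =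
      (Complex.I / 8) * ∑ j, (F.proj j c x : ℂ) * ∑ l, (F.xi l x : ℂ) *
        F.quadComm x (fun a b => F.rQuad j a b x) (fun a b => F.rQuad l a b x) := by
  set v : Fin n → Fin n → ℂ := fun j l =>
    val ((F.dNabla1 (F.rIter 2) + F.iNuSq (F.rIter 2)) j l 1) x with hv
  have hv' : ∀ j l, v j l = Complex.I / 8 *
      F.quadComm x (fun a b => F.rQuad j a b x) (fun a b => F.rQuad l a b x) := by
    intro j l
    simp only [hv, Pi.add_apply, map_add]
    rw [F.val_dNabla1 (F.val_rIter 2 · 1), linearMap_iNuSq, one_add_one_eq_two,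
      val_circ_comm_two _ _ _ (F.lin_rIter_zero 2 j)]
    simp only [F.lin_rIter_zero, F.quad_rIter_two hP, quadComm]
    simp
    ring
  have hanti : ∀ j l, v j l = -v l j := by
    intro j l
    have : ∀ r : W1 n, (F.dNabla1 r + F.iNuSq r) j l 1 = -(F.dNabla1 r + F.iNuSq r) l j 1 := by
      intro r
      simp only [dNabla1, iNuSq, iOverNu, Pi.add_apply, Pi.sub_apply]
      rw [← neg_sub (F.circ (r l) (r j) 2), smul_neg]
      abel
    simp only [hv]
    rw [this, map_neg]
    rfl
  have hlin : ∀ l, lin c (F.rIter 3 l 1) x = (1 / 2 : ℂ) * ∑ j, (F.proj j c x : ℂ) *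
      (v j l - F.lam l x * ∑ q, F.xi q x * v q j) := by
    intro l
    change lin c ((F.deltaInv2 (F.torsionForm + F.curvForm)
      + F.deltaInv2 (F.dNabla1 (F.rIter 2) + F.iNuSq (F.rIter 2))) l 1) x = _
    rw [Pi.add_apply, Pi.add_apply, map_add, lin_deltaInv2_eq_zero, zero_add,
      lin_deltaInv2_apply hP]
    exact fun i j => F.val_torsionForm_add_curvForm i j 1
  have hlx' : ∑ i, (F.xi i x : ℂ) * F.lam i x = 1 := by
    simp only [mul_comm (F.xi _ x : ℂ)]
    exact_mod_cast hlx
  simp only [hlin]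
  calc ∑ l, (F.xi l x : ℂ) * (1 / 2 * ∑ j, (F.proj j c x : ℂ) *
        (v j l - F.lam l x * ∑ q, F.xi q x * v q j))
      = ∑ j, (F.proj j c x : ℂ) * (1 / 2 * (∑ l, (F.xi l x : ℂ) * v j l
        - (∑ l, (F.xi l x : ℂ) * F.lam l x) * ∑ q, F.xi q x * v q j)) := by
        simp only [Finset.mul_sum, Finset.sum_mul, mul_sub, Finset.sum_sub_distrib]
        congr 1
        · rw [Finset.sum_comm]
          refine Finset.sum_congr rfl fun j _ => Finset.sum_congr rfl fun l _ => by ring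
        · rw [Finset.sum_comm]
          refine Finset.sum_congr rfl fun j _ => ?_
          rw [Finset.sum_comm]
          refine Finset.sum_congr rfl fun j _ => Finset.sum_congr rfl fun l _ => by ring
    _ = ∑ j, (F.proj j c x : ℂ) * ∑ l, (F.xi l x : ℂ) * v j l := by
        refine Finset.sum_congr rfl fun j _ => ?_
        -- Antisymmetry turns the difference of the two contractions with `ξ` into twice one of
        -- them, which cancels the `1/2`.
        have hq : ∑ q, (F.xi q x : ℂ) * v q j = -∑ q, (F.xi q x : ℂ) * v j q := by
          rw [← Finset.sum_neg_distrib]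
          exact Finset.sum_congr rfl fun q _ => by rw [hanti q j, mul_neg]
        rw [hlx', hq]
        ring
    _ = _ := by
        simp only [hv', Finset.mul_sum]
        refine Finset.sum_congr rfl fun j _ => Finset.sum_congr rfl fun l _ => by ring

/-! ### The quantum lift in low degrees -/

theorem val_liftIter (A : ℕ → Coord n → ℂ) (N k : ℕ) : val (F.liftIter A N k) = A k := by
  cases N with
  | zero => simp [liftIter, ofFun, val_C]
  | succ N => simp [liftIter, ofFun, val_C, val_deltaInv1]

theorem lin_r_zero (l c : Fin n) : lin c (F.r l 0) = 0 := by
  rw [r, lin_limit, lin_rIter_zero]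

theorem quad_r_zero {x : Coord n} (hP : ∀ c, ∑ j, F.proj j c x * F.lam j x = 0)
    (l b c : Fin n) : quad b c (F.r l 0) x = (F.rQuad l b c x : ℂ) := by
  rw [r, quad_limit, mul_zero, zero_add, F.quad_rIter_two hP]

/-- The `δ` added to `D` cancels its `-δ`, leaving only terms that raise the total degree after
`δ⁻¹`. -/
theorem lift_step (A : ℕ → Coord n → ℂ) (N : ℕ) : F.liftIter A (N + 1) =
    ofFun A + F.deltaInv1 (F.dNabla0 (F.liftIter A N) + F.iNuComm F.r (F.liftIter A N)) := by
  rw [liftIter, D]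
  congr 2
  abel

/-- All dependence of the lift on `y` enters through `δ*`, where `y` appears projected along `ξ`.
Consequently the term `-δ` of `D` drops out of `i_ξ D Q` at `y = 0`. -/
theorem sum_xi_lin_lift {x : Coord n} (hP : ∀ c, ∑ j, F.proj j c x * F.lam j x = 0)
    (hQ : ∀ j, ∑ c, F.xi c x * F.proj j c x = 0)
    (A : ℕ → Coord n → ℂ) (k : ℕ) : ∑ c, (F.xi c x : ℂ) * lin c (F.lift A k) x = 0 := by
  simp only [lift, lin_limit, lift_step, Pi.add_apply, map_add, ofFun, lin_C, Pi.zero_apply,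
    zero_add, lin_deltaInv1_apply hP, Finset.mul_sum]
  rw [Finset.sum_comm]
  refine Finset.sum_eq_zero fun j _ => ?_
  have : ∑ c, (F.xi c x : ℂ) * F.proj j c x = 0 := by exact_mod_cast hQ j
  simp only [← mul_assoc, ← Finset.sum_mul, this, zero_mul]

theorem val_iNuComm_r_zero (b : W n) (i : Fin n) : val (F.iNuComm F.r b i 0) = 0 := by
  rw [linearMap_iNuComm, zero_add, val_circ_comm_one]
  funext x
  simp [lin_r_zero]

theorem lin_liftIter_zero {x : Coord n} (hP : ∀ c, ∑ j, F.proj j c x * F.lam j x = 0)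
    (A : ℕ → Coord n → ℂ) (N : ℕ) (c : Fin n) :
    lin c (F.liftIter A (N + 1) 0) x = ∑ j, (F.proj j c x : ℂ) * pd j (A 0) x := by
  simp only [lift_step, Pi.add_apply, map_add, ofFun, lin_C, Pi.zero_apply,
    zero_add, lin_deltaInv1_apply hP, val_iNuComm_r_zero, dNabla0, val_nabla, val_liftIter]
  simp

/-- The second fibre derivatives of the quantum lift of `A` at `ν = 0`, before symmetrization. -/
def liftQuad (A : Coord n → ℂ) (b c : Fin n) (x : Coord n) : ℂ :=
  ∑ j, (F.proj j b x : ℂ) *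
    (pd j (fun z => ∑ m, (F.proj m c z : ℂ) * pd m A z) x
      - ∑ l, (F.Gam l c j x : ℂ) * ∑ m, (F.proj m l x : ℂ) * pd m A x
      + Complex.I / 2 * ∑ i, ∑ l, (F.h i l x - F.h l i x) *
        ((F.rQuad j c i x : ℂ) * ∑ m, (F.proj m l x : ℂ) * pd m A x))

/-- The projector identity is needed in a neighbourhood, because the linear part of the first
iterate is differentiated in `x`. -/
theorem quad_liftIter_two {x : Coord n}
    (hP : ∀ᶠ z in nhds x, ∀ c, ∑ j, F.proj j c z * F.lam j z = 0)
    (A : ℕ → Coord n → ℂ) (b c : Fin n) :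
    quad b c (F.liftIter A 2 0) x =
      1 / 2 * (F.liftQuad (A 0) b c x + F.liftQuad (A 0) c b x) := by
  have hPx := hP.self_of_nhds
  have key : ∀ c j, lin c ((F.dNabla0 (F.liftIter A 1) + F.iNuComm F.r (F.liftIter A 1)) j 0) x
      = pd j (fun z => ∑ m, (F.proj m c z : ℂ) * pd m (A 0) z) x
      - ∑ l, (F.Gam l c j x : ℂ) * ∑ m, (F.proj m l x : ℂ) * pd m (A 0) x
      + Complex.I / 2 * ∑ i, ∑ l, (F.h i l x - F.h l i x) *
        ((F.rQuad j c i x : ℂ) * ∑ m, (F.proj m l x : ℂ) * pd m (A 0) x) := by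
    intro c j
    simp only [Pi.add_apply, map_add, dNabla0, lin_nabla, linearMap_iNuComm, zero_add,
      lin_circ_comm_one _ _ _ _ (F.lin_r_zero j), F.quad_r_zero hPx]
    simp only [Pi.sub_apply, Finset.sum_apply, Pi.mul_apply, cx, F.lin_liftIter_zero hPx A 0]
    have : pd j (lin c (F.liftIter A 1 0)) x =
        pd j (fun z => ∑ m, (F.proj m c z : ℂ) * pd m (A 0) z) x := by
      unfold pd
      rw [Filter.EventuallyEq.fderiv_eq]
      filter_upwards [hP] with z hz
      exact F.lin_liftIter_zero hz A 0 c
    rw [this]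
    ring
  rw [lift_step, Pi.add_apply, map_add, Pi.add_apply, quad_deltaInv1_apply hPx]
  simp only [key, ofFun, quad_C, Pi.zero_apply, zero_add, liftQuad]

/-! ### The operator `Δ` in low orders -/

/-- `i_ξ Π` is `i_ξ` at `y = 0` since `λ(ξ) = 1`; there `d_∇` is differentiation in `x`, and `δ`
contributes nothing by `sum_xi_lin_lift`. -/
theorem Delta_apply {x : Coord n} (hP : ∀ c, ∑ j, F.proj j c x * F.lam j x = 0)
    (hQ : ∀ j, ∑ c, F.xi c x * F.proj j c x = 0)
    (hlx : ∑ i, F.lam i x * F.xi i x = 1) (A : ℕ → Coord n → ℂ) (k : ℕ) :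
    F.Delta A k x = ∑ i, (F.xi i x : ℂ) * pd i (A k) x
      + ∑ i, (F.xi i x : ℂ) * val (F.iNuComm F.r (F.lift A) i k) x := by
  have hlx' : ∑ i, (F.xi i x : ℂ) * F.lam i x = 1 := by
    simp only [mul_comm (F.xi _ x : ℂ)]
    exact_mod_cast hlx
  have h1 : F.Delta A k x = ∑ i, (F.xi i x : ℂ) * (F.lam i x *
      ∑ j, (F.xi j x : ℂ) * val (F.D (F.lift A) j k) x) := by
    rw [Delta, constantCoeff_eq_val, linearMap_iXi1]
    simp only [Finset.sum_apply, Pi.mul_apply, Pi1, Pi.smul_apply, map_smul, atZero, val_C,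
      constantCoeff_eq_val, linearMap_iXi1, cx, smul_eq_mul]
  rw [h1]
  simp only [← mul_assoc, ← Finset.sum_mul, hlx', one_mul]
  have h2 := F.sum_xi_lin_lift hP hQ A k
  have hv : val (F.lift A k) = A k := by rw [lift, val_limit, val_liftIter]
  simp only [D, Pi.add_apply, Pi.sub_apply, map_add, map_sub, dNabla0, delta0, dY, val_nabla,
    val_pderiv, hv, mul_add, mul_sub, Finset.sum_add_distrib, Finset.sum_sub_distrib, h2, sub_zero]

theorem Delta_zero {x : Coord n} (hP : ∀ c, ∑ j, F.proj j c x * F.lam j x = 0)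
    (hQ : ∀ j, ∑ c, F.xi c x * F.proj j c x = 0)
    (hlx : ∑ i, F.lam i x * F.xi i x = 1) (A : ℕ → Coord n → ℂ) :
    F.Delta A 0 x = ∑ i, (F.xi i x : ℂ) * pd i (A 0) x := by
  simp [F.Delta_apply hP hQ hlx, val_iNuComm_r_zero]

/-- The constants are `√-1 · 1/2 · √-1/8 = -1/16` for the bracket with the linear part of `r` and
`√-1 · 1/8 · 1/2 = √-1/16` for the double contraction. -/
theorem Delta_one {x : Coord n}
    (hP : ∀ᶠ z in nhds x, ∀ c, ∑ j, F.proj j c z * F.lam j z = 0)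
    (hQ : ∀ j, ∑ c, F.xi c x * F.proj j c x = 0)
    (hlx : ∑ i, F.lam i x * F.xi i x = 1) (A : ℕ → Coord n → ℂ) :
    F.Delta A 1 x = ∑ i, (F.xi i x : ℂ) * pd i (A 1) x
      - 1 / 16 * ∑ i, ∑ j, (F.h i j x - F.h j i x) *
        ((∑ p, (F.proj p i x : ℂ) * ∑ l, (F.xi l x : ℂ) *
          F.quadComm x (fun a b => F.rQuad p a b x) (fun a b => F.rQuad l a b x)) *
          ∑ m, (F.proj m j x : ℂ) * pd m (A 0) x)
      + Complex.I / 16 * ∑ q, (F.xi q x : ℂ) *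
          F.quadComm x (fun a b => F.rQuad q a b x)
            (fun a b => F.liftQuad (A 0) a b x + F.liftQuad (A 0) b a x) := by
  have hPx := hP.self_of_nhds
  have hb1 : ∀ j, lin j (F.lift A 0) x = ∑ m, (F.proj m j x : ℂ) * pd m (A 0) x := fun j => by
    rw [lift, lin_limit, F.lin_liftIter_zero hPx]
  have hb2 : ∀ b c, quad b c (F.lift A 0) x =
      1 / 2 * (F.liftQuad (A 0) b c x + F.liftQuad (A 0) c b x) := fun b c => by
    rw [lift, quad_limit, F.quad_liftIter_two hP]
  have hr1 : ∀ i, ∑ q, (F.xi q x : ℂ) * lin i (F.r q 1) x =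
      (Complex.I / 8) * ∑ j, (F.proj j i x : ℂ) * ∑ l, (F.xi l x : ℂ) *
        F.quadComm x (fun a b => F.rQuad j a b x) (fun a b => F.rQuad l a b x) := fun i => by
    simp only [r, lin_limit]
    exact F.sum_xi_lin_rIter_three hPx hlx i
  have hval : ∀ q, val (F.iNuComm F.r (F.lift A) q 1) x =
      Complex.I / 2 * ∑ i, ∑ j, (F.h i j x - F.h j i x) * (lin i (F.r q 1) x *
        ∑ m, (F.proj m j x : ℂ) * pd m (A 0) x)
      + Complex.I / 16 * F.quadComm x (fun a b => F.rQuad q a b x)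
            (fun a b => F.liftQuad (A 0) a b x + F.liftQuad (A 0) b a x) := by
    intro q
    simp only [linearMap_iNuComm, one_add_one_eq_two, val_circ_comm_two _ _ _ (F.lin_r_zero q),
      F.quad_r_zero hPx, hb1, hb2, quadComm, mul_left_comm _ (1 / 2 : ℂ), ← Finset.mul_sum]
    ring
  rw [F.Delta_apply hPx hQ hlx, sub_eq_add_neg, add_assoc]
  congr 1
  simp only [hval, mul_add, Finset.sum_add_distrib]
  congr 1
  · have : ∑ q, (F.xi q x : ℂ) * (Complex.I / 2 * ∑ i, ∑ j, (F.h i j x - F.h j i x) *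
        (lin i (F.r q 1) x * ∑ m, (F.proj m j x : ℂ) * pd m (A 0) x)) =
        Complex.I / 2 * ∑ i, ∑ j, (F.h i j x - F.h j i x) *
        ((∑ q, (F.xi q x : ℂ) * lin i (F.r q 1) x) * ∑ m, (F.proj m j x : ℂ) * pd m (A 0) x) := by
      simp only [Finset.mul_sum, Finset.sum_mul]
      rw [Finset.sum_comm]
      refine Finset.sum_congr rfl fun i _ => ?_
      rw [Finset.sum_comm]
      refine Finset.sum_congr rfl fun j _ => ?_
      rw [Finset.sum_comm]
      refine Finset.sum_congr rfl fun m _ => Finset.sum_congr rfl fun q _ => by ring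
    rw [this]
    simp only [hr1, mul_assoc (Complex.I / 8), mul_left_comm _ (Complex.I / 8), ← Finset.mul_sum]
    linear_combination (1 / 16 * ∑ i, ∑ j, (F.h i j x - F.h j i x) *
        ((∑ p, (F.proj p i x : ℂ) * ∑ l, (F.xi l x : ℂ) *
          F.quadComm x (fun a b => F.rQuad p a b x) (fun a b => F.rQuad l a b x)) *
          ∑ m, (F.proj m j x : ℂ) * pd m (A 0) x)) * Complex.I_mul_I
  · rw [Finset.mul_sum]
    exact Finset.sum_congr rfl fun q _ => by ring

end LocalFields
end WickContact
end

/-! ### First order identities of a contact metric structure in coordinates -/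

noncomputable section

namespace WickContact

variable {n : ℕ}

theorem pd_add {V : Type*} [NormedAddCommGroup V] [NormedSpace ℝ V] {f g : Coord n → V}
    {x : Coord n} (i : Fin n) (hf : DifferentiableAt ℝ f x) (hg : DifferentiableAt ℝ g x) :
    pd i (fun z => f z + g z) x = pd i f x + pd i g x := by
  simp [pd, fderiv_fun_add hf hg]

theorem pd_sub {V : Type*} [NormedAddCommGroup V] [NormedSpace ℝ V] {f g : Coord n → V}
    {x : Coord n} (i : Fin n) (hf : DifferentiableAt ℝ f x) (hg : DifferentiableAt ℝ g x) :
    pd i (fun z => f z - g z) x = pd i f x - pd i g x := by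
  simp [pd, fderiv_fun_sub hf hg]

theorem pd_mul {𝔸 : Type*} [NormedCommRing 𝔸] [NormedAlgebra ℝ 𝔸] {f g : Coord n → 𝔸}
    {x : Coord n} (i : Fin n) (hf : DifferentiableAt ℝ f x) (hg : DifferentiableAt ℝ g x) :
    pd i (fun z => f z * g z) x = pd i f x * g x + f x * pd i g x := by
  simp [pd, fderiv_fun_mul hf hg]
  ring

theorem pd_sum {V : Type*} [NormedAddCommGroup V] [NormedSpace ℝ V] {ι : Type*} {s : Finset ι}
    {f : ι → Coord n → V} {x : Coord n} (i : Fin n) (hf : ∀ a, DifferentiableAt ℝ (f a) x) :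
    pd i (fun z => ∑ a ∈ s, f a z) x = ∑ a ∈ s, pd i (f a) x := by
  simp [pd, fderiv_fun_sum fun a _ => hf a]

theorem pd_sum_mul {𝔸 : Type*} [NormedCommRing 𝔸] [NormedAlgebra ℝ 𝔸] {ι : Type*} {s : Finset ι}
    {f g : ι → Coord n → 𝔸} {x : Coord n} (i : Fin n) (hf : ∀ a, DifferentiableAt ℝ (f a) x)
    (hg : ∀ a, DifferentiableAt ℝ (g a) x) : pd i (fun z => ∑ a ∈ s, f a z * g a z) x =
      ∑ a ∈ s, pd i (f a) x * g a x + ∑ a ∈ s, f a x * pd i (g a) x := by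
  rw [← Finset.sum_add_distrib, pd_sum (f := fun a z => f a z * g a z) i
    fun a => (hf a).fun_mul (hg a)]
  exact Finset.sum_congr rfl fun a _ => pd_mul i (hf a) (hg a)

theorem pd_const {V : Type*} [NormedAddCommGroup V] [NormedSpace ℝ V] (c : V) (i : Fin n)
    (x : Coord n) : pd i (fun _ => c) x = 0 := by
  simp [pd]

theorem pd_congr {V : Type*} [NormedAddCommGroup V] [NormedSpace ℝ V] {f g : Coord n → V}
    {x : Coord n} (i : Fin n) (h : f =ᶠ[nhds x] g) : pd i f x = pd i g x := by
  rw [pd, pd, h.fderiv_eq]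

theorem pd_comm {V : Type*} [NormedAddCommGroup V] [NormedSpace ℝ V] {f : Coord n → V}
    {x : Coord n} (hf : ContDiffAt ℝ 2 f x) (i j : Fin n) :
    pd i (pd j f) x = pd j (pd i f) x := by
  have hd : DifferentiableAt ℝ (fderiv ℝ f) x :=
    (hf.fderiv_right (m := 1) (by norm_num)).differentiableAt (by norm_num)
  have h : ∀ i j : Fin n, pd i (pd j f) x =
      fderiv ℝ (fderiv ℝ f) x (EuclideanSpace.single i 1) (EuclideanSpace.single j 1) := by
    intro i j
    unfold pd
    rw [fderiv_clm_apply hd (differentiableAt_const _)]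
    simp
  rw [h, h]
  exact (hf.isSymmSndFDerivAt (by simp)) _ _

theorem differentiableAt_pd {V : Type*} [NormedAddCommGroup V] [NormedSpace ℝ V] {f : Coord n → V}
    {x : Coord n} (hf : ContDiffAt ℝ 2 f x) (i : Fin n) : DifferentiableAt ℝ (pd i f) x :=
  ((hf.fderiv_right (m := 1) (by norm_num)).differentiableAt (by norm_num)).clm_apply
    (differentiableAt_const _)

namespace LocalFields

/-- The components of a contact metric structure over an open subset of the coordinate space. -/
structure IsContactMetricOn (F : LocalFields n) (U : Set (Coord n)) : Prop where
  isOpen : IsOpen U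
  lam_smooth : ∀ x ∈ U, ∀ i, ContDiffAt ℝ 2 (F.lam i) x
  xi_smooth : ∀ x ∈ U, ∀ i, DifferentiableAt ℝ (F.xi i) x
  phi_smooth : ∀ x ∈ U, ∀ i j, DifferentiableAt ℝ (F.phi i j) x
  g_smooth : ∀ x ∈ U, ∀ i j, DifferentiableAt ℝ (F.g i j) x
  g_symm : ∀ x ∈ U, ∀ i j, F.g i j x = F.g j i x
  det_g : ∀ x ∈ U, (Matrix.of fun i j => F.g i j x).det ≠ 0
  lam_eq : ∀ x ∈ U, ∀ i, F.lam i x = ∑ j, F.g i j x * F.xi j x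
  lam_xi : ∀ x ∈ U, ∑ i, F.lam i x * F.xi i x = 1
  omega_eq : ∀ x ∈ U, ∀ i j, F.omega i j x = ∑ k, F.g i k x * F.phi k j x
  phi_phi : ∀ x ∈ U, ∀ i j, ∑ k, F.phi i k x * F.phi k j x =
    -(if i = j then 1 else 0) + F.xi i x * F.lam j x
  phi_xi : ∀ x ∈ U, ∀ i, ∑ j, F.phi i j x * F.xi j x = 0

variable (F : LocalFields n) (x : Coord n)

/-! ### Matrices of components at a point -/

/-- The matrix of `g_{ij}`. -/
def gMat : Matrix (Fin n) (Fin n) ℝ := Matrix.of fun i j => F.g i j x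
/-- The matrix of `φ^i_j`. -/
def phiMat : Matrix (Fin n) (Fin n) ℝ := Matrix.of fun i j => F.phi i j x
/-- The matrix of `ω_{ij}`. -/
def omegaMat : Matrix (Fin n) (Fin n) ℝ := Matrix.of fun i j => F.omega i j x
/-- The vector of `ξ^i`. -/
def xiVec : Fin n → ℝ := fun i => F.xi i x
/-- The vector of `λ_i`. -/
def lamVec : Fin n → ℝ := fun i => F.lam i x
/-- The matrix of `Γ^i_{jk}`, for fixed `k`. -/
def chrisMat (k : Fin n) : Matrix (Fin n) (Fin n) ℝ := Matrix.of fun i j => F.chris i j k x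
/-- The vector of `∇^g_k ξ^i`, for fixed `k`. -/
def lcXiVec (k : Fin n) : Fin n → ℝ := fun i => F.lcXi k i x
/-- The matrix of `∇^g_k φ^i_j`, for fixed `k`. -/
def lcPhiMat (k : Fin n) : Matrix (Fin n) (Fin n) ℝ := Matrix.of fun i j => F.lcPhi k i j x
/-- The matrix of `∇^g_k ω_{ij}`, for fixed `k`. -/
def lcOmegaMat (k : Fin n) : Matrix (Fin n) (Fin n) ℝ := Matrix.of fun i j => F.lcOmega k i j x
/-- The matrix of `∇^g_k λ_j`. -/
def lcLamMat : Matrix (Fin n) (Fin n) ℝ := Matrix.of fun k j => F.lcLam k j x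
/-- The matrix of `φ^l_j ∇^g_m λ_l`. -/
def zMat : Matrix (Fin n) (Fin n) ℝ := F.lcLamMat x * F.phiMat x

variable {F x} {U : Set (Coord n)}

theorem omega_antisymm (i j : Fin n) : F.omega i j x = -F.omega j i x := by
  simp [omega]

theorem omegaMat_transpose : (F.omegaMat x).transpose = -F.omegaMat x := by
  ext i j
  exact omega_antisymm j i

theorem lcPhiMat_eq (k : Fin n) : F.lcPhiMat x k = (Matrix.of fun i j => pd k (F.phi i j) x)
    + F.chrisMat x k * F.phiMat x - F.phiMat x * F.chrisMat x k := by
  ext i j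
  simp only [lcPhiMat, chrisMat, phiMat, lcPhi, Matrix.of_apply, Matrix.add_apply,
    Matrix.sub_apply, Matrix.mul_apply, Finset.sum_sub_distrib, add_sub_assoc]
  simp [mul_comm]

theorem lcOmegaMat_eq (k : Fin n) : F.lcOmegaMat x k = (Matrix.of fun i j => pd k (F.omega i j) x)
    - (F.chrisMat x k).transpose * F.omegaMat x - F.omegaMat x * F.chrisMat x k := by
  ext i j
  simp only [lcOmegaMat, chrisMat, omegaMat, lcOmega, Matrix.of_apply, Matrix.transpose_apply,
    Matrix.sub_apply, Matrix.mul_apply, Finset.sum_add_distrib]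
  simp [mul_comm, sub_sub]

theorem lcXiVec_eq (k : Fin n) : F.lcXiVec x k = (fun i => pd k (F.xi i) x)
    + Matrix.mulVec (F.chrisMat x k) (F.xiVec x) := by
  ext i
  simp [lcXiVec, lcXi, chrisMat, xiVec, Matrix.mulVec, dotProduct]

theorem lcLamMat_row_eq (k : Fin n) : (F.lcLamMat x) k = (fun i => pd k (F.lam i) x)
    - Matrix.vecMul (F.lamVec x) (F.chrisMat x k) := by
  ext i
  simp [lcLamMat, lcLam, chrisMat, lamVec, Matrix.vecMul, dotProduct, mul_comm]

theorem lcOmega_antisymm (k i j : Fin n) : F.lcOmega k i j x = -F.lcOmega k j i x := by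
  have hp : pd k (F.omega i j) x = -pd k (F.omega j i) x := by
    have : F.omega i j = fun z => -F.omega j i z := funext fun z => omega_antisymm i j
    rw [this]
    simp [pd]
  have hs : ∑ a, (F.chris a i k x * F.omega a j x + F.chris a j k x * F.omega i a x) =
      -∑ a, (F.chris a j k x * F.omega a i x + F.chris a i k x * F.omega j a x) := by
    rw [← Finset.sum_neg_distrib]
    refine Finset.sum_congr rfl fun a _ => ?_
    rw [omega_antisymm a j, omega_antisymm i a]
    ring
  rw [lcOmega, lcOmega, hp, hs]
  ring

namespace IsContactMetricOn

/-! ### Algebraic identities -/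

theorem gMat_transpose (h : F.IsContactMetricOn U) (hx : x ∈ U) :
    (F.gMat x).transpose = F.gMat x := by
  ext i j
  exact h.g_symm x hx j i

theorem gMat_mul_phiMat (h : F.IsContactMetricOn U) (hx : x ∈ U) :
    F.gMat x * F.phiMat x = F.omegaMat x := by
  ext i j
  exact (h.omega_eq x hx i j).symm

theorem phiMat_transpose_mul_gMat (h : F.IsContactMetricOn U) (hx : x ∈ U) :
    (F.phiMat x).transpose * F.gMat x = -(F.gMat x * F.phiMat x) := by
  rw [h.gMat_mul_phiMat hx, ← omegaMat_transpose, ← h.gMat_mul_phiMat hx, Matrix.transpose_mul,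
    h.gMat_transpose hx]

theorem gMat_mulVec_xiVec (h : F.IsContactMetricOn U) (hx : x ∈ U) :
    Matrix.mulVec (F.gMat x) (F.xiVec x) = F.lamVec x := by
  ext i
  exact (h.lam_eq x hx i).symm

theorem phiMat_mulVec_xiVec (h : F.IsContactMetricOn U) (hx : x ∈ U) :
    Matrix.mulVec (F.phiMat x) (F.xiVec x) = 0 := by
  ext i
  exact h.phi_xi x hx i

theorem phiMat_mul_phiMat (h : F.IsContactMetricOn U) (hx : x ∈ U) :
    F.phiMat x * F.phiMat x = -1 + Matrix.vecMulVec (F.xiVec x) (F.lamVec x) := by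
  ext i j
  simp only [phiMat, Matrix.mul_apply, Matrix.of_apply, h.phi_phi x hx i j]
  simp [Matrix.one_apply, Matrix.vecMulVec_apply, xiVec, lamVec]

theorem omegaMat_mulVec_xiVec (h : F.IsContactMetricOn U) (hx : x ∈ U) :
    Matrix.mulVec (F.omegaMat x) (F.xiVec x) = 0 := by
  rw [← h.gMat_mul_phiMat hx, ← Matrix.mulVec_mulVec, h.phiMat_mulVec_xiVec hx, Matrix.mulVec_zero]

theorem lamVec_vecMul_phiMat (h : F.IsContactMetricOn U) (hx : x ∈ U) :
    Matrix.vecMul (F.lamVec x) (F.phiMat x) = 0 := by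
  rw [← h.gMat_mulVec_xiVec hx, ← Matrix.vecMul_transpose, h.gMat_transpose hx,
    Matrix.vecMul_vecMul, h.gMat_mul_phiMat hx, ← Matrix.mulVec_transpose, omegaMat_transpose,
    Matrix.neg_mulVec, h.omegaMat_mulVec_xiVec hx, neg_zero]

theorem ginv_mul_gMat (h : F.IsContactMetricOn U) (hx : x ∈ U) :
    (F.gMat x)⁻¹ * F.gMat x = 1 :=
  Matrix.nonsing_inv_mul _ (isUnit_iff_ne_zero.2 (h.det_g x hx))

theorem gMat_mul_ginv (h : F.IsContactMetricOn U) (hx : x ∈ U) :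
    F.gMat x * (F.gMat x)⁻¹ = 1 :=
  Matrix.mul_nonsing_inv _ (isUnit_iff_ne_zero.2 (h.det_g x hx))

theorem ginv_transpose (h : F.IsContactMetricOn U) (hx : x ∈ U) :
    ((F.gMat x)⁻¹).transpose = (F.gMat x)⁻¹ := by
  rw [Matrix.transpose_nonsing_inv, h.gMat_transpose hx]

/-! ### First order identities -/

theorem lam_diff (h : F.IsContactMetricOn U) (hx : x ∈ U) (i : Fin n) :
    DifferentiableAt ℝ (F.lam i) x := (h.lam_smooth x hx i).differentiableAt (by norm_num)

theorem eventually_mem (h : F.IsContactMetricOn U) (hx : x ∈ U) : ∀ᶠ z in nhds x, z ∈ U :=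
  h.isOpen.mem_nhds hx

/-- This is `∇^g g = 0`, the only property of the Christoffel symbols used besides their symmetry.
-/
theorem pd_g_eq (h : F.IsContactMetricOn U) (hx : x ∈ U) (k : Fin n) :
    (Matrix.of fun i j => pd k (F.g i j) x) =
      (F.chrisMat x k).transpose * F.gMat x + F.gMat x * F.chrisMat x k := by
  have hsym : ∀ k i j, pd k (F.g i j) x = pd k (F.g j i) x := fun k i j =>
    pd_congr k ((h.eventually_mem hx).mono fun z hz => h.g_symm z hz i j)
  have key : F.gMat x * F.chrisMat x k = Matrix.of fun i j => (1 / 2 : ℝ) *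
      (pd j (F.g i k) x + pd k (F.g i j) x - pd i (F.g j k) x) := by
    have : F.chrisMat x k = (F.gMat x)⁻¹ * Matrix.of fun i j => (1 / 2 : ℝ) *
      (pd j (F.g i k) x + pd k (F.g i j) x - pd i (F.g j k) x) := by
      ext i j
      simp only [chrisMat, chris, Matrix.of_apply, Matrix.mul_apply, ginv, gMat, Finset.mul_sum]
      exact Finset.sum_congr rfl fun l _ => by ring
    rw [this, ← Matrix.mul_assoc, h.gMat_mul_ginv hx, Matrix.one_mul]
  have key2 : (F.chrisMat x k).transpose * F.gMat x = (F.gMat x * F.chrisMat x k).transpose := by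
    rw [Matrix.transpose_mul, h.gMat_transpose hx]
  rw [key2, key]
  ext i j
  simp only [Matrix.add_apply, Matrix.transpose_apply, Matrix.of_apply]
  rw [hsym i j k, hsym j i k, hsym k j i, hsym i k j, hsym j k i]
  ring

theorem chris_symm (h : F.IsContactMetricOn U) (hx : x ∈ U) (a i j : Fin n) :
    F.chris a i j x = F.chris a j i x := by
  have hsym : ∀ k i j, pd k (F.g i j) x = pd k (F.g j i) x := fun k i j =>
    pd_congr k ((h.eventually_mem hx).mono fun z hz => h.g_symm z hz i j)
  simp only [chris]
  congr 1
  refine Finset.sum_congr rfl fun l _ => ?_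
  rw [hsym l i j]
  ring

theorem lcLamMat_row (h : F.IsContactMetricOn U) (hx : x ∈ U) (k : Fin n) :
    (F.lcLamMat x) k = Matrix.mulVec (F.gMat x) (F.lcXiVec x k) := by
  have hd : (fun i => pd k (F.lam i) x) =
      Matrix.mulVec (Matrix.of fun i j => pd k (F.g i j) x) (F.xiVec x)
      + Matrix.mulVec (F.gMat x) (fun i => pd k (F.xi i) x) := by
    ext i
    rw [pd_congr k ((h.eventually_mem hx).mono fun z hz => h.lam_eq z hz i),
      pd_sum_mul k (h.g_smooth x hx i) (h.xi_smooth x hx)]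
    rfl
  rw [lcLamMat_row_eq, lcXiVec_eq, hd, h.pd_g_eq hx, ← h.gMat_mulVec_xiVec hx]
  rw [Matrix.mulVec_add, Matrix.add_mulVec, ← Matrix.mulVec_transpose]
  simp only [Matrix.mulVec_mulVec]
  abel

theorem lcOmegaMat_eq_mul (h : F.IsContactMetricOn U) (hx : x ∈ U) (k : Fin n) :
    F.lcOmegaMat x k = F.gMat x * F.lcPhiMat x k := by
  have hd : (Matrix.of fun i j => pd k (F.omega i j) x) =
      (Matrix.of fun i j => pd k (F.g i j) x) * F.phiMat x
      + F.gMat x * (Matrix.of fun i j => pd k (F.phi i j) x) := by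
    ext i j
    rw [Matrix.of_apply, pd_congr k ((h.eventually_mem hx).mono fun z hz => h.omega_eq z hz i j),
      pd_sum_mul (f := fun l => F.g i l) (g := fun l => F.phi l j) k (h.g_smooth x hx i)
        (h.phi_smooth x hx · j)]
    rfl
  rw [lcOmegaMat_eq, lcPhiMat_eq, hd, h.pd_g_eq hx, ← h.gMat_mul_phiMat hx]
  noncomm_ring

/-- `(∇λ)(ξ)` and `λ(∇ξ)` are equal since `g` is parallel, and their sum is the derivative of `λ(ξ)
= 1`. -/
theorem lcLamMat_mulVec_xiVec (h : F.IsContactMetricOn U) (hx : x ∈ U) :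
    Matrix.mulVec (F.lcLamMat x) (F.xiVec x) = 0 := by
  ext k
  have hd : (fun i => pd k (F.lam i) x) ⬝ᵥ F.xiVec x + F.lamVec x ⬝ᵥ (fun i => pd k (F.xi i) x)
      = 0 := by
    have h1 : pd k (fun z => ∑ i, F.lam i z * F.xi i z) x = 0 := by
      rw [pd_congr k ((h.eventually_mem hx).mono fun z hz => h.lam_xi z hz), pd_const]
    rw [pd_sum_mul k (h.lam_diff hx) (h.xi_smooth x hx)] at h1
    exact h1
  have e1 : (F.lcLamMat x) k ⬝ᵥ F.xiVec x = F.lamVec x ⬝ᵥ F.lcXiVec x k := by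
    rw [h.lcLamMat_row hx, ← h.gMat_mulVec_xiVec hx, dotProduct_comm, Matrix.dotProduct_mulVec,
      ← Matrix.mulVec_transpose, h.gMat_transpose hx]
  have e2 : (F.lcLamMat x) k ⬝ᵥ F.xiVec x + F.lamVec x ⬝ᵥ F.lcXiVec x k = 0 := by
    rw [lcLamMat_row_eq, lcXiVec_eq, sub_dotProduct, dotProduct_add, Matrix.dotProduct_mulVec]
    linarith
  change (F.lcLamMat x) k ⬝ᵥ F.xiVec x = 0
  linarith

theorem lcLamMat_sub_transpose (h : F.IsContactMetricOn U) (hx : x ∈ U) :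
    F.lcLamMat x - (F.lcLamMat x).transpose = F.omegaMat x := by
  ext i j
  simp only [lcLamMat, lcLam, omegaMat, omega, Matrix.sub_apply, Matrix.transpose_apply,
    Matrix.of_apply, h.chris_symm hx _ i j]
  ring

/-- The Reeb orbits are geodesics: `∇λ` and its transpose differ by `ω`, and both `∇λ` and `ω`
annihilate `ξ` on the right. -/
theorem xiVec_vecMul_lcLamMat (h : F.IsContactMetricOn U) (hx : x ∈ U) :
    Matrix.vecMul (F.xiVec x) (F.lcLamMat x) = 0 := by
  rw [← Matrix.mulVec_transpose, show (F.lcLamMat x).transpose = F.lcLamMat x - F.omegaMat x by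
    rw [← h.lcLamMat_sub_transpose hx]; abel, Matrix.sub_mulVec, h.lcLamMat_mulVec_xiVec hx,
    h.omegaMat_mulVec_xiVec hx, sub_zero]

/-- Covariant differentiation of `φ ξ = 0`, lowered with `g`; the skewness of `φ` fixes the sign. -/
theorem lcOmegaMat_mulVec_xiVec (h : F.IsContactMetricOn U) (hx : x ∈ U) (k : Fin n) :
    Matrix.mulVec (F.lcOmegaMat x k) (F.xiVec x) = (F.zMat x) k := by
  have hd : Matrix.mulVec (Matrix.of fun i j => pd k (F.phi i j) x) (F.xiVec x)
      + Matrix.mulVec (F.phiMat x) (fun i => pd k (F.xi i) x) = 0 := by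
    ext i
    have h1 : pd k (fun z => ∑ j, F.phi i j z * F.xi j z) x = 0 := by
      rw [pd_congr k ((h.eventually_mem hx).mono fun z hz => h.phi_xi z hz i), pd_const]
    rw [pd_sum_mul k (h.phi_smooth x hx i) (h.xi_smooth x hx)] at h1
    exact h1
  have e1 : Matrix.mulVec (F.lcPhiMat x k) (F.xiVec x) =
      -Matrix.mulVec (F.phiMat x) (F.lcXiVec x k) := by
    rw [lcPhiMat_eq, lcXiVec_eq, Matrix.sub_mulVec, Matrix.add_mulVec, ← Matrix.mulVec_mulVec,
      h.phiMat_mulVec_xiVec hx, Matrix.mulVec_zero, add_zero, Matrix.mulVec_add,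
      ← Matrix.mulVec_mulVec, eq_neg_of_add_eq_zero_left hd]
    abel
  have e2 : (F.zMat x) k = Matrix.mulVec (F.phiMat x).transpose ((F.lcLamMat x) k) := by
    rw [Matrix.mulVec_transpose]
    rfl
  rw [e2, h.lcLamMat_row hx, Matrix.mulVec_mulVec, h.phiMat_transpose_mul_gMat hx,
    h.lcOmegaMat_eq_mul hx, ← Matrix.mulVec_mulVec, e1, Matrix.mulVec_neg, Matrix.neg_mulVec,
    Matrix.mulVec_mulVec]

/-- This is `d(dλ) = 0`: partial derivatives commute and the symmetric Christoffel symbols cancel in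
the cyclic sum. -/
theorem lcOmega_cyclic (h : F.IsContactMetricOn U) (hx : x ∈ U) (i j k : Fin n) :
    F.lcOmega i j k x + F.lcOmega j k i x + F.lcOmega k i j x = 0 := by
  have hp : ∀ i j k, pd i (F.omega j k) x = pd i (pd j (F.lam k)) x - pd i (pd k (F.lam j)) x :=
    fun i j k => pd_sub i (differentiableAt_pd (h.lam_smooth x hx k) j)
      (differentiableAt_pd (h.lam_smooth x hx j) k)
  have hs : ∀ i j k, pd i (pd j (F.lam k)) x = pd j (pd i (F.lam k)) x := fun i j k =>
    pd_comm (h.lam_smooth x hx k) i j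
  have hG : ∑ a, (F.chris a j i x * F.omega a k x + F.chris a k i x * F.omega j a x)
      + ∑ a, (F.chris a k j x * F.omega a i x + F.chris a i j x * F.omega k a x)
      + ∑ a, (F.chris a i k x * F.omega a j x + F.chris a j k x * F.omega i a x) = 0 := by
    rw [← Finset.sum_add_distrib, ← Finset.sum_add_distrib]
    refine Finset.sum_eq_zero fun a _ => ?_
    rw [h.chris_symm hx a j i, h.chris_symm hx a k i, h.chris_symm hx a k j,
      omega_antisymm a k, omega_antisymm a i, omega_antisymm a j]
    ring
  simp only [lcOmega, hp]
  rw [hs i j k, hs i k j, hs j k i]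
  linarith

/-! ### The symmetry of the tensor `φ^l_j ∇^g_m λ_l` -/

theorem sum_xi_lcOmegaMat (h : F.IsContactMetricOn U) (hx : x ∈ U) :
    ∑ k, F.xi k x • F.lcOmegaMat x k = (F.zMat x).transpose - F.zMat x := by
  ext i j
  have hz : ∀ i j, ∑ k, F.lcOmega i j k x * F.xi k x = F.zMat x i j := fun i j =>
    congrFun (h.lcOmegaMat_mulVec_xiVec hx i) j
  simp only [Matrix.sum_apply, Matrix.smul_apply, Matrix.sub_apply, Matrix.transpose_apply,
    smul_eq_mul]
  rw [← hz i j, ← hz j i, ← Finset.sum_sub_distrib]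
  refine Finset.sum_congr rfl fun k _ => ?_
  have h1 := h.lcOmega_cyclic hx i j k
  have h2 : F.lcOmega j k i x = -F.lcOmega j i k x := lcOmega_antisymm j k i
  change F.xi k x * F.lcOmega k i j x = _
  linear_combination F.xi k x * h1 - F.xi k x * h2

/-- Covariant differentiation of `φ² = -I + ξ ⊗ λ`, lowered with `g`. -/
theorem lcOmegaMat_mul_phiMat (h : F.IsContactMetricOn U) (hx : x ∈ U) (k : Fin n) :
    F.lcOmegaMat x k * F.phiMat x - (F.phiMat x).transpose * F.lcOmegaMat x k =
      Matrix.vecMulVec (F.lcLamMat x k) (F.lamVec x)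
        + Matrix.vecMulVec (F.lamVec x) (F.lcLamMat x k) := by
  have hd : (Matrix.of fun i j => pd k (F.phi i j) x) * F.phiMat x
      + F.phiMat x * (Matrix.of fun i j => pd k (F.phi i j) x) =
      Matrix.vecMulVec (fun i => pd k (F.xi i) x) (F.lamVec x)
      + Matrix.vecMulVec (F.xiVec x) (fun i => pd k (F.lam i) x) := by
    ext i j
    have h1 : pd k (fun z => ∑ l, F.phi i l z * F.phi l j z) x =
        pd k (fun z => -(if i = j then 1 else 0) + F.xi i z * F.lam j z) x :=
      pd_congr k ((h.eventually_mem hx).mono fun z hz => h.phi_phi z hz i j)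
    rw [pd_sum_mul (g := fun l => F.phi l j) k (h.phi_smooth x hx i) (h.phi_smooth x hx · j),
      pd_add k (differentiableAt_const _) ((h.xi_smooth x hx i).fun_mul (h.lam_diff hx j)), pd_const,
      zero_add, pd_mul k (h.xi_smooth x hx i) (h.lam_diff hx j)] at h1
    exact h1
  have e1 : F.lcPhiMat x k * F.phiMat x + F.phiMat x * F.lcPhiMat x k =
      Matrix.vecMulVec (F.lcXiVec x k) (F.lamVec x)
        + Matrix.vecMulVec (F.xiVec x) (F.lcLamMat x k) := by
    have e2 : F.lcPhiMat x k * F.phiMat x + F.phiMat x * F.lcPhiMat x k =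
        ((Matrix.of fun i j => pd k (F.phi i j) x) * F.phiMat x
        + F.phiMat x * (Matrix.of fun i j => pd k (F.phi i j) x))
        + F.chrisMat x k * (F.phiMat x * F.phiMat x)
        - (F.phiMat x * F.phiMat x) * F.chrisMat x k := by
      rw [lcPhiMat_eq]
      noncomm_ring
    rw [e2, hd, h.phiMat_mul_phiMat hx, lcXiVec_eq, lcLamMat_row_eq, mul_add, add_mul,
      Matrix.add_vecMulVec, Matrix.vecMulVec_sub, Matrix.mul_vecMulVec, Matrix.vecMulVec_mul]
    noncomm_ring
  have e3 : F.lcOmegaMat x k * F.phiMat x - (F.phiMat x).transpose * F.lcOmegaMat x k =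
      F.gMat x * (F.lcPhiMat x k * F.phiMat x + F.phiMat x * F.lcPhiMat x k) := by
    rw [h.lcOmegaMat_eq_mul hx, ← Matrix.mul_assoc (F.phiMat x).transpose,
      h.phiMat_transpose_mul_gMat hx]
    noncomm_ring
  rw [e3, e1, mul_add, Matrix.mul_vecMulVec, Matrix.mul_vecMulVec, ← h.lcLamMat_row hx,
    h.gMat_mulVec_xiVec hx]

/-- By `sum_xi_lcOmegaMat` the claim is equivalent to `∇^g_ξ ω = 0`. With `A = ∇λ`, the derivative
of `φ²` along `ξ` shows that `A + Aᵗ` intertwines `φ` with `φᵗ`; since `A - Aᵗ = ω` anti-intertwines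
them, the two halves of `Zᵗ - Z` vanish separately. -/
theorem zMat_symm (h : F.IsContactMetricOn U) (hx : x ∈ U) :
    (F.zMat x).transpose = F.zMat x := by
  set A := F.lcLamMat x with hA
  set P := F.phiMat x with hP
  have hAx : ∑ k, F.xi k x • A k = 0 := by
    ext j
    have := congrFun (h.xiVec_vecMul_lcLamMat hx) j
    simpa [Matrix.vecMul, dotProduct, xiVec, Finset.sum_apply] using this
  have hN : ((F.zMat x).transpose - F.zMat x) * P
      - P.transpose * ((F.zMat x).transpose - F.zMat x) = 0 := by
    rw [← h.sum_xi_lcOmegaMat hx, Finset.sum_mul, Finset.mul_sum, ← Finset.sum_sub_distrib]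
    simp only [Matrix.smul_mul, Matrix.mul_smul, ← smul_sub, hP, h.lcOmegaMat_mul_phiMat hx]
    simp only [smul_add, Finset.sum_add_distrib]
    have e1 : ∑ k, F.xi k x • Matrix.vecMulVec (A k) (F.lamVec x) =
        Matrix.vecMulVec (∑ k, F.xi k x • A k) (F.lamVec x) := by
      ext i j
      simp [Matrix.sum_apply, Matrix.vecMulVec_apply, Finset.sum_mul, mul_assoc]
    have e2 : ∑ k, F.xi k x • Matrix.vecMulVec (F.lamVec x) (A k) =
        Matrix.vecMulVec (F.lamVec x) (∑ k, F.xi k x • A k) := by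
      ext i j
      simp [Matrix.sum_apply, Matrix.vecMulVec_apply, Finset.mul_sum, mul_left_comm]
    rw [e1, e2, hAx]
    simp
  have hAPP : A * (P * P) = -A := by
    rw [hP, h.phiMat_mul_phiMat hx, mul_add, Matrix.mul_vecMulVec, h.lcLamMat_mulVec_xiVec hx]
    simp
  have hAtPP : A.transpose * (P * P) = -A.transpose := by
    rw [hP, h.phiMat_mul_phiMat hx, mul_add, Matrix.mul_vecMulVec, Matrix.mulVec_transpose,
      h.xiVec_vecMul_lcLamMat hx]
    simp
  have hPPA : P.transpose * P.transpose * A.transpose = -A.transpose := by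
    rw [← Matrix.transpose_mul, ← Matrix.transpose_mul, hAPP, Matrix.transpose_neg]
  have hZ : F.zMat x = A * P := rfl
  have hZt : (F.zMat x).transpose = P.transpose * A.transpose := by rw [hZ, Matrix.transpose_mul]
  -- The outer products in `lcOmegaMat_mul_phiMat` disappeared along `ξ`; expanding `hN` with `A φ²
  -- = -A` leaves this.
  have hL : P.transpose * (A + A.transpose) * P = -(A + A.transpose) := by
    have e : ((F.zMat x).transpose - F.zMat x) * P
      - P.transpose * ((F.zMat x).transpose - F.zMat x) =
        P.transpose * (A + A.transpose) * P - A * (P * P)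
        - P.transpose * P.transpose * A.transpose := by
      rw [hZ, Matrix.transpose_mul]; noncomm_ring
    rw [e, hAPP, hPPA] at hN
    rw [← sub_eq_zero, ← hN]
    abel
  -- Multiplying `hL` by `φ` on the right and using `φ² = -1` on the range that matters.
  have hL2 : P.transpose * (A + A.transpose) = (A + A.transpose) * P := by
    have e : P.transpose * (A + A.transpose) * P * P = -((A + A.transpose) * P) := by
      rw [hL, neg_mul]
    have e' : P.transpose * (A + A.transpose) * P * P =
        P.transpose * (A * (P * P) + A.transpose * (P * P)) := by noncomm_ring
    rw [e', hAPP, hAtPP, ← neg_add, mul_neg] at e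
    exact neg_injective e
  have hw : P.transpose * F.omegaMat x = -(F.omegaMat x * P) := by
    rw [← h.gMat_mul_phiMat hx, ← Matrix.mul_assoc, h.phiMat_transpose_mul_gMat hx, neg_mul]
  rw [← h.lcLamMat_sub_transpose hx] at hw
  have h2 : (2 : ℝ) • ((F.zMat x).transpose - F.zMat x) = 0 := by
    rw [hZt, hZ]
    have e : (2 : ℝ) • (P.transpose * A.transpose - A * P) =
      (P.transpose * (A + A.transpose) - (A + A.transpose) * P)
      - (P.transpose * (A - A.transpose) + (A - A.transpose) * P) := by
      rw [two_smul]; noncomm_ring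
    rw [e, hL2, hw]
    simp [hA]
  exact sub_eq_zero.1 ((smul_eq_zero.1 h2).resolve_left two_ne_zero)

end IsContactMetricOn

end LocalFields
end WickContact
end

/-! ### Torsion, inverse metric and Lie derivatives along the Reeb field -/

noncomputable section

namespace WickContact

variable {n : ℕ}

namespace LocalFields

variable {F : LocalFields n} {x : Coord n} {U : Set (Coord n)}

/-- The contraction of the second index of a covariant tensor with the projector. -/
theorem sum_proj_mul (f : Fin n → ℝ) (b : Fin n) :
    ∑ j, F.proj j b x * f j = f b - F.lam b x * ∑ j, F.xi j x * f j := by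
  simp only [proj, sub_mul, Finset.sum_sub_distrib, ite_mul, one_mul, zero_mul, Finset.mul_sum]
  simp only [Finset.sum_ite_eq', Finset.mem_univ, if_true]
  congr 1
  exact Finset.sum_congr rfl fun j _ => by ring

theorem rQuad_symm (l b c : Fin n) :
    F.rQuad l b c x = F.rQuad l c b x := by
  rw [rQuad, rQuad, add_comm]

namespace IsContactMetricOn

theorem sum_proj_lam (h : F.IsContactMetricOn U) (hx : x ∈ U) (c : Fin n) :
    ∑ j, F.proj j c x * F.lam j x = 0 := by
  have := h.lam_xi x hx
  rw [sum_proj_mul]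
  simp only [mul_comm (F.xi _ x), this]
  ring

theorem sum_xi_proj (h : F.IsContactMetricOn U) (hx : x ∈ U) (j : Fin n) :
    ∑ c, F.xi c x * F.proj j c x = 0 := by
  have h1 := h.lam_xi x hx
  simp only [proj, mul_sub, Finset.sum_sub_distrib, mul_ite, mul_one, mul_zero,
    mul_left_comm (F.xi _ x) (F.xi j x), ← Finset.mul_sum]
  simp only [mul_comm (F.xi _ x) (F.lam _ x), h1]
  simp

/-! ### The torsion -/

theorem zMat_comm (h : F.IsContactMetricOn U) (hx : x ∈ U) (i j : Fin n) :
    F.zMat x i j = F.zMat x j i := congrFun (congrFun (h.zMat_symm hx) j) i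

/-- Since `ω φ = -g + λ ⊗ λ`, the first term of `S` gives `½ ∇ω` and a multiple of `λ`; the second
gives the other `Z` term, and the third dies by `ω ξ = 0`. -/
theorem omega_mul_S (h : F.IsContactMetricOn U) (hx : x ∈ U) (k j m : Fin n) :
    ∑ a, F.omega k a x * F.S a j m x = 1 / 2 * F.lcOmega m k j x
      + 1 / 2 * (F.lam k x * F.zMat x m j) + 1 / 2 * (F.lam j x * F.zMat x m k) := by
  have hS : (Matrix.of fun i j => F.S i j m x) = -((1 / 2 : ℝ) • (F.phiMat x * F.lcPhiMat x m))
      - (1 / 2 : ℝ) • Matrix.vecMulVec (F.lcXiVec x m) (F.lamVec x)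
      + Matrix.vecMulVec (F.xiVec x) (F.lcLamMat x m) := by
    ext i j
    simp only [Matrix.of_apply, S, Matrix.add_apply, Matrix.sub_apply, Matrix.neg_apply,
      Matrix.smul_apply, Matrix.vecMulVec_apply, Matrix.mul_apply, smul_eq_mul]
    simp only [phiMat, lcPhiMat, lamVec, lcXiVec, xiVec, lcLamMat, Matrix.of_apply]
    ring
  have hrow : Matrix.vecMul (F.lamVec x) (F.lcPhiMat x m) = -(F.zMat x m) := by
    rw [← h.lcOmegaMat_mulVec_xiVec hx, ← h.gMat_mulVec_xiVec hx, ← Matrix.vecMul_transpose,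
      h.gMat_transpose hx, Matrix.vecMul_vecMul, ← h.lcOmegaMat_eq_mul hx,
      ← Matrix.mulVec_transpose, ← Matrix.neg_mulVec]
    congr 1
    ext i j
    exact lcOmega_antisymm m j i
  have hcol : Matrix.mulVec (F.omegaMat x) (F.lcXiVec x m) = -(F.zMat x m) := by
    have e2 : (F.zMat x) m = Matrix.mulVec (F.phiMat x).transpose ((F.lcLamMat x) m) := by
      rw [Matrix.mulVec_transpose]
      rfl
    rw [e2, h.lcLamMat_row hx, Matrix.mulVec_mulVec, h.phiMat_transpose_mul_gMat hx,
      Matrix.neg_mulVec, neg_neg, h.gMat_mul_phiMat hx]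
  have key : F.omegaMat x * (Matrix.of fun i j => F.S i j m x) =
      (1 / 2 : ℝ) • F.lcOmegaMat x m
      + (1 / 2 : ℝ) • Matrix.vecMulVec (F.lamVec x) (F.zMat x m)
      + (1 / 2 : ℝ) • Matrix.vecMulVec (F.zMat x m) (F.lamVec x) := by
    have e : F.omegaMat x * (F.phiMat x * F.lcPhiMat x m) = -F.lcOmegaMat x m
        - Matrix.vecMulVec (F.lamVec x) (F.zMat x m) := by
      rw [← h.gMat_mul_phiMat hx, Matrix.mul_assoc, ← Matrix.mul_assoc (F.phiMat x),
        h.phiMat_mul_phiMat hx, add_mul, Matrix.vecMulVec_mul, hrow, mul_add,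
        Matrix.mul_vecMulVec, h.gMat_mulVec_xiVec hx, h.lcOmegaMat_eq_mul hx,
        Matrix.vecMulVec_neg]
      noncomm_ring
    rw [hS, mul_add, mul_sub, mul_neg, Matrix.mul_smul, Matrix.mul_smul, e, Matrix.mul_vecMulVec,
      Matrix.mul_vecMulVec, hcol, h.omegaMat_mulVec_xiVec hx, Matrix.neg_vecMulVec,
      Matrix.zero_vecMulVec]
    module
  have := congrFun (congrFun key k) j
  simp only [Matrix.mul_apply, Matrix.add_apply, Matrix.smul_apply, Matrix.vecMulVec_apply,
    smul_eq_mul] at this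
  rw [mul_comm (F.lam j x)]
  exact this

/-- Closedness of `ω` merges the two covariant derivatives into one, and the terms with `λ_k` cancel
because `Z` is symmetric. -/
theorem torsionCov_eq (h : F.IsContactMetricOn U) (hx : x ∈ U) (k i j : Fin n) :
    F.torsionCov k i j x = 1 / 2 * (-F.lcOmega k i j x + F.lam i x * F.zMat x j k
      - F.lam j x * F.zMat x i k) := by
  simp only [torsionCov, torsion, mul_sub, Finset.sum_sub_distrib, h.omega_mul_S hx]
  have h1 := h.lcOmega_cyclic hx k i j
  have h2 : F.lcOmega i k j x = -F.lcOmega i j k x := lcOmega_antisymm i k j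
  have h3 := h.zMat_comm hx i j
  linear_combination 1 / 2 * h1 - 1 / 2 * h2 - 1 / 2 * F.lam k x * h3

theorem sum_xi_lcOmega (h : F.IsContactMetricOn U) (hx : x ∈ U) (c j : Fin n) :
    ∑ q, F.xi q x * F.lcOmega c j q x = F.zMat x c j := by
  rw [← congrFun (h.lcOmegaMat_mulVec_xiVec hx c) j]
  exact Finset.sum_congr rfl fun q _ => mul_comm _ _

theorem sum_xi_zMat (h : F.IsContactMetricOn U) (hx : x ∈ U) (j : Fin n) :
    ∑ q, F.xi q x * F.zMat x q j = 0 := by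
  have : Matrix.vecMul (F.xiVec x) (F.zMat x) = 0 := by
    rw [zMat, ← Matrix.vecMul_vecMul, h.xiVec_vecMul_lcLamMat hx, Matrix.zero_vecMul]
  exact congrFun this j

theorem sum_xi_lam (h : F.IsContactMetricOn U) (hx : x ∈ U) :
    ∑ q, F.xi q x * F.lam q x = 1 := by
  rw [← h.lam_xi x hx]
  exact Finset.sum_congr rfl fun q _ => mul_comm _ _

theorem sum_xi_torsionCov (h : F.IsContactMetricOn U) (hx : x ∈ U) (c j : Fin n) :
    ∑ q, F.xi q x * F.torsionCov c q j x = F.zMat x c j := by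
  have : ∀ q, F.xi q x * F.torsionCov c q j x = 1 / 2 * (F.xi q x * F.lcOmega c j q x)
      + 1 / 2 * (F.xi q x * F.lam q x) * F.zMat x j c
      - 1 / 2 * F.lam j x * (F.xi q x * F.zMat x q c) := fun q => by
    rw [h.torsionCov_eq hx, lcOmega_antisymm c q j]
    ring
  simp only [this, Finset.sum_add_distrib, Finset.sum_sub_distrib, ← Finset.mul_sum,
    ← Finset.sum_mul, h.sum_xi_lcOmega hx, h.sum_xi_lam hx, h.sum_xi_zMat hx]
  rw [h.zMat_comm hx j c]
  ring

theorem rQuad_eq (h : F.IsContactMetricOn U) (hx : x ∈ U) (l b c : Fin n) :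
    F.rQuad l b c x = -(1 / 6) * (F.lcOmega c b l x + F.lcOmega b c l x
      + F.lam b x * F.zMat x c l + F.lam c x * F.zMat x b l) - 2 / 3 * F.lam l x * F.zMat x b c := by
  have key : ∀ b c, ∑ j, F.proj j b x * (1 / 3 * F.torsionCov c j l x
      - 1 / 6 * F.lam l x * ∑ q, F.xi q x * F.torsionCov c q j x) =
      -(1 / 6) * (F.lcOmega c b l x + F.lam b x * F.zMat x c l)
        - 1 / 3 * F.lam l x * F.zMat x b c := by
    intro b c
    simp only [h.sum_xi_torsionCov hx]
    rw [sum_proj_mul]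
    have e : ∑ j, F.xi j x * (1 / 3 * F.torsionCov c j l x - 1 / 6 * F.lam l x * F.zMat x c j) =
        1 / 3 * ∑ j, F.xi j x * F.torsionCov c j l x
        - 1 / 6 * F.lam l x * ∑ j, F.xi j x * F.zMat x j c := by
      rw [Finset.mul_sum, Finset.mul_sum, ← Finset.sum_sub_distrib]
      refine Finset.sum_congr rfl fun j _ => ?_
      rw [h.zMat_comm hx c j]
      ring
    rw [e, h.sum_xi_torsionCov hx, h.sum_xi_zMat hx, h.torsionCov_eq hx]
    rw [h.zMat_comm hx c b, h.zMat_comm hx l c]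
    ring
  rw [rQuad, key, key, h.zMat_comm hx c b]
  ring

/-- The weights of `δ⁻¹` add up as `-1/6 - 1/6 - 2/3 = -1`. This puts `Z` into every double
contraction that enters `Δ₁`. -/
theorem sum_xi_rQuad (h : F.IsContactMetricOn U) (hx : x ∈ U) (b c : Fin n) :
    ∑ l, F.xi l x * F.rQuad l b c x = -F.zMat x b c := by
  have : ∀ l, F.xi l x * F.rQuad l b c x = -(1 / 6) * (F.xi l x * F.lcOmega c b l x)
      - (1 / 6) * (F.xi l x * F.lcOmega b c l x)
      - (1 / 6) * F.lam b x * (F.xi l x * F.zMat x l c)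
      - (1 / 6) * F.lam c x * (F.xi l x * F.zMat x l b)
      - 2 / 3 * F.zMat x b c * (F.xi l x * F.lam l x) := fun l => by
    rw [h.rQuad_eq hx, h.zMat_comm hx c l, h.zMat_comm hx b l]
    ring
  simp only [this, Finset.sum_sub_distrib, ← Finset.mul_sum,
    h.sum_xi_lcOmega hx, h.sum_xi_lam hx, h.sum_xi_zMat hx]
  rw [h.zMat_comm hx c b]
  ring

/-! ### The inverse metric, the Jacobi bivector and Lie derivatives along `ξ` -/

/-- Cramer's rule: determinants are polynomial in the entries, and an entry of the adjugate is the
determinant of `g` with one row replaced by a basis vector. -/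
theorem ginv_diff (h : F.IsContactMetricOn U) (hx : x ∈ U) (i j : Fin n) :
    DifferentiableAt ℝ (F.ginv i j) x := by
  have hdet : ∀ M : Matrix (Fin n) (Fin n) (Coord n → ℝ),
      (∀ i j, DifferentiableAt ℝ (M i j) x) →
        DifferentiableAt ℝ (fun z => (Matrix.of fun i j => M i j z).det) x := by
    intro M hM
    simp only [Matrix.det_apply, Matrix.of_apply]
    exact DifferentiableAt.fun_sum fun s _ =>
      (HasFDerivAt.finsetProd fun i _ => (hM (s i) i).hasFDerivAt).differentiableAt.const_smul _
  have hadj : DifferentiableAt ℝ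
      (fun z => (Matrix.of fun a b => F.g a b z).adjugate i j) x := by
    have := hdet (fun a b => if a = j then fun _ => (Pi.single i 1 : Fin n → ℝ) b else F.g a b)
      fun a b => by
        split_ifs
        · exact differentiableAt_const _
        · exact h.g_smooth x hx a b
    refine this.congr_of_eventuallyEq (Filter.Eventually.of_forall fun z => ?_)
    simp only [Matrix.adjugate_apply]
    congr 1
    ext a b
    simp only [Matrix.updateRow_apply, Matrix.of_apply]
    split_ifs <;> rfl
  have : F.ginv i j = fun z => ((Matrix.of fun a b => F.g a b z).det)⁻¹ *
      (Matrix.of fun a b => F.g a b z).adjugate i j := by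
    funext z
    simp [ginv, Matrix.inv_def]
  rw [this]
  exact ((hdet (fun a b => F.g a b) (h.g_smooth x hx)).inv (h.det_g x hx)).mul hadj

theorem pd_ginv_eq (h : F.IsContactMetricOn U) (hx : x ∈ U) (k : Fin n) :
    (Matrix.of fun i j => pd k (F.ginv i j) x) =
      -((F.gMat x)⁻¹ * (F.chrisMat x k).transpose) - F.chrisMat x k * (F.gMat x)⁻¹ := by
  have hd : (Matrix.of fun i j => pd k (F.ginv i j) x) * F.gMat x
      + (F.gMat x)⁻¹ * (Matrix.of fun i j => pd k (F.g i j) x) = 0 := by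
    ext i j
    have h1 : pd k (fun z => ∑ l, F.ginv i l z * F.g l j z) x = 0 := by
      rw [pd_congr (f := fun z => ∑ l, F.ginv i l z * F.g l j z) (g := fun _ => (1 : Matrix (Fin n) (Fin n) ℝ) i j) k
        ((h.eventually_mem hx).mono fun z hz => congrFun (congrFun (h.ginv_mul_gMat hz) i) j),
        pd_const]
    rw [pd_sum_mul (f := fun l => F.ginv i l) (g := fun l => F.g l j) k (h.ginv_diff hx i)
      (h.g_smooth x hx · j)] at h1
    exact h1
  have hd' := congrArg (· * (F.gMat x)⁻¹) hd
  simp only [add_mul, Matrix.mul_assoc, h.gMat_mul_ginv hx, Matrix.mul_one, zero_mul,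
    h.pd_g_eq hx] at hd'
  rw [eq_neg_of_add_eq_zero_left hd', mul_add, ← Matrix.mul_assoc ((F.gMat x)⁻¹) (F.gMat x),
    h.ginv_mul_gMat hx]
  noncomm_ring

/-- The matrix of `∂_k ξ^i`, with `k` the row index. -/
theorem pd_xi_eq (h : F.IsContactMetricOn U) (hx : x ∈ U) :
    (Matrix.of fun k i => pd k (F.xi i) x) = F.lcLamMat x * (F.gMat x)⁻¹
      - (∑ k, F.xi k x • F.chrisMat x k).transpose := by
  have hX : F.lcLamMat x * (F.gMat x)⁻¹ = Matrix.of fun k i => F.lcXi k i x := by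
    have : F.lcLamMat x = (Matrix.of fun k i => F.lcXi k i x) * F.gMat x := by
      ext k j
      rw [h.lcLamMat_row hx, ← Matrix.vecMul_transpose, h.gMat_transpose hx]
      rfl
    rw [this, Matrix.mul_assoc, h.gMat_mul_ginv hx, Matrix.mul_one]
  rw [hX]
  ext k i
  simp only [Matrix.of_apply, lcXi, Matrix.sub_apply, Matrix.transpose_apply, Matrix.sum_apply,
    Matrix.smul_apply, smul_eq_mul, chrisMat]
  have : ∑ a, F.chris i a k x * F.xi a x = ∑ a, F.xi a x * F.chris i k a x :=
    Finset.sum_congr rfl fun a _ => by rw [h.chris_symm hx, mul_comm]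
  rw [this]
  ring

theorem lieMetric_eq (h : F.IsContactMetricOn U) (hx : x ∈ U) :
    (Matrix.of fun i j => F.lieMetric i j x) = F.lcLamMat x + (F.lcLamMat x).transpose := by
  have e : (Matrix.of fun i j => F.lieMetric i j x) =
      ∑ k, F.xi k x • (Matrix.of fun i j => pd k (F.g i j) x)
      + (Matrix.of fun k i => pd k (F.xi i) x) * F.gMat x
      + F.gMat x * (Matrix.of fun k i => pd k (F.xi i) x).transpose := by
    ext i j
    simp only [Matrix.of_apply, lieMetric, Finset.sum_add_distrib, Matrix.add_apply,
      Matrix.sum_apply, Matrix.smul_apply, Matrix.mul_apply, Matrix.transpose_apply, smul_eq_mul,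
      gMat]
    simp only [mul_comm (pd _ (F.xi _) x)]
  rw [e, h.pd_xi_eq hx]
  have e1 : ∑ k, F.xi k x • (Matrix.of fun i j => pd k (F.g i j) x) =
      (∑ k, F.xi k x • F.chrisMat x k).transpose * F.gMat x
        + F.gMat x * ∑ k, F.xi k x • F.chrisMat x k := by
    simp only [h.pd_g_eq hx, smul_add, Finset.sum_add_distrib, Matrix.transpose_sum,
      Matrix.transpose_smul, Finset.sum_mul, Finset.mul_sum, Matrix.smul_mul, Matrix.mul_smul]
  rw [e1]
  simp only [sub_mul, Matrix.transpose_sub, Matrix.transpose_transpose, mul_sub,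
    Matrix.transpose_mul, h.ginv_transpose hx]
  rw [Matrix.mul_assoc, h.ginv_mul_gMat hx, ← Matrix.mul_assoc, h.gMat_mul_ginv hx]
  noncomm_ring

/-- Rewriting partial derivatives by covariant ones, all Christoffel symbols cancel. Together with
`lieMetric_eq` this is `L_ξ g⁻¹ = -g⁻¹ (L_ξ g) g⁻¹`. -/
theorem lieGinv_eq (h : F.IsContactMetricOn U) (hx : x ∈ U) :
    (Matrix.of fun i j => F.lieGinv i j x) =
      -((F.gMat x)⁻¹ * (F.lcLamMat x + (F.lcLamMat x).transpose) * (F.gMat x)⁻¹) := by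
  have e : (Matrix.of fun i j => F.lieGinv i j x) =
      ∑ k, F.xi k x • (Matrix.of fun i j => pd k (F.ginv i j) x)
      - (Matrix.of fun k i => pd k (F.xi i) x).transpose * (F.gMat x)⁻¹
      - (F.gMat x)⁻¹ * (Matrix.of fun k i => pd k (F.xi i) x) := by
    ext i j
    simp only [Matrix.of_apply, lieGinv, Finset.sum_sub_distrib, Matrix.sub_apply,
      Matrix.sum_apply, Matrix.smul_apply, Matrix.mul_apply, Matrix.transpose_apply, smul_eq_mul,
      gMat]
    simp only [mul_comm (pd _ (F.xi _) x)]
    rfl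
  rw [e, h.pd_xi_eq hx]
  have e1 : ∑ k, F.xi k x • (Matrix.of fun i j => pd k (F.ginv i j) x) =
      -((F.gMat x)⁻¹ * (∑ k, F.xi k x • F.chrisMat x k).transpose)
        - (∑ k, F.xi k x • F.chrisMat x k) * (F.gMat x)⁻¹ := by
    simp only [h.pd_ginv_eq hx, smul_sub, smul_neg, Finset.sum_sub_distrib,
      Finset.sum_neg_distrib, Matrix.transpose_sum, Matrix.transpose_smul, Finset.sum_mul,
      Finset.mul_sum, Matrix.smul_mul, Matrix.mul_smul]
  rw [e1]
  simp only [Matrix.transpose_sub, Matrix.transpose_transpose,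
    Matrix.transpose_mul, h.ginv_transpose hx]
  noncomm_ring

theorem piv_eq : (Matrix.of fun i j => F.piv i j x) = (F.gMat x)⁻¹ * (F.phiMat x).transpose := by
  ext i j
  rfl

theorem phiMat_mul_ginv (h : F.IsContactMetricOn U) (hx : x ∈ U) :
    F.phiMat x * (F.gMat x)⁻¹ = -((F.gMat x)⁻¹ * (F.phiMat x).transpose) := by
  have e : (F.gMat x)⁻¹ * ((F.phiMat x).transpose * F.gMat x) * (F.gMat x)⁻¹ =
      (F.gMat x)⁻¹ * (F.phiMat x).transpose := by
    rw [Matrix.mul_assoc, Matrix.mul_assoc (F.phiMat x).transpose, h.gMat_mul_ginv hx,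
      Matrix.mul_one]
  rw [← e, h.phiMat_transpose_mul_gMat hx, mul_neg, ← Matrix.mul_assoc, h.ginv_mul_gMat hx]
  simp

theorem piv_antisymm (h : F.IsContactMetricOn U) (hx : x ∈ U) (i j : Fin n) :
    F.piv i j x = -F.piv j i x := by
  have : (Matrix.of fun i j => F.piv i j x).transpose = -(Matrix.of fun i j => F.piv i j x) := by
    rw [piv_eq, Matrix.transpose_mul, h.ginv_transpose hx, Matrix.transpose_transpose,
      h.phiMat_mul_ginv hx]
  exact congrFun (congrFun this j) i

theorem ginv_symm (h : F.IsContactMetricOn U) (hx : x ∈ U) (i j : Fin n) :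
    F.ginv i j x = F.ginv j i x := congrFun (congrFun (h.ginv_transpose hx) j) i

theorem sum_piv_lam (h : F.IsContactMetricOn U) (hx : x ∈ U) (i : Fin n) :
    ∑ j, F.piv i j x * F.lam j x = 0 := by
  have : Matrix.mulVec (Matrix.of fun i j => F.piv i j x) (F.lamVec x) = 0 := by
    rw [piv_eq, ← Matrix.mulVec_mulVec, Matrix.mulVec_transpose, h.lamVec_vecMul_phiMat hx,
      Matrix.mulVec_zero]
  exact congrFun this i

theorem lieGinv_symm (h : F.IsContactMetricOn U) (hx : x ∈ U) (i j : Fin n) :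
    F.lieGinv i j x = F.lieGinv j i x := by
  have : (Matrix.of fun i j => F.lieGinv i j x).transpose =
      (Matrix.of fun i j => F.lieGinv i j x) := by
    rw [h.lieGinv_eq hx]
    simp only [Matrix.transpose_neg, Matrix.transpose_mul, h.ginv_transpose hx,
      Matrix.transpose_add, Matrix.transpose_transpose, Matrix.mul_assoc]
    rw [add_comm]
  exact congrFun (congrFun this j) i

theorem sum_lieGinv_lam (h : F.IsContactMetricOn U) (hx : x ∈ U) (i : Fin n) :
    ∑ j, F.lieGinv i j x * F.lam j x = 0 := by
  have hG : Matrix.mulVec (F.gMat x)⁻¹ (F.lamVec x) = F.xiVec x := by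
    rw [← h.gMat_mulVec_xiVec hx, Matrix.mulVec_mulVec, h.ginv_mul_gMat hx, Matrix.one_mulVec]
  have : Matrix.mulVec (Matrix.of fun i j => F.lieGinv i j x) (F.lamVec x) = 0 := by
    rw [h.lieGinv_eq hx, Matrix.neg_mulVec, ← Matrix.mulVec_mulVec, hG, ← Matrix.mulVec_mulVec,
      Matrix.add_mulVec, h.lcLamMat_mulVec_xiVec hx, Matrix.mulVec_transpose,
      h.xiVec_vecMul_lcLamMat hx]
    simp
  exact congrFun this i

/-- Since `φ g⁻¹ φᵗ = g⁻¹ - ξ ⊗ ξ` and `∇λ` kills `ξ`, the two factors `φ` disappear and, up to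
sign, `g⁻¹ (∇λ) g⁻¹` is left. Its antisymmetric part is `-½ π`, from `dλ = ω`, and its symmetric
part is `-½ L_ξ g⁻¹`. -/
theorem ginv_mul_zMat_mul_piv (h : F.IsContactMetricOn U) (hx : x ∈ U) (i k : Fin n) :
    ∑ j, ∑ l, F.ginv i j x * F.piv k l x * F.zMat x l j =
      1 / 2 * F.piv i k x + 1 / 2 * F.lieGinv i k x := by
  have e1 : F.phiMat x * (F.gMat x)⁻¹ * (F.phiMat x).transpose = (F.gMat x)⁻¹
      - Matrix.vecMulVec (F.xiVec x) (F.xiVec x) := by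
    have hG : Matrix.mulVec (F.gMat x)⁻¹ (F.lamVec x) = F.xiVec x := by
      rw [← h.gMat_mulVec_xiVec hx, Matrix.mulVec_mulVec, h.ginv_mul_gMat hx, Matrix.one_mulVec]
    rw [h.phiMat_mul_ginv hx, neg_mul, Matrix.mul_assoc, ← Matrix.transpose_mul,
      h.phiMat_mul_phiMat hx, Matrix.transpose_add, Matrix.transpose_vecMulVec, mul_add,
      Matrix.mul_vecMulVec, hG]
    simp
    abel
  have e2 : (F.gMat x)⁻¹ * F.zMat x * ((F.gMat x)⁻¹ * (F.phiMat x).transpose) =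
      (F.gMat x)⁻¹ * F.lcLamMat x * (F.gMat x)⁻¹ := by
    have : (F.gMat x)⁻¹ * F.zMat x * ((F.gMat x)⁻¹ * (F.phiMat x).transpose) =
        (F.gMat x)⁻¹ * F.lcLamMat x * (F.phiMat x * (F.gMat x)⁻¹ * (F.phiMat x).transpose) := by
      rw [zMat]; noncomm_ring
    rw [this, e1, mul_sub, Matrix.mul_vecMulVec, ← Matrix.mulVec_mulVec,
      h.lcLamMat_mulVec_xiVec hx]
    simp
  have e3 : (F.gMat x)⁻¹ * (F.lcLamMat x - (F.lcLamMat x).transpose) * (F.gMat x)⁻¹ =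
      -((F.gMat x)⁻¹ * (F.phiMat x).transpose) := by
    rw [h.lcLamMat_sub_transpose hx, ← h.gMat_mul_phiMat hx, ← Matrix.mul_assoc,
      h.ginv_mul_gMat hx, Matrix.one_mul, h.phiMat_mul_ginv hx]
  have e4 : (F.gMat x)⁻¹ * F.zMat x * (Matrix.of fun i j => F.piv i j x) =
      (1 / 2 : ℝ) • (-(Matrix.of fun i j => F.piv i j x)
        - (Matrix.of fun i j => F.lieGinv i j x)) := by
    rw [h.lieGinv_eq hx, piv_eq, e2, ← e3]
    have : (F.gMat x)⁻¹ * F.lcLamMat x * (F.gMat x)⁻¹ = (1 / 2 : ℝ) •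
        ((2 : ℝ) • ((F.gMat x)⁻¹ * F.lcLamMat x * (F.gMat x)⁻¹)) := by
      rw [smul_smul]; norm_num
    rw [this, two_smul]
    congr 1
    noncomm_ring
  have e5 := congrFun (congrFun e4 i) k
  simp only [Matrix.mul_apply, Matrix.smul_apply, Matrix.sub_apply, Matrix.neg_apply,
    Matrix.of_apply, smul_eq_mul, Finset.sum_mul] at e5
  rw [Finset.sum_comm]
  have e6 : ∑ l, ∑ j, F.ginv i j x * F.piv k l x * F.zMat x l j =
      -∑ l, ∑ j, (F.gMat x)⁻¹ i j * F.zMat x j l * F.piv l k x := by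
    rw [← Finset.sum_neg_distrib]
    refine Finset.sum_congr rfl fun l _ => ?_
    rw [← Finset.sum_neg_distrib]
    refine Finset.sum_congr rfl fun j _ => ?_
    rw [h.piv_antisymm hx k l, h.zMat_comm hx l j]
    change _ = -(F.ginv i j x * F.zMat x j l * F.piv l k x)
    ring
  rw [e6, e5]
  ring

/-- This says `∇λ = 0` for the contact metric connection: the last term of `S` is chosen to cancel
`∇^g λ`, and `λ` annihilates the other two. -/
theorem sum_lam_Gam (h : F.IsContactMetricOn U) (hx : x ∈ U) (k j : Fin n) :
    ∑ l, F.lam l x * F.Gam l k j x = pd j (F.lam k) x := by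
  have hphi : ∀ l, ∑ i, F.lam i x * F.phi i l x = 0 := congrFun (h.lamVec_vecMul_phiMat hx)
  have hxi : ∑ i, F.lam i x * F.lcXi j i x = 0 := by
    have := congrFun (h.lcLamMat_mulVec_xiVec hx) j
    change (F.lcLamMat x) j ⬝ᵥ F.xiVec x = 0 at this
    rw [h.lcLamMat_row hx, dotProduct_comm, Matrix.dotProduct_mulVec, ← Matrix.mulVec_transpose,
      h.gMat_transpose hx, h.gMat_mulVec_xiVec hx] at this
    exact this
  have e : ∀ l, F.lam l x * F.Gam l k j x = F.chris l k j x * F.lam l x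
      - 1 / 2 * ∑ a, F.lam l x * F.phi l a x * F.lcPhi j a k x
      - 1 / 2 * F.lam k x * (F.lam l x * F.lcXi j l x)
      + F.lcLam j k x * (F.lam l x * F.xi l x) := fun l => by
    simp only [Gam, S, mul_assoc, ← Finset.mul_sum]
    ring
  simp only [e, Finset.sum_add_distrib, Finset.sum_sub_distrib, ← Finset.mul_sum, hxi, h.lam_xi x hx]
  rw [Finset.sum_comm]
  simp only [← Finset.sum_mul, hphi, lcLam]
  simp

end IsContactMetricOn

end LocalFields
end WickContact
end

/-! ### Evaluation of `Δ₁` in a chart -/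

noncomputable section

namespace WickContact

variable {n : ℕ}

theorem sum_antisymm_mul_symm {p a : Fin n → Fin n → ℂ} (hp : ∀ i j, p i j = -p j i)
    (ha : ∀ i j, a i j = a j i) : ∑ i, ∑ j, p i j * a i j = 0 := by
  have : ∑ i, ∑ j, p i j * a i j = -∑ i, ∑ j, p i j * a i j := by
    conv_lhs => rw [Finset.sum_comm]
    simp only [← Finset.sum_neg_distrib]
    refine Finset.sum_congr rfl fun i _ => Finset.sum_congr rfl fun j _ => ?_
    rw [hp, ha]
    ring
  linear_combination this / 2

/-- Terms proportional to `v` drop out of the contraction with a tensor annihilating `v`. -/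
theorem sum_mul_sub_mul_sub {p : Fin n → Fin n → ℂ} {v : Fin n → ℂ}
    (h1 : ∀ j, ∑ i, p i j * v i = 0) (h2 : ∀ i, ∑ j, p i j * v j = 0) (r d : Fin n → ℂ) (α β : ℂ) :
    ∑ i, ∑ j, p i j * ((r i - v i * α) * (d j - v j * β)) = ∑ i, ∑ j, p i j * (r i * d j) := by
  have e : ∀ i j, p i j * ((r i - v i * α) * (d j - v j * β)) = p i j * (r i * d j)
      - (r i * β) * (p i j * v j) - α * ((p i j * v i) * (d j - v j * β)) := fun i j => by ring
  simp only [e, Finset.sum_sub_distrib, ← Finset.mul_sum, h2]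
  rw [Finset.sum_comm (f := fun i j => p i j * v i * (d j - v j * β))]
  simp only [← Finset.sum_mul, h1]
  simp

namespace LocalFields

theorem quadComm_swap (F : LocalFields n) (x : Coord n) (a b : Fin n → Fin n → ℂ) :
    F.quadComm x a b = -F.quadComm x b a := by
  simp only [quadComm]
  rw [Finset.sum_comm]
  simp only [← Finset.sum_neg_distrib]
  refine Finset.sum_congr rfl fun i _ => Finset.sum_congr rfl fun j _ => ?_
  rw [Finset.sum_comm]
  refine Finset.sum_congr rfl fun k _ => Finset.sum_congr rfl fun l _ => by ring

theorem sum_mul_quadComm (F : LocalFields n) (x : Coord n) (a : Fin n → Fin n → ℂ) (c : Fin n → ℂ)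
    (b : Fin n → Fin n → Fin n → ℂ) :
    ∑ q, c q * F.quadComm x a (b q) = F.quadComm x a fun i j => ∑ q, c q * b q i j := by
  simp only [quadComm, Finset.mul_sum]
  rw [Finset.sum_comm]
  refine Finset.sum_congr rfl fun i _ => ?_
  rw [Finset.sum_comm]
  refine Finset.sum_congr rfl fun j _ => ?_
  rw [Finset.sum_comm]
  refine Finset.sum_congr rfl fun k _ => ?_
  rw [Finset.sum_comm]
  refine Finset.sum_congr rfl fun l _ => Finset.sum_congr rfl fun q _ => by ring

theorem sum_proj_mul_complex (F : LocalFields n) (x : Coord n) (f : Fin n → ℂ) (b : Fin n) :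
    ∑ j, (F.proj j b x : ℂ) * f j = f b - F.lam b x * ∑ j, (F.xi j x : ℂ) * f j := by
  have e : ∀ j, (F.proj j b x : ℂ) * f j =
      (if j = b then f j else 0) - F.lam b x * (F.xi j x * f j) := fun j => by
    simp only [proj]
    split_ifs <;> push_cast <;> ring
  simp only [e, Finset.sum_sub_distrib, ← Finset.mul_sum]
  simp

namespace IsContactMetricOn

variable {F : LocalFields n} {x : Coord n} {U : Set (Coord n)}

theorem h_sub_h (h : F.IsContactMetricOn U) (hx : x ∈ U) (i j : Fin n) :
    F.h i j x - F.h j i x = 2 * Complex.I * F.piv i j x := by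
  simp only [LocalFields.h]
  rw [h.ginv_symm hx j i, h.piv_antisymm hx j i]
  push_cast
  ring

/-- From `h = g⁻¹ + √-1 π` one gets `h h - hᵗ hᵗ = 2√-1 (g⁻¹ π + π g⁻¹)`, and both terms contribute
equally. The contraction with `Z` is given by `ginv_mul_zMat_mul_piv`, whose `π` part vanishes on
symmetric `a`. -/
theorem quadComm_zMat (h : F.IsContactMetricOn U) (hx : x ∈ U) {a : Fin n → Fin n → ℂ}
    (ha : ∀ i j, a i j = a j i) : F.quadComm x a (fun i j => F.zMat x i j) =
      2 * Complex.I * ∑ i, ∑ j, (F.lieGinv i j x : ℂ) * a i j := by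
  have e : ∀ i j k l, (F.h i j x * F.h k l x - F.h j i x * F.h l k x) * (a k i * F.zMat x l j) =
      2 * Complex.I * (a k i * (F.ginv i j x * F.piv k l x * F.zMat x l j : ℝ))
      + 2 * Complex.I * (a k i * (F.ginv k l x * F.piv i j x * F.zMat x j l : ℝ)) := by
    intro i j k l
    simp only [LocalFields.h]
    rw [h.ginv_symm hx j i, h.piv_antisymm hx j i, h.ginv_symm hx l k, h.piv_antisymm hx l k,
      h.zMat_comm hx j l]
    push_cast
    ring
  have h1 : ∑ i, ∑ j, ∑ k, ∑ l, a k i * ((F.ginv i j x * F.piv k l x * F.zMat x l j : ℝ) : ℂ) =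
      ∑ i, ∑ k, a k i * ((1 / 2 * F.piv i k x + 1 / 2 * F.lieGinv i k x : ℝ) : ℂ) := by
    refine Finset.sum_congr rfl fun i _ => ?_
    rw [Finset.sum_comm]
    refine Finset.sum_congr rfl fun k _ => ?_
    rw [← h.ginv_mul_zMat_mul_piv hx, Complex.ofReal_sum, Finset.mul_sum]
    refine Finset.sum_congr rfl fun j _ => ?_
    rw [Complex.ofReal_sum, Finset.mul_sum]
  have h2 : ∑ i, ∑ j, ∑ k, ∑ l, a k i * ((F.ginv k l x * F.piv i j x * F.zMat x j l : ℝ) : ℂ) =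
      ∑ i, ∑ j, ∑ k, ∑ l, a k i * ((F.ginv i j x * F.piv k l x * F.zMat x l j : ℝ) : ℂ) := by
    have swap : ∀ c : Fin n → Fin n → Fin n → Fin n → ℂ, ∑ i, ∑ j, ∑ k, ∑ l, c i j k l =
        ∑ i, ∑ j, ∑ k, ∑ l, c k l i j := by
      intro c
      have e1 : ∑ p : Fin n × Fin n, ∑ q : Fin n × Fin n, c p.1 p.2 q.1 q.2 =
          ∑ q : Fin n × Fin n, ∑ p : Fin n × Fin n, c p.1 p.2 q.1 q.2 := Finset.sum_comm
      simpa only [Fintype.sum_prod_type] using e1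
    rw [swap]
    refine Finset.sum_congr rfl fun i _ => Finset.sum_congr rfl fun j _ =>
      Finset.sum_congr rfl fun k _ => Finset.sum_congr rfl fun l _ => ?_
    rw [ha i k]
  have h3 : ∑ i, ∑ k, (F.piv i k x : ℂ) * a i k = 0 :=
    sum_antisymm_mul_symm (fun i j => by rw [h.piv_antisymm hx i j]; push_cast; ring) ha
  simp only [quadComm, e, Finset.sum_add_distrib, ← Finset.mul_sum _ _ (2 * Complex.I)]
  rw [h2, h1]
  have e2 : ∀ i k, a k i * ((1 / 2 * F.piv i k x + 1 / 2 * F.lieGinv i k x : ℝ) : ℂ) =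
      1 / 2 * ((F.piv i k x : ℂ) * a i k) + 1 / 2 * ((F.lieGinv i k x : ℂ) * a i k) := by
    intro i k
    rw [ha k i]
    push_cast
    ring
  simp only [e2, Finset.sum_add_distrib, ← Finset.mul_sum, h3]
  ring

theorem sum_lieGinv_lam_right (h : F.IsContactMetricOn U) (hx : x ∈ U) (f : Fin n → ℝ) :
    ∑ i, ∑ j, F.lieGinv i j x * (F.lam j x * f i) = 0 := by
  simp only [← mul_assoc, ← Finset.sum_mul, h.sum_lieGinv_lam hx, zero_mul, Finset.sum_const_zero]

theorem sum_lieGinv_comm (h : F.IsContactMetricOn U) (hx : x ∈ U) (f : Fin n → Fin n → ℝ) :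
    ∑ i, ∑ j, F.lieGinv i j x * f i j = ∑ i, ∑ j, F.lieGinv i j x * f j i := by
  rw [Finset.sum_comm]
  exact Finset.sum_congr rfl fun i _ => Finset.sum_congr rfl fun j _ => by rw [h.lieGinv_symm hx]

theorem sum_lieGinv_lam_left (h : F.IsContactMetricOn U) (hx : x ∈ U) (f : Fin n → ℝ) :
    ∑ i, ∑ j, F.lieGinv i j x * (F.lam i x * f j) = 0 := by
  rw [h.sum_lieGinv_comm hx, h.sum_lieGinv_lam_right hx]

end IsContactMetricOn

variable (F : LocalFields n) (x : Coord n)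

/-- The contraction `(L_ξ g^{ij}) ∇^g_i ω_{jk}`. -/
def lieOmega (k : Fin n) : ℝ := ∑ i, ∑ j, F.lieGinv i j x * F.lcOmega i j k x

/-- The contraction of `L_ξ g^{ij}` with the tensor `φ^l_j ∇^g_i λ_l`. -/
def lieZ : ℝ := ∑ i, ∑ j, F.lieGinv i j x * F.zMat x i j

namespace IsContactMetricOn

variable {F : LocalFields n} {x : Coord n} {U : Set (Coord n)}

theorem sum_lieGinv_rQuad (h : F.IsContactMetricOn U) (hx : x ∈ U) (l : Fin n) :
    ∑ i, ∑ j, F.lieGinv i j x * F.rQuad l i j x =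
      -(1 / 3) * F.lieOmega x l - F.lam l x * (2 / 3 * F.lieZ x) := by
  have e : ∀ i j, F.lieGinv i j x * F.rQuad l i j x =
      -(1 / 6) * (F.lieGinv i j x * F.lcOmega j i l x)
      - 1 / 6 * (F.lieGinv i j x * F.lcOmega i j l x)
      - 1 / 6 * (F.lieGinv i j x * (F.lam i x * F.zMat x j l))
      - 1 / 6 * (F.lieGinv i j x * (F.lam j x * F.zMat x i l))
      - 2 / 3 * F.lam l x * (F.lieGinv i j x * F.zMat x i j) := fun i j => by
    rw [h.rQuad_eq hx]
    ring
  simp only [e, Finset.sum_sub_distrib, ← Finset.mul_sum]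
  rw [h.sum_lieGinv_lam_left hx (fun j => F.zMat x j l),
    h.sum_lieGinv_lam_right hx (fun j => F.zMat x j l),
    h.sum_lieGinv_comm hx (fun i j => F.lcOmega j i l x), lieOmega, lieZ]
  ring

/-- Here the form index of `r` is among the contracted ones, so one of the two derivatives of `ω` is
antisymmetric in them and drops out; hence `1/6`, against `-1/3` in `sum_lieGinv_rQuad`. -/
theorem sum_lieGinv_rQuad_first (h : F.IsContactMetricOn U) (hx : x ∈ U) (l : Fin n) :
    ∑ i, ∑ j, F.lieGinv i j x * F.rQuad i j l x =
      1 / 6 * F.lieOmega x l - F.lam l x * (1 / 6 * F.lieZ x) := by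
  have e : ∀ i j, F.lieGinv i j x * F.rQuad i j l x =
      -(1 / 6) * (F.lieGinv i j x * F.lcOmega l j i x)
      + 1 / 6 * (F.lieGinv i j x * F.lcOmega j i l x)
      - 1 / 6 * (F.lieGinv i j x * (F.lam j x * F.zMat x l i))
      - 1 / 6 * F.lam l x * (F.lieGinv i j x * F.zMat x i j)
      - 2 / 3 * (F.lieGinv i j x * (F.lam i x * F.zMat x j l)) := fun i j => by
    rw [h.rQuad_eq hx, lcOmega_antisymm j l i, h.zMat_comm hx i j]
    ring
  have h0 : ∑ i, ∑ j, F.lieGinv i j x * F.lcOmega l j i x = 0 := by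
    have h1 := h.sum_lieGinv_comm hx (fun i j => F.lcOmega l j i x)
    have h2 : ∑ i, ∑ j, F.lieGinv i j x * F.lcOmega l i j x =
        -∑ i, ∑ j, F.lieGinv i j x * F.lcOmega l j i x := by
      simp only [← Finset.sum_neg_distrib]
      refine Finset.sum_congr rfl fun i _ => Finset.sum_congr rfl fun j _ => ?_
      rw [lcOmega_antisymm l i j]
      ring
    linarith
  simp only [e, Finset.sum_sub_distrib, Finset.sum_add_distrib, ← Finset.mul_sum]
  rw [h.sum_lieGinv_lam_left hx (fun j => F.zMat x j l),
    h.sum_lieGinv_lam_right hx (fun j => F.zMat x l j),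
    h.sum_lieGinv_comm hx (fun i j => F.lcOmega j i l x), h0, lieOmega, lieZ]
  ring

/-- The derivative `β` of `ξ A` is left unspecified since it comes with `λ_c`, which `L_ξ g^{ij}`
annihilates. -/
theorem pd_sum_proj (h : F.IsContactMetricOn U) (hx : x ∈ U) {A : Coord n → ℂ}
    (hA : ContDiffAt ℝ 2 A x) :
    ∃ β : Fin n → ℂ, ∀ j c, pd j (fun z => ∑ m, (F.proj m c z : ℂ) * pd m A z) x =
      pd j (pd c A) x - pd j (F.lam c) x * ∑ m, (F.xi m x : ℂ) * pd m A x - F.lam c x * β j := by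
  have hof : ∀ {f : Coord n → ℝ}, DifferentiableAt ℝ f x →
      DifferentiableAt ℝ (fun z => (f z : ℂ)) x := fun hf =>
    Complex.ofRealCLM.differentiableAt.comp x hf
  have hpd : ∀ (j : Fin n) {f : Coord n → ℝ}, DifferentiableAt ℝ f x →
      pd j (fun z => (f z : ℂ)) x = ((pd j f x : ℝ) : ℂ) := fun j f hf => by
    have := (Complex.ofRealCLM.hasFDerivAt.comp x hf.hasFDerivAt).fderiv
    change fderiv ℝ (fun z => (f z : ℂ)) x = _ at this
    simp [pd, this]
  have hB : DifferentiableAt ℝ (fun z => ∑ m, (F.xi m z : ℂ) * pd m A z) x :=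
    DifferentiableAt.fun_sum fun m _ =>
      (hof (h.xi_smooth x hx m)).fun_mul (differentiableAt_pd hA m)
  refine ⟨fun j => pd j (fun z => ∑ m, (F.xi m z : ℂ) * pd m A z) x, fun j c => ?_⟩
  have e : (fun z => ∑ m, (F.proj m c z : ℂ) * pd m A z) =
      fun z => pd c A z - (F.lam c z : ℂ) * ∑ m, (F.xi m z : ℂ) * pd m A z :=
    funext fun z => F.sum_proj_mul_complex z _ c
  rw [e, pd_sub j (differentiableAt_pd hA c) ((hof (h.lam_diff hx c)).fun_mul hB),
    pd_mul j (hof (h.lam_diff hx c)) hB, hpd j (h.lam_diff hx c)]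
  ring

theorem sum_piv_lam_left (h : F.IsContactMetricOn U) (hx : x ∈ U) (j : Fin n) :
    ∑ i, (F.piv i j x : ℂ) * F.lam i x = 0 := by
  have : ∑ i, F.piv i j x * F.lam i x = 0 := by
    rw [← neg_eq_zero, ← Finset.sum_neg_distrib, ← h.sum_piv_lam hx j]
    exact Finset.sum_congr rfl fun i _ => by rw [h.piv_antisymm hx i j]; ring
  exact_mod_cast this

theorem sum_piv_lam_right (h : F.IsContactMetricOn U) (hx : x ∈ U) (i : Fin n) :
    ∑ j, (F.piv i j x : ℂ) * F.lam j x = 0 := by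
  exact_mod_cast h.sum_piv_lam hx i

/-- Contractions with the Jacobi bivector do not see components along `λ`. -/
theorem sum_piv_mul (h : F.IsContactMetricOn U) (hx : x ∈ U) (r d : Fin n → ℂ) (α β : ℂ) :
    ∑ i, ∑ j, (F.piv i j x : ℂ) * ((r i - F.lam i x * α) * (d j - F.lam j x * β)) =
      ∑ i, ∑ j, (F.piv i j x : ℂ) * (r i * d j) :=
  sum_mul_sub_mul_sub (h.sum_piv_lam_left hx) (h.sum_piv_lam_right hx) r d α β

/-- Projecting the gradient of `A` creates a term `(∂λ)(ξ A)`, and projecting it in the connection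
term creates the same one because `∇λ = 0`; they cancel, leaving the Hessian. -/
theorem liftQuad_eq (h : F.IsContactMetricOn U) (hx : x ∈ U) {A : Coord n → ℂ}
    (hA : ContDiffAt ℝ 2 A x) : ∃ β : Fin n → ℂ, ∀ b c, F.liftQuad A b c x =
      ∑ j, (F.proj j b x : ℂ) * (F.hess j c A x - F.lam c x * β j
        - ∑ i, ∑ l, (F.piv i l x : ℂ) * (F.rQuad j c i x * pd l A x)) := by
  obtain ⟨β, hβ⟩ := h.pd_sum_proj hx hA
  refine ⟨β, fun b c => ?_⟩
  rw [liftQuad]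
  refine Finset.sum_congr rfl fun j _ => ?_
  rw [hβ]
  have e1 : ∑ l, (F.Gam l c j x : ℂ) * ∑ m, (F.proj m l x : ℂ) * pd m A x =
      ∑ l, (F.Gam l c j x : ℂ) * pd l A x
      - pd j (F.lam c) x * ∑ m, (F.xi m x : ℂ) * pd m A x := by
    rw [← h.sum_lam_Gam hx, Complex.ofReal_sum, Finset.sum_mul, ← Finset.sum_sub_distrib]
    refine Finset.sum_congr rfl fun l _ => ?_
    rw [sum_proj_mul_complex]
    push_cast
    ring
  have e2 : ∑ i, ∑ l, (F.h i l x - F.h l i x) *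
        ((F.rQuad j c i x : ℂ) * ∑ m, (F.proj m l x : ℂ) * pd m A x) =
      2 * Complex.I * ∑ i, ∑ l, (F.piv i l x : ℂ) * (F.rQuad j c i x * pd l A x) := by
    rw [← h.sum_piv_mul hx _ _ 0 (∑ m, (F.xi m x : ℂ) * pd m A x)]
    simp only [h.h_sub_h hx, sum_proj_mul_complex, Finset.mul_sum _ _ (2 * Complex.I)]
    refine Finset.sum_congr rfl fun i _ => Finset.sum_congr rfl fun l _ => ?_
    ring
  rw [e1, e2, hess]
  linear_combination (∑ i, ∑ l, (F.piv i l x : ℂ) * (F.rQuad j c i x * pd l A x)) *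
    (F.proj j b x : ℂ) * Complex.I_mul_I

/-- `L_ξ g^{ij}` sees neither the projector nor `β`, and `π` removes the `λ` part of the torsion
correction; the constant is that of `sum_lieGinv_rQuad_first`. -/
theorem sum_lieGinv_liftQuad (h : F.IsContactMetricOn U) (hx : x ∈ U) {A : Coord n → ℂ}
    (hA : ContDiffAt ℝ 2 A x) :
    ∑ b, ∑ c, (F.lieGinv b c x : ℂ) * F.liftQuad A b c x =
      ∑ b, ∑ c, (F.lieGinv b c x : ℂ) * F.hess b c A x
        - 1 / 6 * ∑ i, ∑ l, (F.piv i l x : ℂ) * (F.lieOmega x i * pd l A x) := by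
  obtain ⟨β, hβ⟩ := h.liftQuad_eq hx hA
  have hr : ∀ b, ∑ c, (F.lieGinv b c x : ℂ) * F.lam c x = 0 := fun b => by
    exact_mod_cast h.sum_lieGinv_lam hx b
  have hl : ∀ c, ∑ b, (F.lieGinv b c x : ℂ) * F.lam b x = 0 := fun c => by
    rw [← hr c]
    exact Finset.sum_congr rfl fun b _ => by rw [h.lieGinv_symm hx]
  have hproj : ∀ Y : Fin n → Fin n → ℂ,
      ∑ b, ∑ c, (F.lieGinv b c x : ℂ) * ∑ j, (F.proj j b x : ℂ) * Y j c =
      ∑ b, ∑ c, (F.lieGinv b c x : ℂ) * Y b c := by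
    intro Y
    simp only [sum_proj_mul_complex, mul_sub, Finset.sum_sub_distrib, ← mul_assoc]
    rw [Finset.sum_comm (f := fun b c => (F.lieGinv b c x : ℂ) * F.lam b x * _)]
    simp only [← Finset.sum_mul, hl, zero_mul, Finset.sum_const_zero, sub_zero]
  have hQ : ∀ i, ∑ j, ∑ c, (F.lieGinv j c x : ℂ) * F.rQuad j c i x =
      1 / 6 * F.lieOmega x i - F.lam i x * (1 / 6 * F.lieZ x) := fun i => by
    have := congrArg (fun t : ℝ => (t : ℂ)) (h.sum_lieGinv_rQuad_first hx i)
    push_cast at this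
    exact this
  have hR : ∑ j, ∑ c, (F.lieGinv j c x : ℂ) *
      ∑ i, ∑ l, (F.piv i l x : ℂ) * (F.rQuad j c i x * pd l A x) =
      ∑ i, ∑ l, (F.piv i l x : ℂ) *
        ((∑ j, ∑ c, (F.lieGinv j c x : ℂ) * F.rQuad j c i x) * pd l A x) := by
    have e1 : ∑ p : Fin n × Fin n, ∑ q : Fin n × Fin n, (F.lieGinv p.1 p.2 x : ℂ) *
        ((F.piv q.1 q.2 x : ℂ) * (F.rQuad p.1 p.2 q.1 x * pd q.2 A x)) =
        ∑ q : Fin n × Fin n, ∑ p : Fin n × Fin n, (F.lieGinv p.1 p.2 x : ℂ) *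
        ((F.piv q.1 q.2 x : ℂ) * (F.rQuad p.1 p.2 q.1 x * pd q.2 A x)) := Finset.sum_comm
    simp only [Fintype.sum_prod_type] at e1
    simp only [Finset.mul_sum, Finset.sum_mul]
    rw [e1]
    refine Finset.sum_congr rfl fun i _ => Finset.sum_congr rfl fun l _ =>
      Finset.sum_congr rfl fun j _ => Finset.sum_congr rfl fun c _ => by ring
  simp only [hβ, hproj, mul_sub, Finset.sum_sub_distrib, hR, hQ]
  have e1 : ∑ b, ∑ c, (F.lieGinv b c x : ℂ) * (F.lam c x * β b) = 0 := by
    simp only [← mul_assoc, ← Finset.sum_mul, hr, zero_mul, Finset.sum_const_zero]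
  have e2 := h.sum_piv_mul hx (fun i => 1 / 6 * (F.lieOmega x i : ℂ)) (fun l => pd l A x)
    (1 / 6 * F.lieZ x) 0
  simp only [mul_zero, sub_zero] at e2
  rw [e1, e2, sub_zero, Finset.mul_sum]
  congr 1
  refine Finset.sum_congr rfl fun i _ => ?_
  rw [Finset.mul_sum]
  exact Finset.sum_congr rfl fun l _ => by ring

/-- The value of `Δ` to first order in `ν` in a chart. -/
theorem Delta_one_eq (h : F.IsContactMetricOn U) (hx : x ∈ U) {A : ℕ → Coord n → ℂ}
    (hA : ContDiffAt ℝ 2 (A 0) x) :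
    F.Delta A 1 x = ∑ i, (F.xi i x : ℂ) * pd i (A 1) x
      - 1 / 4 * ∑ i, ∑ j, (F.lieGinv i j x : ℂ) * F.hess i j (A 0) x
      + 1 / 8 * ∑ i, ∑ l, (F.piv i l x : ℂ) * (F.lieOmega x i * pd l (A 0) x) := by
  have hz : ∀ a b : Fin n, ∑ l, (F.xi l x : ℂ) * F.rQuad l a b x = -F.zMat x a b := fun a b => by
    exact_mod_cast h.sum_xi_rQuad hx a b
  have hneg : ∀ a : Fin n → Fin n → ℂ, F.quadComm x a (fun i j => -(F.zMat x i j : ℂ)) =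
      -F.quadComm x a (fun i j => (F.zMat x i j : ℂ)) := fun a => by
    simp [quadComm]
  have hρ : ∀ p, ∑ l, (F.xi l x : ℂ) *
      F.quadComm x (fun a b => F.rQuad p a b x) (fun a b => F.rQuad l a b x) =
      -(2 * Complex.I) * (-(1 / 3) * F.lieOmega x p - F.lam p x * (2 / 3 * F.lieZ x)) := by
    intro p
    have hp : ∑ i, ∑ j, (F.lieGinv i j x : ℂ) * F.rQuad p i j x =
        -(1 / 3) * F.lieOmega x p - F.lam p x * (2 / 3 * F.lieZ x) := by
      have := congrArg (fun t : ℝ => (t : ℂ)) (h.sum_lieGinv_rQuad hx p)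
      push_cast at this
      exact this
    rw [sum_mul_quadComm]
    simp only [hz]
    rw [hneg, h.quadComm_zMat hx fun i j => by rw [rQuad_symm], hp]
    ring
  have hβ : ∑ q, (F.xi q x : ℂ) * F.quadComm x (fun a b => F.rQuad q a b x)
        (fun a b => F.liftQuad (A 0) a b x + F.liftQuad (A 0) b a x) =
      4 * Complex.I * ∑ b, ∑ c, (F.lieGinv b c x : ℂ) * F.liftQuad (A 0) b c x := by
    simp only [F.quadComm_swap x (fun a b => (F.rQuad _ a b x : ℂ)), mul_neg,
      Finset.sum_neg_distrib]
    rw [sum_mul_quadComm]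
    simp only [hz]
    rw [hneg, h.quadComm_zMat hx fun i j => add_comm _ _]
    have : ∑ b, ∑ c, (F.lieGinv b c x : ℂ) * F.liftQuad (A 0) c b x =
        ∑ b, ∑ c, (F.lieGinv b c x : ℂ) * F.liftQuad (A 0) b c x := by
      rw [Finset.sum_comm]
      exact Finset.sum_congr rfl fun b _ => Finset.sum_congr rfl fun c _ => by
        rw [h.lieGinv_symm hx]
    simp only [mul_add, Finset.sum_add_distrib, this]
    ring
  rw [F.Delta_one ((h.eventually_mem hx).mono fun z hz => h.sum_proj_lam hz) (h.sum_xi_proj hx)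
    (h.lam_xi x hx), hβ, h.sum_lieGinv_liftQuad hx hA]
  -- The constant is `2√-1 · 2√-1/3 = -4/3`; the `lieZ` part of `hρ` is a multiple of `λ` and is
  -- killed by `π`.
  have hm : ∑ i, ∑ j, (F.h i j x - F.h j i x) *
        ((∑ p, (F.proj p i x : ℂ) * ∑ l, (F.xi l x : ℂ) *
          F.quadComm x (fun a b => F.rQuad p a b x) (fun a b => F.rQuad l a b x)) *
          ∑ m, (F.proj m j x : ℂ) * pd m (A 0) x) =
      -(4 / 3) * ∑ i, ∑ l, (F.piv i l x : ℂ) * (F.lieOmega x i * pd l (A 0) x) := by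
    simp only [hρ, h.h_sub_h hx, sum_proj_mul_complex, mul_assoc (2 * Complex.I),
      ← Finset.mul_sum _ _ (2 * Complex.I)]
    have e := h.sum_piv_mul hx
      (fun p => -(2 * Complex.I) * (-(1 / 3) * F.lieOmega x p - F.lam p x * (2 / 3 * F.lieZ x)))
      (fun m => pd m (A 0) x)
      (∑ p, (F.xi p x : ℂ) *
        (-(2 * Complex.I) * (-(1 / 3) * F.lieOmega x p - F.lam p x * (2 / 3 * F.lieZ x))))
      (∑ m, (F.xi m x : ℂ) * pd m (A 0) x)
    rw [e]
    have e2 := h.sum_piv_mul hx (fun i => -(1 / 3) * (F.lieOmega x i : ℂ)) (fun l => pd l (A 0) x)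
      (2 / 3 * F.lieZ x) 0
    simp only [mul_zero, sub_zero] at e2
    have e3 : ∀ (a : ℂ) (X d : Fin n → ℂ), ∑ i, ∑ l, (F.piv i l x : ℂ) * (a * X i * d l) =
        a * ∑ i, ∑ l, (F.piv i l x : ℂ) * (X i * d l) := fun a X d => by
      simp only [Finset.mul_sum]
      exact Finset.sum_congr rfl fun i _ => Finset.sum_congr rfl fun l _ => by ring
    rw [e3, e2, e3]
    linear_combination (4 / 3 * ∑ i, ∑ l, (F.piv i l x : ℂ) * (F.lieOmega x i * pd l (A 0) x)) *
      Complex.I_mul_I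
  rw [hm]
  -- The first order terms add up as `1/16 · 4/3 + 1/4 · 1/6 = 1/12 + 1/24 = 1/8`.
  linear_combination (1 / 4 * (∑ b, ∑ c, (F.lieGinv b c x : ℂ) * F.hess b c (A 0) x
        - 1 / 6 * ∑ i, ∑ l, (F.piv i l x : ℂ) * (F.lieOmega x i * pd l (A 0) x))) * Complex.I_mul_I

end IsContactMetricOn

end LocalFields
end WickContact
end

/-! ### From the manifold to components in a chart -/

noncomputable section

namespace WickContact

section Manifold

open Bundle

variable {m : ℕ} {M : Type*} [TopologicalSpace M]
  [ChartedSpace (Coord (2 * m + 1)) M]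
  {e : OpenPartialHomeomorph M (Coord (2 * m + 1))} {x : Coord (2 * m + 1)}

theorem mdifferentiable_of_mem_maximalAtlas
    (he : e ∈ IsManifold.maximalAtlas (𝓡 (2 * m + 1)) ∞ M) :
    e.MDifferentiable (𝓡 (2 * m + 1)) (𝓡 (2 * m + 1)) :=
  ⟨(contMDiffOn_of_mem_maximalAtlas he).mdifferentiableOn (by simp),
    (contMDiffOn_symm_of_mem_maximalAtlas he).mdifferentiableOn (by simp)⟩

theorem coordComp_add (i : Fin (2 * m + 1)) (p : M) (v w : TangentSpace (𝓡 (2 * m + 1)) p) :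
    coordComp e i p (v + w) = coordComp e i p v + coordComp e i p w := by
  simp only [coordComp, map_add]
  rfl

theorem coordComp_smul (i : Fin (2 * m + 1)) (p : M) (c : ℝ)
    (v : TangentSpace (𝓡 (2 * m + 1)) p) :
    coordComp e i p (c • v) = c * coordComp e i p v := by
  simp only [coordComp, map_smul]
  rfl

theorem contMDiffAt_symm (he : e ∈ IsManifold.maximalAtlas (𝓡 (2 * m + 1)) ∞ M)
    (hx : x ∈ e.target) : ContMDiffAt (𝓡 (2 * m + 1)) (𝓡 (2 * m + 1)) ∞ e.symm x :=
  (contMDiffOn_symm_of_mem_maximalAtlas he).contMDiffAt (e.open_target.mem_nhds hx)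

/-- The expansion of a tangent vector in the coordinate basis. -/
theorem sum_coordComp_smul_coordVec (he : e ∈ IsManifold.maximalAtlas (𝓡 (2 * m + 1)) ∞ M)
    (hx : x ∈ e.target) (v : TangentSpace (𝓡 (2 * m + 1)) (e.symm x)) :
    ∑ i, coordComp e i (e.symm x) v • coordVec e i x = v := by
  have h1 := (mdifferentiable_of_mem_maximalAtlas he).symm_comp_deriv (e.map_target hx)
  rw [e.right_inv hx] at h1
  have h2 : mfderiv (𝓡 (2 * m + 1)) (𝓡 (2 * m + 1)) e.symm x
    (mfderiv (𝓡 (2 * m + 1)) (𝓡 (2 * m + 1)) e (e.symm x) v) = v := DFunLike.congr_fun h1 v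
  have h3 : ∀ w : Coord (2 * m + 1), w = ∑ i, w i • EuclideanSpace.single i (1 : ℝ) := by
    intro w
    ext j
    simp [Pi.single_apply]
  have h4 : ∀ (D : Coord (2 * m + 1) →L[ℝ] TangentSpace (𝓡 (2 * m + 1)) (e.symm x))
      (w : Coord (2 * m + 1)), D w = ∑ i, w i • D (EuclideanSpace.single i (1 : ℝ)) := by
    intro D w
    conv_lhs => rw [h3 w]
    rw [map_sum]
    exact Finset.sum_congr rfl fun i _ => map_smul _ _ _
  exact (h4 (mfderiv (𝓡 (2 * m + 1)) (𝓡 (2 * m + 1)) e.symm x)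
    (mfderiv (𝓡 (2 * m + 1)) (𝓡 (2 * m + 1)) e (e.symm x) v)).symm.trans h2

theorem coordVec_expand (he : e ∈ IsManifold.maximalAtlas (𝓡 (2 * m + 1)) ∞ M)
    (hx : x ∈ e.target) {V : Type*} [AddCommMonoid V] [Module ℝ V] [TopologicalSpace V]
    (L : TangentSpace (𝓡 (2 * m + 1)) (e.symm x) →L[ℝ] V)
    (v : TangentSpace (𝓡 (2 * m + 1)) (e.symm x)) :
    L v = ∑ i, coordComp e i (e.symm x) v • L (coordVec e i x) := by
  conv_lhs => rw [← sum_coordComp_smul_coordVec he hx v]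
  rw [map_sum]
  exact Finset.sum_congr rfl fun i _ => map_smul _ _ _

theorem coordComp_coordVec (he : e ∈ IsManifold.maximalAtlas (𝓡 (2 * m + 1)) ∞ M)
    (hx : x ∈ e.target) (i j : Fin (2 * m + 1)) :
    coordComp e i (e.symm x) (coordVec e j x) = if i = j then 1 else 0 := by
  have h1 := (mdifferentiable_of_mem_maximalAtlas he).comp_symm_deriv hx
  have h2 : mfderiv (𝓡 (2 * m + 1)) (𝓡 (2 * m + 1)) e (e.symm x)
    (mfderiv (𝓡 (2 * m + 1)) (𝓡 (2 * m + 1)) e.symm x (EuclideanSpace.single j (1 : ℝ))) =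
      EuclideanSpace.single j (1 : ℝ) := DFunLike.congr_fun h1 _
  rw [coordComp, coordVec, h2]
  change (EuclideanSpace.single j (1 : ℝ) : Coord (2 * m + 1)) i = _
  simp

theorem coordComp_zero (i : Fin (2 * m + 1)) (p : M) :
    coordComp e i p 0 = 0 := by
  simpa using coordComp_smul (e := e) i p 0 0

theorem coordComp_neg (i : Fin (2 * m + 1)) (p : M) (v : TangentSpace (𝓡 (2 * m + 1)) p) :
    coordComp e i p (-v) = -coordComp e i p v := by
  simpa using coordComp_smul (e := e) i p (-1) v

theorem coordComp_sum {ι : Type*} (s : Finset ι) (i : Fin (2 * m + 1)) (p : M)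
    (v : ι → TangentSpace (𝓡 (2 * m + 1)) p) :
    coordComp e i p (∑ a ∈ s, v a) = ∑ a ∈ s, coordComp e i p (v a) := by
  classical
  induction s using Finset.induction_on with
  | empty => simp [coordComp_zero]
  | insert a s ha ih => rw [Finset.sum_insert ha, Finset.sum_insert ha, coordComp_add, ih]

theorem contDiffAt_comp_symm (he : e ∈ IsManifold.maximalAtlas (𝓡 (2 * m + 1)) ∞ M)
    (hx : x ∈ e.target) (a : C^∞⟮𝓡 (2 * m + 1), M; 𝓘(ℝ, ℂ), ℂ⟯) :
    ContDiffAt ℝ ∞ (fun z => a (e.symm z)) x :=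
  (a.contMDiff.contMDiffAt.comp x (contMDiffAt_symm he hx)).contDiffAt

variable [IsManifold (𝓡 (2 * m + 1)) ∞ M]

/-! ### Smoothness of components -/

/-- The field is the tangent map of the inverse chart applied to a constant section; the version
within `e.target` serves since smoothness is known only there. -/
theorem contMDiffAt_coordVec (he : e ∈ IsManifold.maximalAtlas (𝓡 (2 * m + 1)) ∞ M)
    (hx : x ∈ e.target) (j : Fin (2 * m + 1)) :
    ContMDiffAt (𝓡 (2 * m + 1)) ((𝓡 (2 * m + 1)).prod 𝓘(ℝ, Coord (2 * m + 1))) ∞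
      (fun z => TotalSpace.mk' (Coord (2 * m + 1))
        (E := fun q : M => TangentSpace (𝓡 (2 * m + 1)) q) (e.symm z) (coordVec e j z)) x := by
  have h1 := (contMDiffOn_symm_of_mem_maximalAtlas he).contMDiffOn_tangentMapWithin (m := ∞)
    (by simp) e.open_target.uniqueMDiffOn
  have h2 : ContMDiffAt (𝓡 (2 * m + 1)) (𝓡 (2 * m + 1)).tangent ∞
      (fun z : Coord (2 * m + 1) => (⟨z, EuclideanSpace.single j (1 : ℝ)⟩ :
        TangentBundle (𝓡 (2 * m + 1)) (Coord (2 * m + 1)))) x :=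
    contMDiffAt_vectorSpace_iff_contDiffAt.2 contDiffAt_const
  have h3 : ContMDiffAt (𝓡 (2 * m + 1)).tangent (𝓡 (2 * m + 1)).tangent ∞
    (tangentMapWithin (𝓡 (2 * m + 1)) (𝓡 (2 * m + 1)) e.symm e.target)
    (⟨x, EuclideanSpace.single j (1 : ℝ)⟩ :
        TangentBundle (𝓡 (2 * m + 1)) (Coord (2 * m + 1))) := by
    refine (h1 _ hx).contMDiffAt ?_
    exact (e.open_target.preimage (FiberBundle.continuous_proj _ _)).mem_nhds hx
  refine (h3.comp x h2).congr_of_eventuallyEq ?_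
  filter_upwards [e.open_target.mem_nhds hx] with z hz
  simp only [Function.comp, tangentMapWithin, coordVec]
  rw [mfderivWithin_of_isOpen e.open_target hz]

theorem contDiffAt_coordComp (he : e ∈ IsManifold.maximalAtlas (𝓡 (2 * m + 1)) ∞ M)
    (hx : x ∈ e.target) (i : Fin (2 * m + 1))
    {v : ∀ z : Coord (2 * m + 1), TangentSpace (𝓡 (2 * m + 1)) (e.symm z)}
    (hv : ContMDiffAt (𝓡 (2 * m + 1)) ((𝓡 (2 * m + 1)).prod 𝓘(ℝ, Coord (2 * m + 1))) ∞
      (fun z => TotalSpace.mk' (Coord (2 * m + 1))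
        (E := fun q : M => TangentSpace (𝓡 (2 * m + 1)) q) (e.symm z) (v z)) x) :
    ContDiffAt ℝ ∞ (fun z => coordComp e i (e.symm z) (v z)) x := by
  have h1 := (contMDiffOn_of_mem_maximalAtlas he).contMDiffOn_tangentMapWithin (m := ∞)
    (by simp) e.open_source.uniqueMDiffOn
  have h3 : ContMDiffAt (𝓡 (2 * m + 1)).tangent (𝓡 (2 * m + 1)).tangent ∞
    (tangentMapWithin (𝓡 (2 * m + 1)) (𝓡 (2 * m + 1)) e e.source)
    (⟨e.symm x, v x⟩ : TangentBundle (𝓡 (2 * m + 1)) M) := by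
    refine (h1 _ (e.map_target hx)).contMDiffAt ?_
    exact (e.open_source.preimage (FiberBundle.continuous_proj _ _)).mem_nhds (e.map_target hx)
  have h4 := ((contMDiff_snd_tangentBundle_modelSpace (Coord (2 * m + 1)) (𝓡 (2 * m + 1))
    (n := ∞)).contMDiffAt.comp x (h3.comp x hv)).contDiffAt
  have h5 : ContDiffAt ℝ ∞ (fun z => (EuclideanSpace.proj i : Coord (2 * m + 1) →L[ℝ] ℝ)
    (tangentMapWithin (𝓡 (2 * m + 1)) (𝓡 (2 * m + 1)) e e.source ⟨e.symm z, v z⟩).2) x :=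
    (EuclideanSpace.proj i : Coord (2 * m + 1) →L[ℝ] ℝ).contDiff.contDiffAt.comp x h4
  refine h5.congr_of_eventuallyEq ?_
  filter_upwards [e.open_target.mem_nhds hx] with z hz
  simp only [tangentMapWithin, coordComp]
  rw [mfderivWithin_of_isOpen e.open_source (e.map_target hz)]
  rfl

theorem ContactTensors.contDiffAt_lam (C : ContactTensors m M)
    (he : e ∈ IsManifold.maximalAtlas (𝓡 (2 * m + 1)) ∞ M)
    (hx : x ∈ e.target) (i : Fin (2 * m + 1)) : ContDiffAt ℝ ∞ ((C.inChart e).lam i) x := by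
  have h : ContMDiffAt (𝓡 (2 * m + 1)) ((𝓡 (2 * m + 1)).prod 𝓘(ℝ, ℝ)) ∞
      (fun z ↦ TotalSpace.mk' ℝ (E := Bundle.Trivial M ℝ) (e.symm z)
        (C.lam (e.symm z) (coordVec e i z))) x :=
    ContMDiffAt.clm_bundle_apply (F₁ := Coord (2 * m + 1))
    (C.contMDiff_lam.contMDiffAt.comp x (contMDiffAt_symm he hx)) (contMDiffAt_coordVec he hx i)
  simp only [contMDiffAt_totalSpace] at h
  exact h.2.contDiffAt

theorem ContactTensors.contDiffAt_g (C : ContactTensors m M)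
    (he : e ∈ IsManifold.maximalAtlas (𝓡 (2 * m + 1)) ∞ M)
    (hx : x ∈ e.target) (i j : Fin (2 * m + 1)) : ContDiffAt ℝ ∞ ((C.inChart e).g i j) x := by
  have h : ContMDiffAt (𝓡 (2 * m + 1)) ((𝓡 (2 * m + 1)).prod 𝓘(ℝ, ℝ)) ∞
      (fun z ↦ TotalSpace.mk' ℝ (E := Bundle.Trivial M ℝ) (e.symm z)
        (C.metric.inner (e.symm z) (coordVec e i z) (coordVec e j z))) x :=
    ContMDiffAt.clm_bundle_apply₂ (F₁ := Coord (2 * m + 1)) (F₂ := Coord (2 * m + 1))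
    (C.metric.contMDiff.contMDiffAt.comp x (contMDiffAt_symm he hx))
    (contMDiffAt_coordVec he hx i) (contMDiffAt_coordVec he hx j)
  simp only [contMDiffAt_totalSpace] at h
  exact h.2.contDiffAt

theorem ContactTensors.contDiffAt_xi (C : ContactTensors m M)
    (he : e ∈ IsManifold.maximalAtlas (𝓡 (2 * m + 1)) ∞ M)
    (hx : x ∈ e.target) (i : Fin (2 * m + 1)) : ContDiffAt ℝ ∞ ((C.inChart e).xi i) x :=
  contDiffAt_coordComp he hx i (C.contMDiff_xi.contMDiffAt.comp x (contMDiffAt_symm he hx))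

theorem ContactTensors.contDiffAt_phi (C : ContactTensors m M)
    (he : e ∈ IsManifold.maximalAtlas (𝓡 (2 * m + 1)) ∞ M)
    (hx : x ∈ e.target) (i j : Fin (2 * m + 1)) : ContDiffAt ℝ ∞ ((C.inChart e).phi i j) x :=
  contDiffAt_coordComp he hx i (ContMDiffAt.clm_bundle_apply
    (C.contMDiff_phi.contMDiffAt.comp x (contMDiffAt_symm he hx)) (contMDiffAt_coordVec he hx j))

/-! ### The structure in a chart -/

/-- Each identity is the invariant one expanded in the coordinate basis. -/
theorem ContactMetricStructure.isContactMetricOn (C : ContactMetricStructure m M)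
    (he : e ∈ IsManifold.maximalAtlas (𝓡 (2 * m + 1)) ∞ M) :
    (C.inChart e).IsContactMetricOn e.target where
  isOpen := e.open_target
  lam_smooth x hx i := contDiffAt_infty.1 (C.contDiffAt_lam he hx i) 2
  xi_smooth x hx i := (C.contDiffAt_xi he hx i).differentiableAt (by simp)
  phi_smooth x hx i j := (C.contDiffAt_phi he hx i j).differentiableAt (by simp)
  g_smooth x hx i j := (C.contDiffAt_g he hx i j).differentiableAt (by simp)
  g_symm x hx i j := C.metric.symm _ _ _
  det_g x hx hdet := by
    obtain ⟨v, hv, hgv⟩ := Matrix.exists_mulVec_eq_zero_iff.2 hdet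
    set w : TangentSpace (𝓡 (2 * m + 1)) (e.symm x) := ∑ i, v i • coordVec e i x with hw
    -- A kernel vector of the Gram matrix is a tangent vector of length zero, so definiteness of the
    -- metric and independence of the coordinate fields exclude it.
    have h0 : C.metric.inner (e.symm x) w w = 0 := by
      have h1 : ∀ i, C.metric.inner (e.symm x) (coordVec e i x) w = 0 := by
        intro i
        rw [hw, map_sum]
        refine Eq.trans (Finset.sum_congr rfl fun j _ => ?_) (congrFun hgv i)
        rw [map_smul]
        exact mul_comm _ _
      conv_lhs => rw [C.metric.symm]
      rw [show C.metric.inner (e.symm x) w w =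
        ∑ i, v i * C.metric.inner (e.symm x) w (coordVec e i x) by
          conv_lhs => arg 2; rw [hw]
          simp only [map_sum, map_smul, smul_eq_mul]]
      exact Finset.sum_eq_zero fun i _ => by rw [C.metric.symm, h1, mul_zero]
    have hw0 : w = 0 := by
      by_contra hne
      exact (C.metric.pos _ w hne).ne' h0
    apply hv
    ext i
    have : coordComp e i (e.symm x) w = v i := by
      rw [hw, coordComp_sum]
      simp [coordComp_smul, coordComp_coordVec he hx]
    rw [← this, hw0, coordComp_zero]
    rfl
  lam_eq x hx i := by
    change C.lam _ _ = _
    rw [C.lam_eq, coordVec_expand he hx (C.metric.inner (e.symm x) (coordVec e i x))]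
    exact Finset.sum_congr rfl fun j _ => mul_comm _ _
  lam_xi x hx := by
    rw [← C.lam_xi (e.symm x), coordVec_expand he hx (C.lam (e.symm x))]
    exact Finset.sum_congr rfl fun j _ => mul_comm _ _
  omega_eq x hx i j := by
    rw [C.omega_eq e he x hx, coordVec_expand he hx (C.metric.inner (e.symm x) (coordVec e i x))]
    exact Finset.sum_congr rfl fun j _ => mul_comm _ _
  phi_phi x hx i j := by
    have h1 := congrArg (coordComp e i (e.symm x)) (C.phi_phi (e.symm x) (coordVec e j x))
    rw [coordComp_add, coordComp_neg, coordComp_smul, coordComp_coordVec he hx,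
      coordVec_expand he hx (C.phi (e.symm x)) (C.phi (e.symm x) _), coordComp_sum] at h1
    simp only [coordComp_smul] at h1
    rw [mul_comm ((C.inChart e).xi i x)]
    refine Eq.trans ?_ h1
    exact Finset.sum_congr rfl fun k _ => mul_comm _ _
  phi_xi x hx i := by
    have h1 := congrArg (coordComp e i (e.symm x)) (C.phi_xi (e.symm x))
    rw [coordComp_zero, coordVec_expand he hx (C.phi (e.symm x)), coordComp_sum] at h1
    simp only [coordComp_smul] at h1
    refine Eq.trans ?_ h1
    exact Finset.sum_congr rfl fun k _ => mul_comm _ _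

theorem ContactMetricStructure.reebDeriv_eq (C : ContactMetricStructure m M)
    (he : e ∈ IsManifold.maximalAtlas (𝓡 (2 * m + 1)) ∞ M)
    (a : C^∞⟮𝓡 (2 * m + 1), M; 𝓘(ℝ, ℂ), ℂ⟯) {p : M} (hp : p ∈ e.source) :
    C.reebDeriv a p = ∑ i, ((C.inChart e).xi i (e p) : ℂ) *
      pd i (fun z => a (e.symm z)) (e p) := by
  have hx := e.map_source hp
  have key : ∀ x ∈ e.target, C.reebDeriv a (e.symm x) = ∑ i, ((C.inChart e).xi i x : ℂ) *
      pd i (fun z => a (e.symm z)) x := by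
    intro x hx
    have hc : mfderiv (𝓡 (2 * m + 1)) 𝓘(ℝ, ℂ) (a ∘ e.symm) x =
        (mfderiv (𝓡 (2 * m + 1)) 𝓘(ℝ, ℂ) a (e.symm x)).comp
          (mfderiv (𝓡 (2 * m + 1)) (𝓡 (2 * m + 1)) e.symm x) :=
      mfderiv_comp x ((a.contMDiff.contMDiffAt).mdifferentiableAt (by simp))
        ((contMDiffAt_symm he hx).mdifferentiableAt (by simp))
    rw [mfderiv_eq_fderiv] at hc
    rw [reebDeriv, coordVec_expand he hx (mfderiv (𝓡 (2 * m + 1)) 𝓘(ℝ, ℂ) a (e.symm x))]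
    refine Finset.sum_congr rfl fun i _ => ?_
    have : pd i (fun z => a (e.symm z)) x =
        mfderiv (𝓡 (2 * m + 1)) 𝓘(ℝ, ℂ) a (e.symm x) (coordVec e i x) :=
      DFunLike.congr_fun hc (EuclideanSpace.single i (1 : ℝ))
    rw [this]
    exact Complex.real_smul
  have := key _ hx
  rwa [e.left_inv hp] at this

end Manifold

end WickContact
end

/-! ### The operators `Δ₀` and `Δ₁` on the manifold and the K-contact case -/

noncomputable section

namespace WickContact

variable {m : ℕ} {M : Type*} [TopologicalSpace M]
  [ChartedSpace (Coord (2 * m + 1)) M] [IsManifold (𝓡 (2 * m + 1)) ∞ M]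
  {e : OpenPartialHomeomorph M (Coord (2 * m + 1))}

theorem ContactMetricStructure.DeltaCoeff_zero (C : ContactMetricStructure m M)
    (he : e ∈ IsManifold.maximalAtlas (𝓡 (2 * m + 1)) ∞ M)
    (a : C^∞⟮𝓡 (2 * m + 1), M; 𝓘(ℝ, ℂ), ℂ⟯) {p : M} (hp : p ∈ e.source) :
    C.DeltaCoeff 0 e a p = C.reebDeriv a p := by
  have h := C.isContactMetricOn he
  have hx := e.map_source hp
  rw [DeltaCoeff, ContactMetricStructure.Delta, LocalFields.Delta_zero _ (h.sum_proj_lam hx)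
    (h.sum_xi_proj hx) (h.lam_xi _ hx), C.reebDeriv_eq he a hp]
  rfl

theorem ContactMetricStructure.DeltaCoeff_one (C : ContactMetricStructure m M)
    (he : e ∈ IsManifold.maximalAtlas (𝓡 (2 * m + 1)) ∞ M)
    (a : C^∞⟮𝓡 (2 * m + 1), M; 𝓘(ℝ, ℂ), ℂ⟯) {p : M} (hp : p ∈ e.source) :
    C.DeltaCoeff 1 e a p =
      -(1 / 4) * (∑ i, ∑ j, ((C.inChart e).lieGinv i j (e p) : ℂ) *
          (C.inChart e).hess i j (fun x => a (e.symm x)) (e p))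
      + (1 / 8) * (∑ i, ∑ j, ∑ k, ∑ n, ((C.inChart e).lieGinv i j (e p) : ℂ) *
          ((C.inChart e).lcOmega i j k (e p) : ℂ) * ((C.inChart e).piv k n (e p) : ℂ) *
          pd n (fun x => a (e.symm x)) (e p)) := by
  have h := C.isContactMetricOn he
  have hx := e.map_source hp
  have ha : ContDiffAt ℝ 2 (fun x => a (e.symm x)) (e p) :=
    contDiffAt_infty.1 (contDiffAt_comp_symm he hx a) 2
  have key := h.Delta_one_eq hx (A := fun l x =>
    (if l = 0 then a else 0 : C^∞⟮𝓡 (2 * m + 1), M; 𝓘(ℝ, ℂ), ℂ⟯) (e.symm x)) ha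
  have h0 : ∀ i, pd i (fun x => (if (1 : ℕ) = 0 then a else 0 :
      C^∞⟮𝓡 (2 * m + 1), M; 𝓘(ℝ, ℂ), ℂ⟯) (e.symm x)) (e p) = 0 := fun i => pd_const (0 : ℂ) i _
  rw [DeltaCoeff, ContactMetricStructure.Delta, key]
  simp only [h0, mul_zero, Finset.sum_const_zero, if_true]
  have hΩ : ∑ k, ∑ n, ((C.inChart e).piv k n (e p) : ℂ) *
      ((C.inChart e).lieOmega (e p) k * pd n (fun x => a (e.symm x)) (e p)) =
      ∑ i, ∑ j, ∑ k, ∑ n, ((C.inChart e).lieGinv i j (e p) : ℂ) *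
          ((C.inChart e).lcOmega i j k (e p) : ℂ) * ((C.inChart e).piv k n (e p) : ℂ) *
          pd n (fun x => a (e.symm x)) (e p) := by
    have e1 : ∑ q : Fin (2 * m + 1) × Fin (2 * m + 1), ∑ r : Fin (2 * m + 1) × Fin (2 * m + 1),
        ((C.inChart e).lieGinv q.1 q.2 (e p) : ℂ) *
          ((C.inChart e).lcOmega q.1 q.2 r.1 (e p) : ℂ) * ((C.inChart e).piv r.1 r.2 (e p) : ℂ) *
          pd r.2 (fun x => a (e.symm x)) (e p) =
        ∑ r : Fin (2 * m + 1) × Fin (2 * m + 1), ∑ q : Fin (2 * m + 1) × Fin (2 * m + 1),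
        ((C.inChart e).lieGinv q.1 q.2 (e p) : ℂ) *
          ((C.inChart e).lcOmega q.1 q.2 r.1 (e p) : ℂ) * ((C.inChart e).piv r.1 r.2 (e p) : ℂ) *
          pd r.2 (fun x => a (e.symm x)) (e p) := Finset.sum_comm
    simp only [Fintype.sum_prod_type] at e1
    rw [e1]
    refine Finset.sum_congr rfl fun k _ => Finset.sum_congr rfl fun n _ => ?_
    rw [LocalFields.lieOmega]
    push_cast
    simp only [Finset.mul_sum, Finset.sum_mul]
    exact Finset.sum_congr rfl fun i _ => Finset.sum_congr rfl fun j _ => by ring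
  rw [hΩ]
  ring

/-- The Killing condition is stated for the metric and `Δ₁` involves its inverse; `lieGinv_eq` and
`lieMetric_eq` relate the two. -/
theorem ContactMetricStructure.IsKContact.lieGinv_eq_zero {C : ContactMetricStructure m M}
    (hC : C.IsKContact) (he : e ∈ IsManifold.maximalAtlas (𝓡 (2 * m + 1)) ∞ M)
    {x : Coord (2 * m + 1)} (hx : x ∈ e.target) (i j : Fin (2 * m + 1)) :
    (C.inChart e).lieGinv i j x = 0 := by
  have h := C.isContactMetricOn he
  have h1 : (Matrix.of fun i j => (C.inChart e).lieMetric i j x) = 0 := by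
    ext i j
    exact hC e he x hx i j
  have h2 := h.lieGinv_eq hx
  rw [← h.lieMetric_eq hx, h1, mul_zero, zero_mul, neg_zero] at h2
  exact congrFun (congrFun h2 i) j

end WickContact
end

theorem proposition4p1 {m : ℕ} {M : Type*} [TopologicalSpace M]
    [ChartedSpace (WickContact.Coord (2 * m + 1)) M] [IsManifold (𝓡 (2 * m + 1)) ∞ M]
    (C : WickContact.ContactMetricStructure m M) :
    (∀ e ∈ IsManifold.maximalAtlas (𝓡 (2 * m + 1)) ∞ M,
      ∀ (a : C^∞⟮𝓡 (2 * m + 1), M; 𝓘(ℝ, ℂ), ℂ⟯), ∀ p ∈ e.source,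
        C.DeltaCoeff 0 e a p = C.reebDeriv a p ∧
        C.DeltaCoeff 1 e a p =
          -(1 / 4) * (∑ i, ∑ j, ((C.inChart e).lieGinv i j (e p) : ℂ) *
              (C.inChart e).hess i j (fun x => a (e.symm x)) (e p))
          + (1 / 8) * (∑ i, ∑ j, ∑ k, ∑ n, ((C.inChart e).lieGinv i j (e p) : ℂ) *
              ((C.inChart e).lcOmega i j k (e p) : ℂ) * ((C.inChart e).piv k n (e p) : ℂ) *
              WickContact.pd n (fun x => a (e.symm x)) (e p))) ∧
    (C.IsKContact →
      (∀ e ∈ IsManifold.maximalAtlas (𝓡 (2 * m + 1)) ∞ M,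
        ∀ (a : C^∞⟮𝓡 (2 * m + 1), M; 𝓘(ℝ, ℂ), ℂ⟯), ∀ p ∈ e.source,
          C.DeltaCoeff 1 e a p = 0) ∧
      (∀ a₀ : C^∞⟮𝓡 (2 * m + 1), M; 𝓘(ℝ, ℂ), ℂ⟯,
        (∀ p, C.reebDeriv a₀ p = 0) → C.QuantizableToFirstOrder a₀)) := by
  have hK : C.IsKContact → ∀ e ∈ IsManifold.maximalAtlas (𝓡 (2 * m + 1)) ∞ M,
      ∀ (a : C^∞⟮𝓡 (2 * m + 1), M; 𝓘(ℝ, ℂ), ℂ⟯), ∀ p ∈ e.source, C.DeltaCoeff 1 e a p = 0 := by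
    intro hC e he a p hp
    rw [C.DeltaCoeff_one he a hp]
    simp [hC.lieGinv_eq_zero he (e.map_source hp)]
  -- As `Δ₁ = 0`, no correction is required and `a₁ = 0` works.
  refine ⟨fun e he a p hp => ⟨C.DeltaCoeff_zero he a hp, C.DeltaCoeff_one he a hp⟩,
    fun hC => ⟨hK hC, fun a₀ ha₀ => ⟨0, fun e he p hp k hk => ?_⟩⟩⟩
  have h0 : (fun l : ℕ => if l = 0 then a₀ else if l = 1 then
      (0 : C^∞⟮𝓡 (2 * m + 1), M; 𝓘(ℝ, ℂ), ℂ⟯) else 0) = fun l => if l = 0 then a₀ else 0 := by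
    simp
  rw [h0]
  change C.DeltaCoeff k e a₀ p = 0
  interval_cases k
  · rw [C.DeltaCoeff_zero he a₀ hp, ha₀]
  · exact hK hC e he a₀ p hp
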